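/- Let $M^s\in\mathbb C^{d_M\times d_M}$, $s=1,\dots,d_s$, satisfy $\sum_s M^{s\dagger}M^s=\mathbb 1$, and let $\sigma$ be a full-rank density operator with $\sum_s M^s\sigma M^{s\dagger}=\sigma$; let $\sigma_{\min}>0$ be its smallest eigenvalue. Let $V_n=\sum_{s_1,\dots,s_n}|s_n\cdots s_1\rangle\otimes M^{s_n}\cdots M^{s_1}$, and for consecutive regions $A,B,C$ of a spin chain let $\rho_{ABC}=\mathrm{tr}_M\big(V_CV_BV_A\,\sigma\,V_A^\dagger V_B^\dagger V_C^\dagger\big)$, with $V_R=V_{|R|}$, be the marginal of the infinite uniform matrix product state (iuMPS). Let $\mathcal E(X)=\sum_sM^sXM^{s\dagger}$, with transfer matrix $E=\sum_s M^s\otimes\overline{M^s}$. Let $P$ be the spectral projector of $E$ onto the span of the eigenvectors with eigenvalue of modulus $1$ (along all other generalized eigenspaces), $\tilde E=PEP$, and $\tilde{\mathcal E}$ the map represented by $\tilde E$. Let $\nu_{\rm gap}$ be the largest modulus of an eigenvalue of $E$ of modulus less than $1$, and let $K+1$ be the largest dimension of a Jordan block of $E$ for an eigenvalue of modulus $\nu_{\rm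 gap}$ (if there is no such eigenvalue, $\nu_{\rm gap}=0$ and $K=0$). For a Jordan decomposition $E=SJS^{-1}$ put $c_2=(K+1)(e/K)^K\|S\|\,\|S^{-1}\|$ (with $(e/K)^K=1$ for $K=0$), $\|\cdot\|$ being the operator norm. Then there are nonzero, mutually orthogonal projections $\Pi^\alpha_k$ on $\mathbb C^{d_M}$ ($\alpha=1,\dots,N$, $k\in\mathbb Z/p_\alpha$, $p_\alpha\ge1$) with $\sum_{\alpha,k}\Pi^\alpha_k=\mathbb 1$ and $\sigma=\sum_{\alpha,k}\Pi^\alpha_k\sigma\Pi^\alpha_k$ such that, with $\Pi^\alpha=\sum_k\Pi^\alpha_k$, $$\tilde{\mathcal E}(X)=\frac{p_\alpha}{\mathrm{tr}(\Pi^\alpha\sigma)}\sum_{k}\mathrm{tr}(\Pi^\alpha_kX\Pi^\alpha_k)\,\Pi^\alpha_{k+1}\sigma\Pi^\alpha_{k+1}\qquad\text{whenever } X=\Pi^\alpha X\Pi^\alpha .$$ Moreover there are $n_0>K$ and a constant $c_0$, depending only on $(M,\sigma)$ and the choice of these projections, such that for every $|B|\ge n_0$ there is an isometry $\tilde V_B:\mathbb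 C^{d_M}\to(\mathbb C^{d_s})^{\otimes|B|}\otimes\mathbb C^{d_M}$ dilating the peripheral channel, $\mathrm{tr}_B(\tilde V_BX\tilde V_B^\dagger)=\tilde{\mathcal E}^{|B|}(X)$ for all $X$, with the following properties for all sizes of $A$ and $C$. The operator $\tilde\rho_{ABC}=\mathrm{tr}_M\big(V_C\tilde V_BV_A\,\sigma\,V_A^\dagger\tilde V_B^\dagger V_C^\dagger\big)$ is a quantum Markov chain, i.e. a density operator with $I(A:C|B)=0$; and with $d_{M_\alpha}=\mathrm{rank}\,\Pi^\alpha$ and $\|\cdot\|_1$ the trace norm: 1. $\|\rho_{ABC}-\tilde\rho_{ABC}\|_1\le c_0\,|B|^K\nu_{\rm gap}^{|B|-K}$; 2. (linearity in the channel distance) $\|\rho_{ABC}-\tilde\rho_{ABC}\|_1$ is at most $\max_\alpha\sqrt{d_{M_\alpha}^3/p_\alpha}\,\sqrt{2/\sigma_{\min}}\;\|E^{|B|}-\tilde E^{|B|}\|$ and at most $d_M\sqrt{2d_M/\sigma_{\min}}\;\|E^{|B|}-\tilde E^{|B|}\|$; 3. for every Jordan decomposition of $E$, $\|\rho_{ABC}-\tilde\rho_{ABC}\|_1$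 is at most $\max_\alpha\sqrt{d_{M_\alpha}^3/p_\alpha}\;c_2\sqrt{2/\sigma_{\min}}\;|B|^K\nu_{\rm gap}^{|B|-K}$ and at most $c_2d_M\sqrt{2d_M/\sigma_{\min}}\;|B|^K\nu_{\rm gap}^{|B|-K}$. In particular this holds in the injective case, where $\sigma$ is the only eigenvector of $\mathcal E$ (up to scalars) with eigenvalue of modulus $1$. -/

import Mathlib

open scoped Matrix Kronecker ComplexOrder Matrix.Norms.L2Operator

noncomputable section

namespace MPS

/-! ### Finite-dimensional quantum states -/

section States

variable {n α β γ : Type} [Fintype n] [DecidableEq n] [Fintype α] [DecidableEq α]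
  [Fintype β] [DecidableEq β] [Fintype γ] [DecidableEq γ]

/-- The trace norm `‖A‖₁ = tr √(A† A)`: the sum of the singular values of `A`. -/
def traceNorm (A : Matrix n n ℂ) : ℝ :=
  ∑ i, Real.sqrt ((Matrix.isHermitian_conjTranspose_mul_self A).eigenvalues i)

/-- A density operator: positive semidefinite of trace one. -/
def IsDensity (ρ : Matrix n n ℂ) : Prop := ρ.PosSemidef ∧ ρ.trace = 1

open Classical in
/-- The von Neumann entropy `S(ρ) = -tr (ρ ln ρ) = ∑ -λ ln λ` of a Hermitian matrix
(it is only applied to density operators). -/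
def entropy (ρ : Matrix n n ℂ) : ℝ :=
  if h : ρ.IsHermitian then ∑ i, Real.negMulLog (h.eigenvalues i) else 0

/-- The reduced operator on `AB` of an operator on `ABC`. -/
def margAB (ρ : Matrix (α × β × γ) (α × β × γ) ℂ) : Matrix (α × β) (α × β) ℂ :=
  fun u v => ∑ z, ρ (u.1, u.2, z) (v.1, v.2, z)

/-- The reduced operator on `BC` of an operator on `ABC`. -/
def margBC (ρ : Matrix (α × β × γ) (α × β × γ) ℂ) : Matrix (β × γ) (β × γ) ℂ :=
  fun u v => ∑ x, ρ (x, u.1, u.2) (x, v.1, v.2)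

/-- The reduced operator on `B` of an operator on `ABC`. -/
def margB (ρ : Matrix (α × β × γ) (α × β × γ) ℂ) : Matrix β β ℂ :=
  fun y y' => ∑ x, ∑ z, ρ (x, y, z) (x, y', z)

/-- The quantum conditional mutual information
`I(A:C|B) = S(ρ_AB) + S(ρ_BC) - S(ρ_ABC) - S(ρ_B)`. -/
def qcmi (ρ : Matrix (α × β × γ) (α × β × γ) ℂ) : ℝ :=
  entropy (margAB ρ) + entropy (margBC ρ) - entropy ρ - entropy (margB ρ)

/-- A quantum Markov chain `A - B - C`: a density operator with `I(A:C|B) = 0`. -/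
def IsQuantumMarkovChain (ρ : Matrix (α × β × γ) (α × β × γ) ℂ) : Prop :=
  IsDensity ρ ∧ qcmi ρ = 0

end States

/-! ### Linear maps on matrices and their matrix representation -/

/-- The linear map on `d × d` matrices represented by the `d² × d²` matrix `T`:
`⟨j| 𝒯(|i⟩⟨i'|) |j'⟩ = T_{jj';ii'}`. -/
def mapOf {d : ℕ} (T : Matrix (Fin d × Fin d) (Fin d × Fin d) ℂ)
    (X : Matrix (Fin d) (Fin d) ℂ) : Matrix (Fin d) (Fin d) ℂ :=
  fun j j' => ∑ i, ∑ i', T (j, j') (i, i') * X i i'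

/-- The `k × k` Jordan block with eigenvalue `ν`: `ν` on the diagonal, `1` immediately above. -/
def jordanBlock (k : ℕ) (ν : ℂ) : Matrix (Fin k) (Fin k) ℂ :=
  fun i j => if i = j then ν else if (i : ℕ) + 1 = j then 1 else 0

/-- A Jordan decomposition `T = S (⨁ J_{kᵢ}(νᵢ)) S⁻¹`. -/
structure JordanDecomposition {n : Type} [Fintype n] [DecidableEq n] (T : Matrix n n ℂ) where
  /-- the number of blocks -/
  blocks : ℕ
  /-- the sizes of the blocks -/
  size : Fin blocks → ℕ
  /-- the eigenvalues of the blocks -/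
  eig : Fin blocks → ℂ
  /-- the change of basis -/
  S : Matrix n (Σ b, Fin (size b)) ℂ
  /-- its inverse -/
  Sinv : Matrix (Σ b, Fin (size b)) n ℂ
  mul_inv : S * Sinv = 1
  inv_mul : Sinv * S = 1
  decomp : T = S * Matrix.blockDiagonal' (fun b => jordanBlock (size b) (eig b)) * Sinv

/-! ### Spectral subspaces -/

section Spectral

variable {V : Type} [AddCommGroup V] [Module ℂ V]

/-- The span of the eigenvectors whose eigenvalue has modulus one. -/
def peripheralSpace (f : Module.End ℂ V) : Submodule ℂ V :=
  Submodule.span ℂ {u | ∃ ν : ℂ, ‖ν‖ = 1 ∧ f u = ν • u}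

/-- The sum of the generalized eigenspaces of all the other eigenvalues. -/
def nonperipheralSpace (f : Module.End ℂ V) : Submodule ℂ V :=
  ⨆ ν ∈ {ν : ℂ | ‖ν‖ ≠ 1}, f.maxGenEigenspace ν

end Spectral

/-! ### Infinite uniform matrix product states -/

/-- An infinite uniform matrix product state with virtual dimension `d` and physical dimension
`ds`, in canonical form: matrices `M^s` with `∑ M^s† M^s = 1` together with a faithful density
operator `σ` fixed by the channel `X ↦ ∑ M^s X M^s†`. -/
structure IUMPS (d ds : ℕ) where
  /-- the matrices `M^s` -/
  M : Fin ds → Matrix (Fin d) (Fin d) ℂ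
  /-- the fixed point -/
  σ : Matrix (Fin d) (Fin d) ℂ
  canonical : ∑ s, (M s)ᴴ * M s = 1
  posDef : σ.PosDef
  trace_one : σ.trace = 1
  fixed : ∑ s, M s * σ * (M s)ᴴ = σ

namespace IUMPS

variable {d ds : ℕ} (Φ : IUMPS d ds)

/-- The product `M^{x_n} ⋯ M^{x_2} M^{x_1}` for a configuration `x` of `n` spins. -/
def word {n : ℕ} (x : Fin n → Fin ds) : Matrix (Fin d) (Fin d) ℂ :=
  (List.ofFn fun i => Φ.M (x i)).reverse.prod

/-- The operator `tr_M (V_C F_B V_A σ V_A† F_B† V_C†)` on the spins of three consecutive regions,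
where the matrices of the region `B` are given by the family `F`. -/
def blockState {a b c : ℕ} (F : (Fin b → Fin ds) → Matrix (Fin d) (Fin d) ℂ) :
    Matrix ((Fin a → Fin ds) × (Fin b → Fin ds) × (Fin c → Fin ds))
      ((Fin a → Fin ds) × (Fin b → Fin ds) × (Fin c → Fin ds)) ℂ :=
  fun u v => Matrix.trace
    ((Φ.word u.2.2 * F u.2.1 * Φ.word u.1) * Φ.σ * (Φ.word v.2.2 * F v.2.1 * Φ.word v.1)ᴴ)

/-- The reduced density operator `ρ_ABC` of three consecutive regions of `a`, `b`, `c` spins. -/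
def rho (a b c : ℕ) :
    Matrix ((Fin a → Fin ds) × (Fin b → Fin ds) × (Fin c → Fin ds))
      ((Fin a → Fin ds) × (Fin b → Fin ds) × (Fin c → Fin ds)) ℂ :=
  Φ.blockState Φ.word

/-- The transfer matrix `E = ∑ M^s ⊗ conj M^s`; it represents the channel
`X ↦ ∑ M^s X M^s†`. -/
def E : Matrix (Fin d × Fin d) (Fin d × Fin d) ℂ :=
  ∑ s, Φ.M s ⊗ₖ (Φ.M s).map star

/-- The transfer matrix as an endomorphism. -/
def endE : Module.End ℂ (Fin d × Fin d → ℂ) := Matrix.toLin' Φ.E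

/-- `ν_gap`, the largest modulus of an eigenvalue of `E` of modulus smaller than one
(zero if there is no such eigenvalue). -/
def nuGap : ℝ := sSup {r | ∃ ν : ℂ, Φ.endE.HasEigenvalue ν ∧ ‖ν‖ < 1 ∧ r = ‖ν‖}

/-- `K`, where `K + 1` is the largest dimension of a Jordan block of `E` for an eigenvalue of
modulus `ν_gap` (zero if there is no such eigenvalue). The largest Jordan block for `ν` has
dimension the least `k` with `ker (E - ν)^k = ker (E - ν)^(k+1)`. -/
def K : ℕ := sSup {k | ∃ ν : ℂ, Φ.endE.HasEigenvalue ν ∧ ‖ν‖ = Φ.nuGap ∧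
  k = Φ.endE.maxGenEigenspaceIndex ν - 1}

/-- `σ_min`, the smallest eigenvalue of `σ`. -/
def sigmaMin : ℝ := ⨅ i, Φ.posDef.isHermitian.eigenvalues i

lemma exists_kraus (n : ℕ) : ∃ (ι : Type) (_ : Fintype ι)
    (A : ι → Matrix (Fin d) (Fin d) ℂ), ∑ i, (A i)ᴴ * A i = 1 ∧
      Φ.E ^ n = ∑ i, A i ⊗ₖ (A i).map star := by
  induction n with
  | zero =>
    refine ⟨Unit, inferInstance, fun _ => 1, by simp, ?_⟩
    simp [Matrix.map_one]
  | succ n ih =>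
    obtain ⟨ι, _, A, hA, hE⟩ := ih
    refine ⟨ι × Fin ds, inferInstance, fun p => A p.1 * Φ.M p.2, ?_, ?_⟩
    · rw [Fintype.sum_prod_type_right]
      rw [← Φ.canonical]
      refine Finset.sum_congr rfl fun s _ => ?_
      calc ∑ i, (A i * Φ.M s)ᴴ * (A i * Φ.M s)
          = (Φ.M s)ᴴ * (∑ i, (A i)ᴴ * A i) * Φ.M s := by
            simp [Matrix.mul_sum, Matrix.sum_mul, Matrix.conjTranspose_mul, Matrix.mul_assoc]
        _ = _ := by rw [hA, Matrix.mul_one]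
    · rw [pow_succ, hE, E, Finset.sum_mul_sum, Fintype.sum_prod_type]
      refine Finset.sum_congr rfl fun i _ => Finset.sum_congr rfl fun s _ => ?_
      rw [← Matrix.mul_kronecker_mul]
      congr 1
      ext j k
      simp [Matrix.mul_apply]

lemma norm_pow_apply_le (n : ℕ) (p q : Fin d × Fin d) : ‖(Φ.E ^ n) p q‖ ≤ 1 := by
  obtain ⟨ι, _, A, hA, hE⟩ := Φ.exists_kraus n
  have key : ∀ j k : Fin d, ∑ i, ‖A i j k‖ ^ 2 ≤ 1 := by
    intro j k
    have h1 : (∑ i, ∑ l, ‖A i l k‖ ^ 2 : ℝ) = 1 := by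
      have := congrFun (congrFun hA k) k
      simp only [Matrix.sum_apply, Matrix.mul_apply, Matrix.conjTranspose_apply,
        Matrix.one_apply_eq] at this
      have h2 : ((∑ i, ∑ l, ‖A i l k‖ ^ 2 : ℝ) : ℂ) = 1 := by
        rw [← this]
        push_cast
        refine Finset.sum_congr rfl fun i _ => Finset.sum_congr rfl fun l _ => ?_
        rw [← Complex.conj_mul']
        rfl
      exact_mod_cast h2
    rw [← h1]
    refine Finset.sum_le_sum fun i _ => ?_
    exact Finset.single_le_sum (f := fun l => ‖A i l k‖ ^ 2) (fun l _ => by positivity)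
      (Finset.mem_univ j)
  rw [hE, Matrix.sum_apply]
  calc ‖∑ i, (A i ⊗ₖ (A i).map star) p q‖
      ≤ ∑ i, ‖(A i ⊗ₖ (A i).map star) p q‖ := norm_sum_le _ _
    _ ≤ ∑ i, (‖A i p.1 q.1‖ ^ 2 + ‖A i p.2 q.2‖ ^ 2) / 2 := by
        refine Finset.sum_le_sum fun i _ => ?_
        simp only [Matrix.kroneckerMap_apply, Matrix.map_apply, norm_mul, norm_star]
        nlinarith [sq_nonneg (‖A i p.1 q.1‖ - ‖A i p.2 q.2‖)]
    _ = ((∑ i, ‖A i p.1 q.1‖ ^ 2) + ∑ i, ‖A i p.2 q.2‖ ^ 2) / 2 := by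
        rw [← Finset.sum_add_distrib, Finset.sum_div]
    _ ≤ 1 := by linarith [key p.1 q.1, key p.2 q.2]

/-- Peripheral eigenvalues of the transfer matrix have no nontrivial Jordan blocks. -/
lemma maxGenEigenspace_eq {ν : ℂ} (hν : ‖ν‖ = 1) :
    Φ.endE.maxGenEigenspace ν = Φ.endE.eigenspace ν := by
  set f : Module.End ℂ (Fin d × Fin d → ℂ) := Φ.endE - algebraMap ℂ _ ν with hf
  have hfE : ∀ v, Φ.endE v = ν • v + f v := by
    intro v
    simp [hf, Module.algebraMap_end_apply]
  have hbound : ∀ (v : Fin d × Fin d → ℂ) (n : ℕ) p, ‖(Φ.endE ^ n) v p‖ ≤ ∑ q, ‖v q‖ := by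
    intro v n p
    have : (Φ.endE ^ n) v = (Φ.E ^ n) *ᵥ v := by
      rw [endE, ← Matrix.toLin'_pow, Matrix.toLin'_apply]
    rw [this, Matrix.mulVec, dotProduct]
    refine (norm_sum_le _ _).trans (Finset.sum_le_sum fun q _ => ?_)
    rw [norm_mul]
    exact mul_le_of_le_one_left (norm_nonneg _) (Φ.norm_pow_apply_le n p q)
  have step : ∀ v, f (f v) = 0 → f v = 0 := by
    intro v hv
    have hw : Φ.endE (f v) = ν • f v := by rw [hfE, hv, add_zero]
    have hpow : ∀ n : ℕ, (Φ.endE ^ (n + 1)) v = ν ^ (n + 1) • v + ((n + 1 : ℂ) * ν ^ n) • f v := by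
      intro n
      induction n with
      | zero => simp [hfE v]
      | succ n ih =>
        rw [pow_succ', Module.End.mul_apply, ih, map_add, map_smul, map_smul, hw, hfE v]
        ext p
        simp only [Pi.add_apply, Pi.smul_apply, smul_eq_mul]
        push_cast
        ring
    ext p
    by_contra hp
    have hpos : 0 < ‖f v p‖ := norm_pos_iff.mpr hp
    obtain ⟨n, hn⟩ := exists_nat_gt ((∑ q, ‖v q‖ + ‖v p‖) / ‖f v p‖)
    rw [div_lt_iff₀ hpos] at hn
    have h1 := hbound v (n + 1) p
    rw [hpow n] at h1
    have h2 : ‖((n + 1 : ℂ) * ν ^ n) * f v p‖ = (n + 1) * ‖f v p‖ := by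
      rw [norm_mul, norm_mul, norm_pow, hν, one_pow, mul_one]
      congr 1
      exact_mod_cast Complex.norm_natCast (n + 1)
    have h3 : ‖ν ^ (n + 1) * v p‖ = ‖v p‖ := by
      rw [norm_mul, norm_pow, hν, one_pow, one_mul]
    have h4 := norm_sub_le (ν ^ (n + 1) * v p + ((n + 1 : ℂ) * ν ^ n) * f v p)
      (ν ^ (n + 1) * v p)
    rw [add_sub_cancel_left, h2, h3] at h4
    simp only [Pi.add_apply, Pi.smul_apply, smul_eq_mul] at h1
    nlinarith
  apply le_antisymm _ Module.End.eigenspace_le_maxGenEigenspace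
  intro v hv
  rw [Module.End.mem_maxGenEigenspace] at hv
  obtain ⟨k, hk⟩ := hv
  have hk' : (f ^ k) v = 0 := by
    rw [hf, Algebra.algebraMap_eq_smul_one]; exact hk
  have main : ∀ k : ℕ, ∀ v, (f ^ k) v = 0 → f v = 0 := by
    intro k
    induction k with
    | zero => intro v h; simp at h; simp [h]
    | succ k ih =>
      intro v h
      rw [pow_succ, Module.End.mul_apply] at h
      exact step v (ih _ h)
  have := main k v hk'
  rw [Module.End.mem_eigenspace_iff, hfE, this, add_zero]

lemma peripheralSpace_eq :
    peripheralSpace Φ.endE = ⨆ ν ∈ {ν : ℂ | ‖ν‖ = 1}, Φ.endE.maxGenEigenspace ν := by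
  apply le_antisymm
  · rw [peripheralSpace, Submodule.span_le]
    rintro u ⟨ν, hν, hu⟩
    have : u ∈ Φ.endE.maxGenEigenspace ν := by
      rw [Φ.maxGenEigenspace_eq hν, Module.End.mem_eigenspace_iff]
      exact hu
    exact (le_iSup₂_of_le (f := fun (ν : ℂ) (_ : ν ∈ {ν : ℂ | ‖ν‖ = 1}) =>
      Φ.endE.maxGenEigenspace ν) ν hν le_rfl) this
  · refine iSup₂_le fun ν hν => ?_
    rw [Φ.maxGenEigenspace_eq hν]
    intro u hu
    exact Submodule.subset_span ⟨ν, hν, Module.End.mem_eigenspace_iff.mp hu⟩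

lemma isCompl_peripheral :
    IsCompl (peripheralSpace Φ.endE) (nonperipheralSpace Φ.endE) := by
  rw [peripheralSpace_eq, nonperipheralSpace]
  constructor
  · refine (Module.End.independent_maxGenEigenspace Φ.endE).disjoint_biSup_biSup ?_
    rw [Set.disjoint_left]
    intro ν h1 h2
    exact h2 h1
  · rw [codisjoint_iff, eq_top_iff, ← Module.End.iSup_maxGenEigenspace_eq_top Φ.endE]
    refine iSup_le fun ν => ?_
    by_cases h : ‖ν‖ = 1
    · exact le_sup_of_le_left (le_iSup₂_of_le (f := fun (ν : ℂ) (_ : ν ∈ {ν : ℂ | ‖ν‖ = 1}) =>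
        Φ.endE.maxGenEigenspace ν) ν h le_rfl)
    · exact le_sup_of_le_right (le_iSup₂_of_le (f := fun (ν : ℂ) (_ : ν ∈ {ν : ℂ | ‖ν‖ ≠ 1}) =>
        Φ.endE.maxGenEigenspace ν) ν h le_rfl)

/-- The spectral projector `P` of `E` onto the span of the eigenvectors of modulus-one
eigenvalues, along the other generalized eigenspaces. -/
def P : Matrix (Fin d × Fin d) (Fin d × Fin d) ℂ :=
  LinearMap.toMatrix' (Submodule.projection _ _ Φ.isCompl_peripheral)

/-- The peripheral part `Ẽ = P E P` of the transfer matrix. -/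
def Eper : Matrix (Fin d × Fin d) (Fin d × Fin d) ℂ := Φ.P * Φ.E * Φ.P

/-- The matrices `F` on a region of `b` spins form a dilation of the `b`-th power of the
peripheral channel: `F = ∑_y |y⟩ ⊗ F_y` is an isometry and `Ẽ^b(X) = tr_B (F X F†)`. -/
def IsPeripheralDilation {b : ℕ} (F : (Fin b → Fin ds) → Matrix (Fin d) (Fin d) ℂ) : Prop :=
  ∑ y, (F y)ᴴ * F y = 1 ∧ ∀ X, ∑ y, F y * X * (F y)ᴴ = mapOf (Φ.Eper ^ b) X

/-- The orthogonal projections `Π^α_k`, `k` modulo `p_α`, split the virtual space into the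
components `Π^α = ∑_k Π^α_k` of the peripheral channel, with periods `p_α`: they are nonzero,
mutually orthogonal and sum to one, `σ` is block diagonal, and on the component `α` the
peripheral channel is
`X ↦ (p_α / tr (Π^α σ)) ∑_k tr (Π^α_k X Π^α_k) Π^α_{k+1} σ Π^α_{k+1}`. -/
structure IsPeripheralDecomposition {N : ℕ} (p : Fin N → ℕ)
    (Q : ∀ α, Fin (p α) → Matrix (Fin d) (Fin d) ℂ) : Prop where
  period_pos : ∀ α, 1 ≤ p α
  hermitian : ∀ α k, (Q α k).IsHermitian
  idempotent : ∀ α k, Q α k * Q α k = Q α k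
  ne_zero : ∀ α k, Q α k ≠ 0
  orthogonal : ∀ α k α' k', (⟨α, k⟩ : Σ α, Fin (p α)) ≠ ⟨α', k'⟩ → Q α k * Q α' k' = 0
  sum_eq_one : ∑ α, ∑ k, Q α k = 1
  sigma_eq : Φ.σ = ∑ α, ∑ k, Q α k * Φ.σ * Q α k
  channel : ∀ α X, (∑ k, Q α k) * X * (∑ k, Q α k) = X →
    mapOf Φ.Eper X = ((p α : ℂ) / ((∑ k, Q α k) * Φ.σ).trace) •
      ∑ k, (Q α k * X * Q α k).trace •
        (Q α (finRotate (p α) k) * Φ.σ * Q α (finRotate (p α) k))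

/-- The constant `c₂ = (K+1) (e/K)^K ‖S‖ ‖S⁻¹‖` of a Jordan decomposition of `E`
(with `(e/K)^K = 1` for `K = 0`). -/
def c₂ (J : JordanDecomposition Φ.E) : ℝ :=
  (Φ.K + 1) * (Real.exp 1 / Φ.K) ^ Φ.K * (‖J.S‖ * ‖J.Sinv‖)

end IUMPS

end MPS

end

set_option linter.unusedSectionVars false

noncomputable section

namespace MPS
/-! ### Positivity -/

-- The peripheral spectrum is governed by the twisted commutants: the matrices Z with Z M^s = ν M^s
-- Z for all s, where |ν| = 1. Expanding the trace of ∑_s (Z M^s - ν M^s Z) σ (Z M^s - ν M^s Z)†,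
-- with the channel trace preserving and σ a faithful fixed point, shows that the eigenvectors of
-- the channel for ν̄ are exactly the matrices Zσ with Z twisted by ν (`mem_twisted_of_chan`,
-- `chan_mul_sigma`). The functionals X ↦ tr(Z†X) annihilate the nonperipheral generalized
-- eigenspaces and separate the points of the peripheral space, so they determine the powers of Ẽ
-- (`mapOf_Eper_pow`).
--
-- Minimal projections commuting with all M^s, M^s† and σ split the virtual space into blocks.
-- Inside a block every twisted commutant commutes with σ (`IsBlock.commute_sigma_of_mem`), those
-- with ν = 1 are scalars, and the phases that occur form a finite cyclic group. A unitary U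
-- carrying a generating phase has spectral projections Π^α_k, which every M^s shifts cyclically
-- (`IsBlock.exists_cyclicFamily`). Distinct blocks may be unitarily equivalent up to a phase, in
-- which case Ẽ preserves coherences between them; `NormalForm` therefore records class
-- representatives and intertwiners.
--
-- For a region B of b sites, take the matrix units from cycle position k to k + b of a
-- representative block, amplify them to all equivalent blocks with the right phases, and normalise.
-- The resulting K_g are Kraus operators of Ẽ^b (`sum_kraus_mul`), and every word M^{s_b}⋯M^{s_1} is
-- a combination ∑_g v_{gy} K_g (`word_eq_sum_kraus`). Hence E^b - Ẽ^b has coefficient matrix vv† -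
-- 1 in the K_g. When this is small, u = (vv†)^{-1/2} v satisfies uu† = 1, and F_y = ∑_g u_{gy} K_g
-- is the required dilation (`exists_isometric_near`).
--
-- The estimate is linear because v - u is controlled directly by vv† - 1. The K_g are orthogonal
-- for (K, K') ↦ tr(ω K†K'), where ω = ∑_α tr(Π^α σ) Π^α ≥ σ, with squared norms at least σ_min.
-- Realigning indices bounds the weighted Frobenius norm of vv† - 1 by ‖E^b - Ẽ^b‖ tr ω
-- (`sum_wt_le`). Comparing purifications then bounds the trace distance by √(2/σ_min) tr ω ‖E^b -
-- Ẽ^b‖, uniformly in A and C; and tr ω, an average of the block dimensions, is at most each of the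
-- stated prefactors.
--
-- The Markov property comes from the index g = (κ, i, j): region A couples only to the input index
-- i, region C only to the output index j, and coherences between different labels κ vanish. So ρ̃
-- is, up to an isometry on B, a direct sum of products L_κ ⊗ R_κ, for which the four entropies
-- cancel (`qcmi_eq_zero`). Finally ‖E^b - Ẽ^b‖ is bounded through powers of Jordan blocks
-- (`exists_bound_pow_sub`, `exists_bound_jordan`).

lemma eq_zero_of_trace_mul_mul_conjTranspose {m n : Type*} [Fintype m] [Fintype n]
    {σ : Matrix n n ℂ} (hσ : σ.PosDef) {A : Matrix m n ℂ}
    (h : (A * σ * Aᴴ).trace = 0) : A = 0 := by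
  classical
  have hp : (A * σ * Aᴴ).PosSemidef := hσ.posSemidef.mul_mul_conjTranspose_same A
  have h0 := hp.trace_eq_zero_iff.mp h
  rw [← Matrix.conjTranspose_eq_zero]
  refine Matrix.ext_of_mulVec_single fun i => ?_
  rw [Matrix.zero_mulVec]
  set x : m → ℂ := Pi.single i 1
  by_contra hx
  have h1 := hσ.dotProduct_mulVec_pos hx
  have h2 : star (Aᴴ *ᵥ x) ⬝ᵥ σ *ᵥ Aᴴ *ᵥ x = star x ⬝ᵥ (A * σ * Aᴴ) *ᵥ x := by
    rw [Matrix.star_mulVec, Matrix.conjTranspose_conjTranspose, ← Matrix.dotProduct_mulVec,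
      Matrix.mulVec_mulVec, Matrix.mulVec_mulVec, Matrix.mul_assoc]
  rw [h2, h0] at h1
  simp at h1

lemma eq_zero_of_sum_trace {ι m n : Type*} [Fintype ι] [Fintype m] [Fintype n]
    {σ : Matrix n n ℂ} (hσ : σ.PosDef) {A : ι → Matrix m n ℂ}
    (h : ∑ i, (A i * σ * (A i)ᴴ).trace = 0) (i : ι) : A i = 0 := by
  refine eq_zero_of_trace_mul_mul_conjTranspose hσ ?_
  have hp : ∀ j ∈ Finset.univ, 0 ≤ (A j * σ * (A j)ᴴ).trace := fun j _ =>
    (hσ.posSemidef.mul_mul_conjTranspose_same (A j)).trace_nonneg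
  exact (Finset.sum_eq_zero_iff_of_nonneg hp).mp h i (Finset.mem_univ _)

lemma eq_zero_of_trace_conjTranspose_mul {m n : Type*} [Fintype m] [Fintype n]
    {A : Matrix m n ℂ} (h : (Aᴴ * A).trace = 0) : A = 0 := by
  classical
  have := (Matrix.posSemidef_conjTranspose_mul_self A).trace_eq_zero_iff.mp h
  exact Matrix.conjTranspose_mul_self_eq_zero.mp this

namespace IUMPS

variable {d ds : ℕ} (Φ : IUMPS d ds)

/-! ### The channel and the twisted commutants -/

/-- The channel `X ↦ ∑ M^s X M^s†`. -/
def chan : Matrix (Fin d) (Fin d) ℂ →ₗ[ℂ] Matrix (Fin d) (Fin d) ℂ where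
  toFun X := ∑ s, Φ.M s * X * (Φ.M s)ᴴ
  map_add' X Y := by simp [Matrix.mul_add, Matrix.add_mul, Finset.sum_add_distrib]
  map_smul' c X := by simp [Finset.smul_sum]

lemma chan_apply (X : Matrix (Fin d) (Fin d) ℂ) :
    Φ.chan X = ∑ s, Φ.M s * X * (Φ.M s)ᴴ := rfl

/-- The matrices `Z` with `Z M^s = ν M^s Z` for all `s`. -/
def twisted (ν : ℂ) : Submodule ℂ (Matrix (Fin d) (Fin d) ℂ) where
  carrier := {Z | ∀ s, Z * Φ.M s = ν • (Φ.M s * Z)}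
  add_mem' h h' s := by simp [Matrix.add_mul, Matrix.mul_add, h s, h' s]
  zero_mem' s := by simp
  smul_mem' c Z h s := by
    rw [Matrix.smul_mul, h s, Matrix.mul_smul, smul_comm]

variable {Φ}

lemma conj_mul_of_norm {ν : ℂ} (hν : ‖ν‖ = 1) : star ν * ν = 1 := by
  have := Complex.conj_mul' ν
  rw [hν] at this
  simpa using this

lemma mul_conj_of_norm {ν : ℂ} (hν : ‖ν‖ = 1) : ν * star ν = 1 := by
  rw [mul_comm, conj_mul_of_norm hν]

lemma norm_star_one {ν : ℂ} (hν : ‖ν‖ = 1) : ‖star ν‖ = 1 := by rw [norm_star, hν]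

lemma one_mem_twisted : (1 : Matrix (Fin d) (Fin d) ℂ) ∈ Φ.twisted 1 := by
  intro s; simp

lemma twisted_mul {ν μ : ℂ} {Z W : Matrix (Fin d) (Fin d) ℂ} (hZ : Z ∈ Φ.twisted ν)
    (hW : W ∈ Φ.twisted μ) : Z * W ∈ Φ.twisted (ν * μ) := by
  intro s
  rw [Matrix.mul_assoc, hW s, Matrix.mul_smul, ← Matrix.mul_assoc, hZ s, Matrix.smul_mul,
    smul_smul, Matrix.mul_assoc, mul_comm]

/-- An equality case of the Schwarz inequality: the four terms of the expanded sum of squares all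
have trace ±tr(ZσZ†) and cancel, and faithfulness of σ makes every summand vanish. -/
lemma mem_twisted_of_chan {ν : ℂ} (hν : ‖ν‖ = 1) {Z : Matrix (Fin d) (Fin d) ℂ}
    (h : Φ.chan (Z * Φ.σ) = star ν • (Z * Φ.σ)) : Z ∈ Φ.twisted ν := by
  have hσh : Φ.σᴴ = Φ.σ := Φ.posDef.isHermitian
  have h' : Φ.chan (Φ.σ * Zᴴ) = ν • (Φ.σ * Zᴴ) := by
    have := congrArg Matrix.conjTranspose h
    simpa [chan_apply, Matrix.conjTranspose_sum, Matrix.conjTranspose_mul, hσh,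
      Matrix.mul_assoc] using this
  have h1 : ∑ s, (Z * Φ.M s - ν • (Φ.M s * Z)) * Φ.σ * (Z * Φ.M s - ν • (Φ.M s * Z))ᴴ =
      Z * Φ.chan Φ.σ * Zᴴ - ν • (Φ.chan (Z * Φ.σ) * Zᴴ) - star ν • (Z * Φ.chan (Φ.σ * Zᴴ))
        + Φ.chan (Z * Φ.σ * Zᴴ) := by
    simp only [chan_apply, Finset.sum_mul, Finset.mul_sum, Finset.smul_sum,
      ← Finset.sum_sub_distrib, ← Finset.sum_add_distrib]
    refine Finset.sum_congr rfl fun s _ => ?_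
    simp only [Matrix.conjTranspose_sub, Matrix.conjTranspose_smul, Matrix.conjTranspose_mul,
      Matrix.sub_mul, Matrix.mul_sub, Matrix.smul_mul, Matrix.mul_smul, smul_sub, smul_smul,
      Matrix.mul_assoc, mul_conj_of_norm hν, conj_mul_of_norm hν, one_smul]
    abel
  have h2 : (Φ.chan (Z * Φ.σ * Zᴴ)).trace = (Z * Φ.σ * Zᴴ).trace := by
    rw [chan_apply, Matrix.trace_sum]
    calc ∑ s, (Φ.M s * (Z * Φ.σ * Zᴴ) * (Φ.M s)ᴴ).trace
        = ∑ s, (((Φ.M s)ᴴ * Φ.M s) * (Z * Φ.σ * Zᴴ)).trace :=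
          Finset.sum_congr rfl fun s _ => by rw [Matrix.trace_mul_comm, ← Matrix.mul_assoc]
      _ = _ := by rw [← Matrix.trace_sum, ← Finset.sum_mul, Φ.canonical, Matrix.one_mul]
  have h3 : ∑ s, ((Z * Φ.M s - ν • (Φ.M s * Z)) * Φ.σ *
      (Z * Φ.M s - ν • (Φ.M s * Z))ᴴ).trace = 0 := by
    rw [← Matrix.trace_sum, h1, Matrix.trace_add, h2, h, h',
      show Φ.chan Φ.σ = Φ.σ from Φ.fixed]
    simp only [Matrix.trace_sub, Matrix.trace_smul, Matrix.smul_mul, Matrix.mul_smul, smul_smul,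
      mul_conj_of_norm hν, conj_mul_of_norm hν, one_smul, ← Matrix.mul_assoc]
    ring
  intro s
  exact sub_eq_zero.mp (eq_zero_of_sum_trace Φ.posDef h3 s)

/-- The same cancellation for the dual map, whose invariant state is X ↦ tr(Xσ). -/
lemma mem_twisted_of_dual {ν : ℂ} (hν : ‖ν‖ = 1) {Z : Matrix (Fin d) (Fin d) ℂ}
    (h : ∑ s, (Φ.M s)ᴴ * Z * Φ.M s = ν • Z) : Z ∈ Φ.twisted ν := by
  have h' : ∑ s, (Φ.M s)ᴴ * Zᴴ * Φ.M s = star ν • Zᴴ := by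
    have := congrArg Matrix.conjTranspose h
    simpa [Matrix.conjTranspose_sum, Matrix.conjTranspose_mul, Matrix.mul_assoc] using this
  have h1 : ∑ s, (Z * Φ.M s - ν • (Φ.M s * Z))ᴴ * (Z * Φ.M s - ν • (Φ.M s * Z)) =
      ∑ s, (Φ.M s)ᴴ * (Zᴴ * Z) * Φ.M s - ν • ((∑ s, (Φ.M s)ᴴ * Zᴴ * Φ.M s) * Z)
        - star ν • (Zᴴ * ∑ s, (Φ.M s)ᴴ * Z * Φ.M s)
        + Zᴴ * (∑ s, (Φ.M s)ᴴ * Φ.M s) * Z := by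
    simp only [Finset.sum_mul, Finset.mul_sum, Finset.smul_sum,
      ← Finset.sum_sub_distrib, ← Finset.sum_add_distrib]
    refine Finset.sum_congr rfl fun s _ => ?_
    simp only [Matrix.conjTranspose_sub, Matrix.conjTranspose_smul, Matrix.conjTranspose_mul,
      Matrix.sub_mul, Matrix.mul_sub, Matrix.smul_mul, Matrix.mul_smul, smul_sub, smul_smul,
      Matrix.mul_assoc, mul_conj_of_norm hν, conj_mul_of_norm hν, one_smul]
    abel
  have h3 : ∑ s, ((Z * Φ.M s - ν • (Φ.M s * Z)) * Φ.σ *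
      (Z * Φ.M s - ν • (Φ.M s * Z))ᴴ).trace = 0 := by
    have e1 : ∑ s, ((Z * Φ.M s - ν • (Φ.M s * Z)) * Φ.σ *
        (Z * Φ.M s - ν • (Φ.M s * Z))ᴴ).trace =
        ((∑ s, (Z * Φ.M s - ν • (Φ.M s * Z))ᴴ * (Z * Φ.M s - ν • (Φ.M s * Z))) * Φ.σ).trace := by
      rw [Finset.sum_mul, Matrix.trace_sum]
      exact Finset.sum_congr rfl fun s _ => by
        rw [Matrix.trace_mul_comm, Matrix.mul_assoc]
    have e2 : ((∑ s, (Φ.M s)ᴴ * (Zᴴ * Z) * Φ.M s) * Φ.σ).trace = (Zᴴ * Z * Φ.σ).trace := by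
      nth_rewrite 2 [← Φ.fixed]
      rw [Finset.sum_mul, Finset.mul_sum, Matrix.trace_sum, Matrix.trace_sum]
      refine Finset.sum_congr rfl fun s _ => ?_
      rw [Matrix.mul_assoc ((Φ.M s)ᴴ), Matrix.mul_assoc ((Φ.M s)ᴴ), Matrix.trace_mul_comm]
      simp only [Matrix.mul_assoc]
    rw [e1, h1, h, h', Φ.canonical]
    simp only [Matrix.sub_mul, Matrix.add_mul, Matrix.trace_sub, Matrix.trace_add, e2,
      Matrix.smul_mul, Matrix.mul_smul, smul_smul,
      mul_conj_of_norm hν, conj_mul_of_norm hν, one_smul, Matrix.mul_one]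
    ring
  intro s
  exact sub_eq_zero.mp (eq_zero_of_sum_trace Φ.posDef h3 s)

lemma dual_of_mem_twisted {ν : ℂ} {Z : Matrix (Fin d) (Fin d) ℂ} (h : Z ∈ Φ.twisted ν) :
    ∑ s, (Φ.M s)ᴴ * Z * Φ.M s = ν • Z := by
  calc ∑ s, (Φ.M s)ᴴ * Z * Φ.M s = ν • ((∑ s, (Φ.M s)ᴴ * Φ.M s) * Z) := by
        rw [Finset.sum_mul, Finset.smul_sum]
        refine Finset.sum_congr rfl fun s _ => ?_
        rw [Matrix.mul_assoc, h s, Matrix.mul_smul, Matrix.mul_assoc]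
    _ = _ := by rw [Φ.canonical, Matrix.one_mul]

/-- Not a formal adjoint, since taking adjoints of the twisted relation turns M^s into M^s†. The
dual eigenvalue equation is stable under adjoints and leads back to a relation with M^s. -/
lemma conjTranspose_mem_twisted {ν : ℂ} (hν : ‖ν‖ = 1) {Z : Matrix (Fin d) (Fin d) ℂ}
    (h : Z ∈ Φ.twisted ν) : Zᴴ ∈ Φ.twisted (star ν) := by
  refine mem_twisted_of_dual (norm_star_one hν) ?_
  have := congrArg Matrix.conjTranspose (dual_of_mem_twisted h)
  simpa [Matrix.conjTranspose_sum, Matrix.conjTranspose_mul, Matrix.mul_assoc] using this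

lemma mul_conjTranspose_of_mem_twisted {ν : ℂ} (hν : ‖ν‖ = 1) {Z : Matrix (Fin d) (Fin d) ℂ}
    (h : Z ∈ Φ.twisted ν) (s : Fin ds) : Z * (Φ.M s)ᴴ = star ν • ((Φ.M s)ᴴ * Z) := by
  have h1 := congrArg Matrix.conjTranspose (conjTranspose_mem_twisted hν h s)
  rw [Matrix.conjTranspose_mul, Matrix.conjTranspose_smul, Matrix.conjTranspose_mul,
    Matrix.conjTranspose_conjTranspose, star_star] at h1
  rw [h1, smul_smul, conj_mul_of_norm hν, one_smul]

lemma mul_eq_star_of_mem_twisted {ν : ℂ} (hν : ‖ν‖ = 1) {Z : Matrix (Fin d) (Fin d) ℂ}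
    (h : Z ∈ Φ.twisted ν) (s : Fin ds) : Φ.M s * Z = star ν • (Z * Φ.M s) := by
  rw [h s, smul_smul, conj_mul_of_norm hν, one_smul]

lemma chan_mul_mul {ν μ : ℂ} (hν : ‖ν‖ = 1) (hμ : ‖μ‖ = 1) {Z W : Matrix (Fin d) (Fin d) ℂ}
    (hZ : Z ∈ Φ.twisted ν) (hW : W ∈ Φ.twisted μ) (X : Matrix (Fin d) (Fin d) ℂ) :
    Φ.chan (Z * X * W) = (star ν * star μ) • (Z * Φ.chan X * W) := by
  rw [chan_apply, chan_apply, Finset.mul_sum, Finset.sum_mul, Finset.smul_sum]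
  refine Finset.sum_congr rfl fun s _ => ?_
  calc Φ.M s * (Z * X * W) * (Φ.M s)ᴴ = (Φ.M s * Z) * X * (W * (Φ.M s)ᴴ) := by
        simp only [Matrix.mul_assoc]
    _ = _ := by
        rw [mul_eq_star_of_mem_twisted hν hZ, mul_conjTranspose_of_mem_twisted hμ hW]
        simp only [Matrix.smul_mul, Matrix.mul_smul, smul_smul, Matrix.mul_assoc]
        rw [mul_comm]

lemma chan_sigma : Φ.chan Φ.σ = Φ.σ := Φ.fixed

lemma chan_mul_sigma {ν : ℂ} (hν : ‖ν‖ = 1) {Z : Matrix (Fin d) (Fin d) ℂ}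
    (hZ : Z ∈ Φ.twisted ν) : Φ.chan (Z * Φ.σ) = star ν • (Z * Φ.σ) := by
  have := chan_mul_mul hν norm_one hZ (one_mem_twisted (Φ := Φ)) Φ.σ
  simpa [chan_sigma] using this

lemma chan_sigma_mul {ν : ℂ} (hν : ‖ν‖ = 1) {Z : Matrix (Fin d) (Fin d) ℂ}
    (hZ : Z ∈ Φ.twisted ν) : Φ.chan (Φ.σ * Z) = star ν • (Φ.σ * Z) := by
  have := chan_mul_mul norm_one hν (one_mem_twisted (Φ := Φ)) hZ Φ.σ
  simpa [chan_sigma] using this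

lemma isUnit_det_sigma (Φ : IUMPS d ds) : IsUnit Φ.σ.det :=
  (Matrix.isUnit_iff_isUnit_det _).mp Φ.posDef.isUnit

lemma sigma_mul_inv (Φ : IUMPS d ds) : Φ.σ * Φ.σ⁻¹ = 1 :=
  Matrix.mul_nonsing_inv _ Φ.isUnit_det_sigma

lemma inv_mul_sigma (Φ : IUMPS d ds) : Φ.σ⁻¹ * Φ.σ = 1 :=
  Matrix.nonsing_inv_mul _ Φ.isUnit_det_sigma

/-- Both Zσ and σZ are eigenvectors of the channel, and σZ = (σZσ⁻¹)σ; so the twisted commutants are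
stable under the modular automorphism of σ. -/
lemma modular_mem_twisted {ν : ℂ} (hν : ‖ν‖ = 1) {Z : Matrix (Fin d) (Fin d) ℂ}
    (hZ : Z ∈ Φ.twisted ν) : Φ.σ * Z * Φ.σ⁻¹ ∈ Φ.twisted ν := by
  refine mem_twisted_of_chan hν ?_
  rw [Matrix.mul_assoc, inv_mul_sigma, Matrix.mul_one, chan_sigma_mul hν hZ]

lemma word_succ {n : ℕ} (x : Fin (n + 1) → Fin ds) :
    Φ.word x = Φ.word (fun i => x i.succ) * Φ.M (x 0) := by
  simp [word, List.ofFn_succ]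

lemma word_zero (x : Fin 0 → Fin ds) : Φ.word x = 1 := by simp [word]

lemma sum_word_succ {V : Type*} [AddCommMonoid V] {n : ℕ}
    (f : (Fin (n + 1) → Fin ds) → V) :
    ∑ x, f x = ∑ s, ∑ y : Fin n → Fin ds, f (Fin.cons s y) := by
  rw [← (Fin.consEquiv fun _ => Fin ds).sum_comp, Fintype.sum_prod_type]
  rfl

lemma word_cons {n : ℕ} (s : Fin ds) (y : Fin n → Fin ds) :
    Φ.word (Fin.cons s y : Fin (n + 1) → Fin ds) = Φ.word y * Φ.M s := by
  rw [word_succ]; simp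

lemma mul_word {ν : ℂ} {Z : Matrix (Fin d) (Fin d) ℂ} (hZ : Z ∈ Φ.twisted ν) {n : ℕ}
    (x : Fin n → Fin ds) : Z * Φ.word x = ν ^ n • (Φ.word x * Z) := by
  induction n with
  | zero => simp [word_zero]
  | succ n ih =>
    rw [word_succ, ← Matrix.mul_assoc, ih, Matrix.smul_mul, Matrix.mul_assoc, hZ, Matrix.mul_smul,
      smul_smul, Matrix.mul_assoc, pow_succ]

lemma sum_word_conjTranspose_mul (n : ℕ) :
    ∑ x : Fin n → Fin ds, (Φ.word x)ᴴ * Φ.word x = 1 := by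
  induction n with
  | zero => simp [word_zero]
  | succ n ih =>
    rw [sum_word_succ, ← Φ.canonical]
    refine Finset.sum_congr rfl fun s _ => ?_
    simp only [word_cons, Matrix.conjTranspose_mul]
    calc _ = (Φ.M s)ᴴ * (∑ x : Fin n → Fin ds, (Φ.word x)ᴴ * Φ.word x) * Φ.M s := by
          simp only [Finset.mul_sum, Finset.sum_mul, Matrix.mul_assoc]
      _ = _ := by rw [ih, Matrix.mul_one]

lemma sum_word_mul (n : ℕ) (X : Matrix (Fin d) (Fin d) ℂ) :
    ∑ x : Fin n → Fin ds, Φ.word x * X * (Φ.word x)ᴴ = (Φ.chan ^ n) X := by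
  induction n generalizing X with
  | zero => simp [word_zero]
  | succ n ih =>
    rw [sum_word_succ, pow_succ, Module.End.mul_apply, ← ih, chan_apply, Finset.sum_comm]
    refine Finset.sum_congr rfl fun y _ => ?_
    simp only [word_cons, Matrix.conjTranspose_mul, Finset.mul_sum, Finset.sum_mul,
      Matrix.mul_assoc]

lemma chan_pow_sigma (n : ℕ) : (Φ.chan ^ n) Φ.σ = Φ.σ := by
  induction n with
  | zero => rfl
  | succ n ih => rw [pow_succ, Module.End.mul_apply, chan_sigma, ih]

lemma sum_word_sigma (n : ℕ) :
    ∑ x : Fin n → Fin ds, Φ.word x * Φ.σ * (Φ.word x)ᴴ = Φ.σ := by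
  rw [sum_word_mul, chan_pow_sigma]

/-! ### The matrix representation -/

/-- A `d × d` matrix as a vector indexed by pairs. -/
def flat : Matrix (Fin d) (Fin d) ℂ ≃ₗ[ℂ] (Fin d × Fin d → ℂ) where
  toFun X p := X p.1 p.2
  invFun v i j := v (i, j)
  map_add' _ _ := rfl
  map_smul' _ _ := rfl
  left_inv _ := rfl
  right_inv _ := rfl

lemma flat_mapOf (T : Matrix (Fin d × Fin d) (Fin d × Fin d) ℂ) (X : Matrix (Fin d) (Fin d) ℂ) :
    flat (mapOf T X) = T *ᵥ flat X := by
  ext p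
  rw [Matrix.mulVec, dotProduct, Fintype.sum_prod_type]
  rfl

lemma mapOf_kraus {ι : Type*} [Fintype ι] (A : ι → Matrix (Fin d) (Fin d) ℂ)
    (X : Matrix (Fin d) (Fin d) ℂ) :
    mapOf (∑ i, A i ⊗ₖ (A i).map star) X = ∑ i, A i * X * (A i)ᴴ := by
  ext j j'
  simp only [mapOf, Matrix.sum_apply, Matrix.kroneckerMap_apply, Matrix.map_apply,
    Matrix.mul_apply, Matrix.conjTranspose_apply, Finset.sum_mul]
  rw [Finset.sum_congr rfl fun _ _ => Finset.sum_comm, Finset.sum_comm]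
  refine Finset.sum_congr rfl fun s _ => ?_
  rw [Finset.sum_comm]
  refine Finset.sum_congr rfl fun a _ => Finset.sum_congr rfl fun b _ => ?_
  ring

lemma mapOf_E (X : Matrix (Fin d) (Fin d) ℂ) : mapOf Φ.E X = Φ.chan X := mapOf_kraus _ X

lemma E_mulVec_flat (X : Matrix (Fin d) (Fin d) ℂ) : Φ.E *ᵥ flat X = flat (Φ.chan X) := by
  rw [← flat_mapOf, mapOf_E]

lemma E_pow_mulVec_flat (n : ℕ) (X : Matrix (Fin d) (Fin d) ℂ) :
    Φ.E ^ n *ᵥ flat X = flat ((Φ.chan ^ n) X) := by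
  induction n generalizing X with
  | zero => simp
  | succ n ih => rw [pow_succ, ← Matrix.mulVec_mulVec, E_mulVec_flat, ih, pow_succ]; rfl

/-- The span of the matrices that the channel multiplies by a phase. -/
def peripheral (Φ : IUMPS d ds) : Submodule ℂ (Matrix (Fin d) (Fin d) ℂ) :=
  Submodule.span ℂ {X | ∃ ν : ℂ, ‖ν‖ = 1 ∧ Φ.chan X = ν • X}

lemma flat_mem_peripheralSpace {X : Matrix (Fin d) (Fin d) ℂ} (hX : X ∈ Φ.peripheral) :
    flat X ∈ peripheralSpace Φ.endE := by
  induction hX using Submodule.span_induction with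
  | mem X h =>
    obtain ⟨ν, hν, h⟩ := h
    refine Submodule.subset_span ⟨ν, hν, ?_⟩
    rw [endE, Matrix.toLin'_apply, E_mulVec_flat, h, map_smul]
  | zero => simp
  | add X Y _ _ hX hY => rw [map_add]; exact add_mem hX hY
  | smul c X _ hX => rw [map_smul]; exact Submodule.smul_mem _ _ hX

lemma exists_flat_of_mem_peripheralSpace {v : Fin d × Fin d → ℂ}
    (hv : v ∈ peripheralSpace Φ.endE) : ∃ X ∈ Φ.peripheral, flat X = v := by
  induction hv using Submodule.span_induction with
  | mem v h =>
    obtain ⟨ν, hν, h⟩ := h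
    refine ⟨flat.symm v, Submodule.subset_span ⟨ν, hν, ?_⟩, by simp⟩
    apply flat.injective
    rw [← E_mulVec_flat, map_smul, LinearEquiv.apply_symm_apply, ← h]
    rfl
  | zero => exact ⟨0, zero_mem _, map_zero _⟩
  | add v w _ _ hv hw =>
    obtain ⟨X, hX, rfl⟩ := hv
    obtain ⟨Y, hY, rfl⟩ := hw
    exact ⟨X + Y, add_mem hX hY, map_add _ _ _⟩
  | smul c v _ hv =>
    obtain ⟨X, hX, rfl⟩ := hv
    exact ⟨c • X, Submodule.smul_mem _ _ hX, map_smul _ _ _⟩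

lemma peripheral_mul_mul {ν μ : ℂ} (hν : ‖ν‖ = 1) (hμ : ‖μ‖ = 1) {Z W : Matrix (Fin d) (Fin d) ℂ}
    (hZ : Z ∈ Φ.twisted ν) (hW : W ∈ Φ.twisted μ) {X : Matrix (Fin d) (Fin d) ℂ}
    (hX : X ∈ Φ.peripheral) : Z * X * W ∈ Φ.peripheral := by
  induction hX using Submodule.span_induction with
  | mem X h =>
    obtain ⟨ξ, hξ, h⟩ := h
    refine Submodule.subset_span ⟨star ν * star μ * ξ, by simp [hν, hμ, hξ], ?_⟩
    rw [chan_mul_mul hν hμ hZ hW, h, Matrix.mul_smul, Matrix.smul_mul, smul_smul]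
  | zero => simp
  | add X Y _ _ hX hY => rw [Matrix.mul_add, Matrix.add_mul]; exact add_mem hX hY
  | smul c X _ hX => rw [Matrix.mul_smul, Matrix.smul_mul]; exact Submodule.smul_mem _ _ hX

lemma mul_sigma_mem_peripheral {ν : ℂ} (hν : ‖ν‖ = 1) {Z : Matrix (Fin d) (Fin d) ℂ}
    (hZ : Z ∈ Φ.twisted ν) : Z * Φ.σ ∈ Φ.peripheral :=
  Submodule.subset_span ⟨star ν, norm_star_one hν, chan_mul_sigma hν hZ⟩

/-- A peripheral matrix is determined by its pairings with the twisted commutants. -/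
lemma eq_zero_of_pairing {X : Matrix (Fin d) (Fin d) ℂ} (hX : X ∈ Φ.peripheral)
    (h : ∀ ν : ℂ, ‖ν‖ = 1 → ∀ Z ∈ Φ.twisted ν, (Zᴴ * X).trace = 0) : X = 0 := by
  -- Xσ⁻¹ is a sum of twisted commutants, so X may be paired with it; the result is the trace of
  -- (Xσ⁻¹) σ (Xσ⁻¹)†.
  have key : (((X * Φ.σ⁻¹)ᴴ) * X).trace = 0 := by
    have : ∀ W ∈ Φ.peripheral, (((W * Φ.σ⁻¹)ᴴ) * X).trace = 0 := by
      intro W hW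
      induction hW using Submodule.span_induction with
      | mem W hW =>
        obtain ⟨ν, hν, hW⟩ := hW
        refine h (star ν) (norm_star_one hν) _ (mem_twisted_of_chan (norm_star_one hν) ?_)
        rw [Matrix.mul_assoc, inv_mul_sigma, Matrix.mul_one, hW, star_star]
      | zero => simp
      | add W W' _ _ hW hW' =>
        rw [Matrix.add_mul, Matrix.conjTranspose_add, Matrix.add_mul, Matrix.trace_add, hW, hW',
          add_zero]
      | smul c W _ hW =>
        rw [Matrix.smul_mul, Matrix.conjTranspose_smul, Matrix.smul_mul, Matrix.trace_smul, hW,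
          smul_zero]
    exact this X hX
  have h2 : X * Φ.σ⁻¹ = 0 := by
    apply eq_zero_of_trace_mul_mul_conjTranspose Φ.posDef
    rw [Matrix.trace_mul_comm, Matrix.mul_assoc X, inv_mul_sigma, Matrix.mul_one]
    exact key
  calc X = X * Φ.σ⁻¹ * Φ.σ := by rw [Matrix.mul_assoc, inv_mul_sigma, Matrix.mul_one]
    _ = 0 := by rw [h2, Matrix.zero_mul]

lemma pairing_chan {ν : ℂ} {Z : Matrix (Fin d) (Fin d) ℂ}
    (hZ : Z ∈ Φ.twisted ν) (X : Matrix (Fin d) (Fin d) ℂ) :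
    (Zᴴ * Φ.chan X).trace = star ν * (Zᴴ * X).trace := by
  have h := congrArg Matrix.conjTranspose (dual_of_mem_twisted hZ)
  simp only [Matrix.conjTranspose_sum, Matrix.conjTranspose_mul, Matrix.conjTranspose_smul,
    Matrix.conjTranspose_conjTranspose] at h
  rw [← smul_eq_mul (star ν), ← Matrix.trace_smul, ← Matrix.smul_mul, ← h, chan_apply, Finset.mul_sum,
    Finset.sum_mul, Matrix.trace_sum, Matrix.trace_sum]
  refine Finset.sum_congr rfl fun s _ => ?_
  rw [← Matrix.mul_assoc, Matrix.trace_mul_comm]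
  simp only [Matrix.mul_assoc]

/-- On the generalized eigenspace of μ, applying E - μ multiplies the pairing by ν̄ - μ, which is
nonzero because |μ| ≠ 1, while some power of E - μ kills the vector. -/
lemma pairing_nonperipheral {ν : ℂ} (hν : ‖ν‖ = 1) {Z : Matrix (Fin d) (Fin d) ℂ}
    (hZ : Z ∈ Φ.twisted ν) {v : Fin d × Fin d → ℂ} (hv : v ∈ nonperipheralSpace Φ.endE) :
    (Zᴴ * flat.symm v).trace = 0 := by
  rw [nonperipheralSpace] at hv
  induction hv using Submodule.iSup_induction' with
  | zero => simp
  | add v w _ _ hv hw => rw [map_add, Matrix.mul_add, Matrix.trace_add, hv, hw, add_zero]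
  | mem μ v hv =>
    by_cases hμ : ‖μ‖ = 1
    · rw [iSup_neg (by simpa using hμ)] at hv
      rw [(Submodule.mem_bot ℂ).mp hv]; simp
    · rw [iSup_pos (by simpa using hμ), Module.End.mem_maxGenEigenspace] at hv
      obtain ⟨k, hk⟩ := hv
      have step : ∀ w, (Zᴴ * flat.symm ((Φ.endE - μ • 1) w)).trace
          = (star ν - μ) * (Zᴴ * flat.symm w).trace := by
        intro w
        have : flat.symm (Φ.endE w) = Φ.chan (flat.symm w) := by
          apply flat.injective
          rw [← E_mulVec_flat, LinearEquiv.apply_symm_apply, LinearEquiv.apply_symm_apply]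
          rfl
        rw [LinearMap.sub_apply, map_sub, this, Matrix.mul_sub, Matrix.trace_sub, pairing_chan hZ]
        simp [sub_mul]
      have hpow : ∀ (k : ℕ) w, (Zᴴ * flat.symm (((Φ.endE - μ • 1) ^ k) w)).trace
          = (star ν - μ) ^ k * (Zᴴ * flat.symm w).trace := by
        intro k
        induction k with
        | zero => intro w; simp
        | succ k ih =>
          intro w
          rw [pow_succ, Module.End.mul_apply, ih, step]; ring
      have h1 := hpow k v
      rw [hk] at h1
      have hne : star ν - μ ≠ 0 := by
        intro h
        rw [sub_eq_zero] at h
        exact hμ (by rw [← h, norm_star_one hν])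
      simp only [map_zero, Matrix.mul_zero, Matrix.trace_zero] at h1
      exact (mul_eq_zero.mp h1.symm).resolve_left (pow_ne_zero _ hne)

lemma P_mulVec (v : Fin d × Fin d → ℂ) :
    Φ.P *ᵥ v = Submodule.projection _ _ Φ.isCompl_peripheral v := by
  rw [P, ← Matrix.toLin'_apply, Matrix.toLin'_toMatrix']

lemma P_mulVec_of_mem {v : Fin d × Fin d → ℂ} (hv : v ∈ peripheralSpace Φ.endE) :
    Φ.P *ᵥ v = v := by
  rw [P_mulVec]
  exact Submodule.projection_apply_of_mem_left _ hv

lemma P_mulVec_of_mem_non {v : Fin d × Fin d → ℂ} (hv : v ∈ nonperipheralSpace Φ.endE) :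
    Φ.P *ᵥ v = 0 := by
  rw [P_mulVec]
  exact Submodule.projection_apply_of_mem_right _ hv
end IUMPS
/-! ### Minimal projections of a commutant -/

section Projections

variable {n : Type} [Fintype n] [DecidableEq n]

lemma trace_eq_rank_of_idempotent {A : Matrix n n ℂ} (h : A * A = A) : A.trace = A.rank := by
  have h1 : IsIdempotentElem (Matrix.toLin' A) := by
    rw [IsIdempotentElem, Module.End.mul_eq_comp, ← Matrix.toLin'_mul, h]
  have h2 := (LinearMap.IsIdempotentElem.isProj_range _ h1).trace
  rw [Matrix.trace_toLin'_eq] at h2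
  rw [h2]
  rfl

/-- The matrices commuting with every element of a set. -/
def InCommutant (𝒮 : Set (Matrix n n ℂ)) (Y : Matrix n n ℂ) : Prop := ∀ A ∈ 𝒮, Commute A Y

namespace InCommutant

variable {𝒮 : Set (Matrix n n ℂ)} {Y Z : Matrix n n ℂ}

lemma mul (hY : InCommutant 𝒮 Y) (hZ : InCommutant 𝒮 Z) : InCommutant 𝒮 (Y * Z) :=
  fun A hA => (hY A hA).mul_right (hZ A hA)

lemma add (hY : InCommutant 𝒮 Y) (hZ : InCommutant 𝒮 Z) : InCommutant 𝒮 (Y + Z) :=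
  fun A hA => (hY A hA).add_right (hZ A hA)

lemma sub (hY : InCommutant 𝒮 Y) (hZ : InCommutant 𝒮 Z) : InCommutant 𝒮 (Y - Z) :=
  fun A hA => (hY A hA).sub_right (hZ A hA)

lemma smul (hY : InCommutant 𝒮 Y) (c : ℂ) : InCommutant 𝒮 (c • Y) :=
  fun A hA => (hY A hA).smul_right c

lemma conjTranspose (h𝒮 : ∀ A ∈ 𝒮, Aᴴ ∈ 𝒮) (hY : InCommutant 𝒮 Y) : InCommutant 𝒮 Yᴴ := by
  intro A hA
  have := congrArg Matrix.conjTranspose (hY _ (h𝒮 A hA)).eq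
  simp only [Matrix.conjTranspose_mul, Matrix.conjTranspose_conjTranspose] at this
  exact this.symm

end InCommutant

/-- A nonzero projection `p` in the commutant such that the compression of the commutant by `p`
consists of scalars. -/
structure IsMinimalProjection (𝒮 : Set (Matrix n n ℂ)) (p : Matrix n n ℂ) : Prop where
  proj : IsStarProjection p
  ne_zero : p ≠ 0
  mem : InCommutant 𝒮 p
  scalar : ∀ Y, InCommutant 𝒮 Y → ∃ c : ℂ, p * Y * p = c • p

lemma _root_.IsStarProjection.conjTranspose_eq {p : Matrix n n ℂ} (hp : IsStarProjection p) : pᴴ = p :=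
  hp.isSelfAdjoint

lemma eq_of_rank_le {p q : Matrix n n ℂ} (hp : IsStarProjection p) (hq : IsStarProjection q)
    (h : p * q = q) (hr : p.rank ≤ q.rank) : q = p := by
  have hpq : IsStarProjection (p - q) := hq.sub_of_mul_eq_right hp h
  have h0 : (p - q).rank = 0 := by
    have h1 := trace_eq_rank_of_idempotent hpq.isIdempotentElem
    rw [Matrix.trace_sub, trace_eq_rank_of_idempotent hp.isIdempotentElem,
      trace_eq_rank_of_idempotent hq.isIdempotentElem, sub_eq_iff_eq_add] at h1
    norm_cast at h1
    omega
  have h1 : ((p - q)ᴴ * (p - q)).trace = 0 := by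
    rw [hpq.conjTranspose_eq, hpq.isIdempotentElem, trace_eq_rank_of_idempotent
      hpq.isIdempotentElem, h0, Nat.cast_zero]
  exact (sub_eq_zero.mp (eq_zero_of_trace_conjTranspose_mul h1)).symm

/-- The spectral projections of pYp belong to the commutant; cut down by p each is zero or, by
minimality of the rank, all of p. Hence pYp has a single eigenvalue on the range of p. -/
lemma exists_scalar_of_isHermitian {𝒮 : Set (Matrix n n ℂ)} {p : Matrix n n ℂ}
    (hp : IsStarProjection p) (hp0 : p ≠ 0) (hpm : InCommutant 𝒮 p)
    (hmin : ∀ q, IsStarProjection q → q ≠ 0 → InCommutant 𝒮 q → p * q = q → p.rank ≤ q.rank)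
    {Y : Matrix n n ℂ} (hY : InCommutant 𝒮 Y) (hYh : Yᴴ = Y) : ∃ c : ℂ, p * Y * p = c • p := by
  set H := p * Y * p with hH
  have hHs : IsSelfAdjoint H := by
    change Hᴴ = H
    rw [hH, Matrix.conjTranspose_mul, Matrix.conjTranspose_mul, hYh, hp.conjTranspose_eq,
      Matrix.mul_assoc]
  have hHm : InCommutant 𝒮 H := (hpm.mul hY).mul hpm
  have hHp : H * p = H := by rw [hH, Matrix.mul_assoc, hp.isIdempotentElem.eq]
  have hpH : p * H = H := by
    rw [hH, ← Matrix.mul_assoc, ← Matrix.mul_assoc, hp.isIdempotentElem.eq]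
  have hfin := H.finite_real_spectrum
  have hcont : ∀ f : ℝ → ℝ, ContinuousOn f (spectrum ℝ H) := fun f => hfin.continuousOn f
  -- The spectrum is finite, so indicators of points are continuous on it and the functional
  -- calculus produces the spectral projections.
  let χ : ℝ → ℝ → ℝ := fun μ x => if x = μ then 1 else 0
  let e : ℝ → Matrix n n ℂ := fun μ => cfc (χ μ) H
  have hee : ∀ μ, e μ * e μ = e μ := by
    intro μ
    rw [← cfc_mul (χ μ) (χ μ) H (hcont _) (hcont _)]
    congr 1
    ext x
    simp [χ]
  have hes : ∀ μ, IsStarProjection (e μ) := fun μ => ⟨hee μ, cfc_predicate (χ μ) H⟩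
  have hcomm : ∀ μ A, Commute H A → Commute (e μ) A := fun μ A h => IsSelfAdjoint.commute_cfc hHs h _
  have hHe : ∀ μ, H * e μ = (μ : ℂ) • e μ := by
    intro μ
    have h1 : H * e μ = cfc (fun x => x * χ μ x) H := by
      rw [cfc_mul (fun x => x) (χ μ) H (hcont _) (hcont _), cfc_id' ℝ H hHs]
    have h2 : cfc (fun x => x * χ μ x) H = μ • e μ := by
      rw [← cfc_smul μ (χ μ) H (hcont _)]
      congr 1
      ext x
      by_cases hx : x = μ <;> simp [χ, hx]
    rw [h1, h2]
    rfl
  have hsum : ∑ μ ∈ hfin.toFinset, e μ = 1 := by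
    rw [← cfc_sum χ H hfin.toFinset (fun i _ => hcont _), ← cfc_one ℝ H hHs]
    refine cfc_congr fun x hx => ?_
    rw [Finset.sum_apply, Finset.sum_eq_single x]
    · simp [χ]
    · intro b _ hb
      simp [χ, hb.symm]
    · intro h
      exact absurd (hfin.mem_toFinset.mpr hx) h
  have hpe : ∀ μ, Commute (e μ) p := fun μ => hcomm μ p (by rw [Commute, SemiconjBy, hHp, hpH])
  have hex : ∃ μ, e μ * p ≠ 0 := by
    by_contra! hall
    apply hp0
    rw [← Matrix.one_mul p, ← hsum, Finset.sum_mul]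
    exact Finset.sum_eq_zero fun μ _ => hall μ
  obtain ⟨μ, hμ⟩ := hex
  have hq : IsStarProjection (e μ * p) := (hes μ).mul hp (hpe μ)
  have hpq : p * (e μ * p) = e μ * p := by
    rw [(hpe μ).eq, ← Matrix.mul_assoc, hp.isIdempotentElem.eq]
  have hem : InCommutant 𝒮 (e μ) := fun A hA => (hcomm μ A (hHm A hA).symm).symm
  have heq := eq_of_rank_le hp hq hpq (hmin _ hq hμ (hem.mul hpm) hpq)
  refine ⟨μ, ?_⟩
  calc H = H * (e μ * p) := by rw [heq, hHp]
    _ = (μ : ℂ) • p := by rw [← Matrix.mul_assoc, hHe, Matrix.smul_mul, heq]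

/-- A nonzero projection of least rank below r works; a general Y is handled through Y + Y† and i(Y
- Y†). -/
lemma exists_isMinimalProjection {𝒮 : Set (Matrix n n ℂ)} (h𝒮 : ∀ A ∈ 𝒮, Aᴴ ∈ 𝒮)
    {r : Matrix n n ℂ} (hr : IsStarProjection r) (hr0 : r ≠ 0) (hrm : InCommutant 𝒮 r) :
    ∃ p, IsMinimalProjection 𝒮 p ∧ r * p = p := by
  classical
  have hex : ∃ k : ℕ, ∃ p, (IsStarProjection p ∧ p ≠ 0 ∧ InCommutant 𝒮 p ∧ r * p = p) ∧
      p.rank = k := ⟨_, r, ⟨hr, hr0, hrm, hr.isIdempotentElem⟩, rfl⟩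
  obtain ⟨p, ⟨hp, hp0, hpm, hrp⟩, hpr⟩ := Nat.find_spec hex
  have hmin : ∀ q, IsStarProjection q → q ≠ 0 → InCommutant 𝒮 q → p * q = q →
      p.rank ≤ q.rank := by
    intro q hq hq0 hqm hpq
    rw [hpr]
    refine Nat.find_min' hex ⟨q, ⟨hq, hq0, hqm, ?_⟩, rfl⟩
    rw [← hpq, ← Matrix.mul_assoc, hrp]
  refine ⟨p, ⟨hp, hp0, hpm, ?_⟩, hrp⟩
  intro Y hY
  have hYs := hY.conjTranspose h𝒮
  obtain ⟨c, hc⟩ := exists_scalar_of_isHermitian hp hp0 hpm hmin (hY.add hYs)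
    (by rw [Matrix.conjTranspose_add, Matrix.conjTranspose_conjTranspose, add_comm])
  obtain ⟨c', hc'⟩ := exists_scalar_of_isHermitian hp hp0 hpm hmin
    ((hY.sub hYs).smul Complex.I) (by
      rw [Matrix.conjTranspose_smul, Matrix.conjTranspose_sub, Matrix.conjTranspose_conjTranspose,
        Complex.star_def, Complex.conj_I, neg_smul, ← smul_neg, neg_sub])
  refine ⟨(c - Complex.I * c') / 2, ?_⟩
  have h2 : (2 : ℂ) • Y = (Y + Yᴴ) - Complex.I • (Complex.I • (Y - Yᴴ)) := by
    rw [smul_smul, Complex.I_mul_I, neg_one_smul, two_smul]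
    abel
  have h3 : (2 : ℂ) • (p * Y * p) = (c - Complex.I * c') • p := by
    calc (2 : ℂ) • (p * Y * p) = p * ((2 : ℂ) • Y) * p := by simp
      _ = p * (Y + Yᴴ) * p - Complex.I • (p * (Complex.I • (Y - Yᴴ)) * p) := by
          rw [h2, Matrix.mul_sub, Matrix.sub_mul]; simp
      _ = _ := by rw [hc, hc', smul_smul, sub_smul]
  rw [div_eq_inv_mul, mul_smul, ← h3, smul_smul]
  norm_num

lemma exists_minimal_decomposition {𝒮 : Set (Matrix n n ℂ)} (h𝒮 : ∀ A ∈ 𝒮, Aᴴ ∈ 𝒮)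
    {r : Matrix n n ℂ} (hr : IsStarProjection r) (hrm : InCommutant 𝒮 r) :
    ∃ (N : ℕ) (p : Fin N → Matrix n n ℂ), (∀ i, IsMinimalProjection 𝒮 (p i)) ∧
      (∀ i j, i ≠ j → p i * p j = 0) ∧ ∑ i, p i = r := by
  induction hk : r.rank using Nat.strong_induction_on generalizing r with
  | _ k ih =>
    by_cases hr0 : r = 0
    · exact ⟨0, Fin.elim0, fun i => i.elim0, fun i => i.elim0, by simp [hr0]⟩
    obtain ⟨p, hp, hrp⟩ := exists_isMinimalProjection h𝒮 hr hr0 hrm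
    have hr' : IsStarProjection (r - p) := hp.proj.sub_of_mul_eq_right hr hrp
    have hpr : p * r = p := by
      have := congrArg Matrix.conjTranspose hrp
      rwa [Matrix.conjTranspose_mul, hr.conjTranspose_eq, hp.proj.conjTranspose_eq] at this
    have hpr' : p * (r - p) = 0 := by
      rw [Matrix.mul_sub, hpr, hp.proj.isIdempotentElem.eq, sub_self]
    have hlt : (r - p).rank < k := by
      have h1 := trace_eq_rank_of_idempotent hr'.isIdempotentElem
      rw [Matrix.trace_sub, trace_eq_rank_of_idempotent hr.isIdempotentElem,
        trace_eq_rank_of_idempotent hp.proj.isIdempotentElem, sub_eq_iff_eq_add] at h1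
      norm_cast at h1
      have h2 : p.rank ≠ 0 := by
        intro h
        apply hp.ne_zero
        apply eq_zero_of_trace_conjTranspose_mul
        rw [hp.proj.conjTranspose_eq, hp.proj.isIdempotentElem.eq,
          trace_eq_rank_of_idempotent hp.proj.isIdempotentElem, h, Nat.cast_zero]
      omega
    obtain ⟨N, q, hq, horth, hsum⟩ := ih _ hlt hr' (hrm.sub hp.mem) rfl
    have hrq : ∀ i, (r - p) * q i = q i := by
      intro i
      rw [← hsum, Finset.sum_mul, Finset.sum_eq_single i]
      · exact (hq i).proj.isIdempotentElem
      · intro j _ hj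
        exact horth j i hj
      · simp
    have hpq : ∀ i, p * q i = 0 := by
      intro i
      rw [← hrq i, ← Matrix.mul_assoc, hpr', Matrix.zero_mul]
    have hqp : ∀ i, q i * p = 0 := by
      intro i
      have := congrArg Matrix.conjTranspose (hpq i)
      rwa [Matrix.conjTranspose_mul, hp.proj.conjTranspose_eq, (hq i).proj.conjTranspose_eq,
        Matrix.conjTranspose_zero] at this
    refine ⟨N + 1, Fin.cons p q, ?_, ?_, ?_⟩
    · intro i
      refine Fin.cases hp (fun j => ?_) i
      exact hq j
    · intro i j
      refine Fin.cases ?_ (fun i => ?_) i <;> refine Fin.cases ?_ (fun j => ?_) j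
      · intro h; exact absurd rfl h
      · intro _; exact hpq j
      · intro _; exact hqp i
      · intro h; exact horth i j fun h' => h (by rw [h'])
    · rw [Fin.sum_univ_succ]
      simp [hsum]

end Projections

namespace IUMPS

variable {d ds : ℕ} {Φ : IUMPS d ds}

/-! ### The peripheral channel -/

lemma P_mulVec_mem (v : Fin d × Fin d → ℂ) : Φ.P *ᵥ v ∈ peripheralSpace Φ.endE := by
  rw [P_mulVec]
  exact Submodule.projection_apply_mem _ _

lemma sub_P_mulVec_mem (v : Fin d × Fin d → ℂ) :
    v - Φ.P *ᵥ v ∈ nonperipheralSpace Φ.endE := by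
  rw [P_mulVec]
  exact Submodule.sub_projection_mem _ v

lemma chan_mem_peripheral {X : Matrix (Fin d) (Fin d) ℂ} (hX : X ∈ Φ.peripheral) :
    Φ.chan X ∈ Φ.peripheral := by
  induction hX using Submodule.span_induction with
  | mem X h =>
    obtain ⟨ν, hν, h⟩ := h
    rw [h]
    exact Submodule.smul_mem _ _ (Submodule.subset_span ⟨ν, hν, h⟩)
  | zero => simp
  | add X Y _ _ hX hY => rw [map_add]; exact add_mem hX hY
  | smul c X _ hX => rw [map_smul]; exact Submodule.smul_mem _ _ hX

lemma chan_pow_mem_peripheral (n : ℕ) {X : Matrix (Fin d) (Fin d) ℂ} (hX : X ∈ Φ.peripheral) :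
    (Φ.chan ^ n) X ∈ Φ.peripheral := by
  induction n generalizing X with
  | zero => exact hX
  | succ n ih => rw [pow_succ]; exact ih (chan_mem_peripheral hX)

lemma P_mul_E_pow_mul_P (n : ℕ) : Φ.P * (Φ.E ^ n * Φ.P) = Φ.E ^ n * Φ.P := by
  refine Matrix.ext_of_mulVec_single fun i => ?_
  rw [← Matrix.mulVec_mulVec]
  apply P_mulVec_of_mem
  rw [← Matrix.mulVec_mulVec]
  obtain ⟨X, hX, h⟩ := exists_flat_of_mem_peripheralSpace (Φ.P_mulVec_mem (Pi.single i 1))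
  rw [← h, E_pow_mulVec_flat]
  exact flat_mem_peripheralSpace (chan_pow_mem_peripheral n hX)

/-- The exponent zero is a genuine exception: Ẽ⁰ is the identity, while E⁰P is P. -/
lemma Eper_pow {n : ℕ} (hn : n ≠ 0) : Φ.Eper ^ n = Φ.E ^ n * Φ.P := by
  have h1 : Φ.Eper = Φ.E * Φ.P := by
    have := Φ.P_mul_E_pow_mul_P 1
    rwa [pow_one, ← Matrix.mul_assoc] at this
  obtain ⟨n, rfl⟩ := Nat.exists_eq_succ_of_ne_zero hn
  clear hn
  induction n with
  | zero => simp [h1]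
  | succ n ih =>
    rw [pow_succ', ih, h1, Matrix.mul_assoc, P_mul_E_pow_mul_P, ← Matrix.mul_assoc, ← pow_succ']

lemma pairing_chan_pow {ν : ℂ} {Z : Matrix (Fin d) (Fin d) ℂ}
    (hZ : Z ∈ Φ.twisted ν) (n : ℕ) (X : Matrix (Fin d) (Fin d) ℂ) :
    (Zᴴ * (Φ.chan ^ n) X).trace = star ν ^ n * (Zᴴ * X).trace := by
  induction n generalizing X with
  | zero => simp
  | succ n ih => rw [pow_succ, Module.End.mul_apply, ih, pairing_chan hZ, pow_succ]; ring

/-- Characterization of the powers of the peripheral channel by pairings. -/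
lemma mapOf_Eper_pow {n : ℕ} (hn : n ≠ 0) {X R : Matrix (Fin d) (Fin d) ℂ} (hR : R ∈ Φ.peripheral)
    (h : ∀ ν : ℂ, ‖ν‖ = 1 → ∀ Z ∈ Φ.twisted ν,
      (Zᴴ * R).trace = star ν ^ n * (Zᴴ * X).trace) :
    mapOf (Φ.Eper ^ n) X = R := by
  obtain ⟨Y, hY, hYX⟩ := exists_flat_of_mem_peripheralSpace (Φ.P_mulVec_mem (flat X))
  have h1 : mapOf (Φ.Eper ^ n) X = (Φ.chan ^ n) Y := by
    apply flat.injective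
    rw [flat_mapOf, Eper_pow hn, ← Matrix.mulVec_mulVec, ← hYX, E_pow_mulVec_flat]
  rw [h1, ← sub_eq_zero]
  refine eq_zero_of_pairing (sub_mem (chan_pow_mem_peripheral n hY) hR) fun ν hν Z hZ => ?_
  -- X differs from its peripheral part Y by a nonperipheral matrix, so the two have the same
  -- pairings.
  have h2 := pairing_nonperipheral hν hZ (Φ.sub_P_mulVec_mem (flat X))
  rw [← hYX, map_sub, LinearEquiv.symm_apply_apply, LinearEquiv.symm_apply_apply, Matrix.mul_sub,
    Matrix.trace_sub, sub_eq_zero] at h2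
  rw [Matrix.mul_sub, Matrix.trace_sub, pairing_chan_pow hZ, h ν hν Z hZ, h2, sub_self]

end IUMPS
namespace IUMPS

variable {d ds : ℕ} {Φ : IUMPS d ds}

/-! ### Irreducible components -/

/-- The matrices `M^s`, their adjoints, and the fixed point. -/
def gens (Φ : IUMPS d ds) : Set (Matrix (Fin d) (Fin d) ℂ) :=
  {A | (∃ s, A = Φ.M s) ∨ (∃ s, A = (Φ.M s)ᴴ) ∨ A = Φ.σ}

lemma gens_star (Φ : IUMPS d ds) : ∀ A ∈ Φ.gens, Aᴴ ∈ Φ.gens := by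
  rintro A (⟨s, rfl⟩ | ⟨s, rfl⟩ | rfl)
  · exact Or.inr (Or.inl ⟨s, rfl⟩)
  · exact Or.inl ⟨s, by simp⟩
  · exact Or.inr (Or.inr Φ.posDef.isHermitian)

/-- Commutation with M^s† follows from commutation with M^s, so σ is the only additional constraint.
-/
lemma inCommutant_gens_iff {Y : Matrix (Fin d) (Fin d) ℂ} :
    InCommutant Φ.gens Y ↔ Y ∈ Φ.twisted 1 ∧ Commute Φ.σ Y := by
  constructor
  · intro h
    refine ⟨fun s => ?_, h _ (Or.inr (Or.inr rfl))⟩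
    rw [one_smul, (h _ (Or.inl ⟨s, rfl⟩)).eq]
  · rintro ⟨h, hσ⟩ A (⟨s, rfl⟩ | ⟨s, rfl⟩ | rfl)
    · have := h s
      rw [one_smul] at this
      exact this.symm
    · have := mul_conjTranspose_of_mem_twisted norm_one h s
      rw [star_one, one_smul] at this
      exact this.symm
    · exact hσ

/-- A projection onto an irreducible component. -/
abbrev IsBlock (Φ : IUMPS d ds) (p : Matrix (Fin d) (Fin d) ℂ) : Prop :=
  IsMinimalProjection Φ.gens p

namespace IsBlock

variable {p q r : Matrix (Fin d) (Fin d) ℂ}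

lemma mem_twisted (hp : Φ.IsBlock p) : p ∈ Φ.twisted 1 := (inCommutant_gens_iff.mp hp.mem).1

lemma commute_sigma (hp : Φ.IsBlock p) : Commute Φ.σ p := (inCommutant_gens_iff.mp hp.mem).2

lemma conjTranspose_eq (hp : Φ.IsBlock p) : pᴴ = p := hp.proj.conjTranspose_eq

lemma mul_self (hp : Φ.IsBlock p) : p * p = p := hp.proj.isIdempotentElem

lemma trace_sigma_pos (hp : Φ.IsBlock p) : 0 < (p * Φ.σ).trace := by
  have h1 : (p * Φ.σ).trace = (p * Φ.σ * pᴴ).trace := by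
    rw [Matrix.trace_mul_comm (p * Φ.σ), hp.conjTranspose_eq, ← Matrix.mul_assoc, hp.mul_self]
  rw [h1]
  refine lt_of_le_of_ne (Φ.posDef.posSemidef.mul_mul_conjTranspose_same p).trace_nonneg ?_
  intro h
  exact hp.ne_zero (eq_zero_of_trace_mul_mul_conjTranspose Φ.posDef h.symm)

lemma exists_scalar (hp : Φ.IsBlock p) {Y : Matrix (Fin d) (Fin d) ℂ} (hY : Y ∈ Φ.twisted 1)
    (hσ : Commute Φ.σ Y) (h1 : p * Y = Y) (h2 : Y * p = Y) : ∃ c : ℂ, Y = c • p := by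
  obtain ⟨c, hc⟩ := hp.scalar Y (inCommutant_gens_iff.mpr ⟨hY, hσ⟩)
  exact ⟨c, by rw [← hc, h1, h2]⟩

lemma conjTranspose_mul_eq (hp : Φ.IsBlock p) {Y : Matrix (Fin d) (Fin d) ℂ} (h : p * Y = Y) :
    Yᴴ * p = Yᴴ := by
  have := congrArg Matrix.conjTranspose h
  rwa [Matrix.conjTranspose_mul, hp.conjTranspose_eq] at this

lemma mul_conjTranspose_eq (hp : Φ.IsBlock p) {Y : Matrix (Fin d) (Fin d) ℂ} (h : Y * p = Y) :
    p * Yᴴ = Yᴴ := by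
  have := congrArg Matrix.conjTranspose h
  rwa [Matrix.conjTranspose_mul, hp.conjTranspose_eq] at this

lemma conjTranspose_mul_mem {ν : ℂ} (hν : ‖ν‖ = 1) {Y Z : Matrix (Fin d) (Fin d) ℂ}
    (hY : Y ∈ Φ.twisted ν) (hZ : Z ∈ Φ.twisted ν) : Yᴴ * Z ∈ Φ.twisted 1 := by
  have := twisted_mul (conjTranspose_mem_twisted hν hY) hZ
  rwa [conj_mul_of_norm hν] at this

lemma mul_conjTranspose_mem {ν : ℂ} (hν : ‖ν‖ = 1) {Y Z : Matrix (Fin d) (Fin d) ℂ}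
    (hY : Y ∈ Φ.twisted ν) (hZ : Z ∈ Φ.twisted ν) : Y * Zᴴ ∈ Φ.twisted 1 := by
  have := twisted_mul hY (conjTranspose_mem_twisted hν hZ)
  rwa [mul_conj_of_norm hν] at this

/-- An eigenvector of the modular automorphism in a block has eigenvalue one. -/
lemma commute_of_modular_eigen (hp : Φ.IsBlock p) {ν c : ℂ} (hν : ‖ν‖ = 1)
    {Z : Matrix (Fin d) (Fin d) ℂ} (hZ : Z ∈ Φ.twisted ν) (h1 : p * Z = Z) (h2 : Z * p = Z)
    (hc : Φ.σ * Z = c • (Z * Φ.σ)) : Φ.σ * Z = Z * Φ.σ := by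
  by_cases hZ0 : Z = 0
  · simp [hZ0]
  have hσh : Φ.σᴴ = Φ.σ := Φ.posDef.isHermitian
  have e1 : (Zᴴ * Φ.σ * Z).trace = c * (Z * Φ.σ * Zᴴ).trace := by
    rw [Matrix.mul_assoc, hc, Matrix.mul_smul, Matrix.trace_smul, smul_eq_mul,
      Matrix.trace_mul_comm]
  have p1 : 0 < (Z * Φ.σ * Zᴴ).trace := by
    refine lt_of_le_of_ne (Φ.posDef.posSemidef.mul_mul_conjTranspose_same Z).trace_nonneg ?_
    intro h
    exact hZ0 (eq_zero_of_trace_mul_mul_conjTranspose Φ.posDef h.symm)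
  have p2 : 0 ≤ (Zᴴ * Φ.σ * Z).trace :=
    (Φ.posDef.posSemidef.conjTranspose_mul_mul_same Z).trace_nonneg
  -- c is the quotient of a nonnegative number by a positive one.
  have hcr : star c = c := by
    rw [e1] at p2
    have i1 := (Complex.nonneg_iff.mp p2).2
    obtain ⟨r1, i2⟩ := Complex.pos_iff.mp p1
    rw [Complex.mul_im, ← i2, mul_zero, zero_add] at i1
    have : c.im = 0 := by
      rcases mul_eq_zero.mp i1.symm with h | h
      · exact h
      · exact absurd h r1.ne'
    exact Complex.conj_eq_iff_im.mpr this
  have hc' : Zᴴ * Φ.σ = c • (Φ.σ * Zᴴ) := by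
    have := congrArg Matrix.conjTranspose hc
    simpa [Matrix.conjTranspose_mul, hσh, hcr] using this
  have hc0 : c ≠ 0 := by
    intro h
    rw [h, zero_smul] at hc
    apply hZ0
    rw [← Matrix.one_mul Z, ← inv_mul_sigma Φ, Matrix.mul_assoc, hc, Matrix.mul_zero]
  -- For real c both Z†Z and ZZ† commute with σ, hence are multiples of p by minimality, and the two
  -- multiples agree. This equates the traces of Z†σZ and ZσZ†, which forces c = 1.
  have c1 : Commute Φ.σ (Zᴴ * Z) := by
    have : c • (Φ.σ * (Zᴴ * Z)) = c • (Zᴴ * Z * Φ.σ) := by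
      rw [← Matrix.mul_assoc, ← Matrix.smul_mul, ← hc', Matrix.mul_assoc, hc, Matrix.mul_smul,
        Matrix.mul_assoc]
    exact smul_right_injective _ hc0 this
  have c2 : Commute Φ.σ (Z * Zᴴ) := by
    have : Φ.σ * (Z * Zᴴ) = Z * Zᴴ * Φ.σ := by
      rw [← Matrix.mul_assoc, hc, Matrix.mul_assoc, hc', Matrix.smul_mul, Matrix.mul_smul,
        Matrix.mul_assoc]
    exact this
  obtain ⟨l, hl⟩ := hp.exists_scalar (conjTranspose_mul_mem hν hZ hZ) c1
    (by rw [← Matrix.mul_assoc, hp.mul_conjTranspose_eq h2]) (by rw [Matrix.mul_assoc, h2])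
  obtain ⟨l', hl'⟩ := hp.exists_scalar (mul_conjTranspose_mem hν hZ hZ) c2
    (by rw [← Matrix.mul_assoc, h1]) (by rw [Matrix.mul_assoc, hp.conjTranspose_mul_eq h1])
  have hll : l = l' := by
    have e : l • Z = l' • Z := by
      calc l • Z = Z * (Zᴴ * Z) := by rw [hl, Matrix.mul_smul, h2]
        _ = _ := by rw [← Matrix.mul_assoc, hl', Matrix.smul_mul, h1]
    exact smul_left_injective _ hZ0 e
  have e2 : (Zᴴ * Φ.σ * Z).trace = (Z * Φ.σ * Zᴴ).trace := by
    rw [Matrix.mul_assoc, Matrix.trace_mul_comm, Matrix.mul_assoc, hl', Matrix.trace_mul_comm (Z * Φ.σ),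
      ← Matrix.mul_assoc, hl, hll, Matrix.mul_smul, Matrix.smul_mul, Matrix.trace_smul,
      Matrix.trace_smul, Matrix.trace_mul_comm]
  have hc1 : c = 1 := by
    rw [e2] at e1
    exact (mul_right_cancel₀ p1.ne' (by rw [one_mul]; exact e1)).symm
  rw [hc, hc1, one_smul]

/-- Twisted commutants inside a block commute with the fixed point. -/
lemma commute_sigma_of_mem (hp : Φ.IsBlock p) {ν : ℂ} (hν : ‖ν‖ = 1)
    {Y : Matrix (Fin d) (Fin d) ℂ} (hY : Y ∈ Φ.twisted ν) (h1 : p * Y = Y) (h2 : Y * p = Y) :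
    Commute Φ.σ Y := by
  let V : Submodule ℂ (Matrix (Fin d) (Fin d) ℂ) :=
    { carrier := {Y | Y ∈ Φ.twisted ν ∧ p * Y = Y ∧ Y * p = Y}
      add_mem' := fun {A B} hA hB => ⟨add_mem hA.1 hB.1, by rw [Matrix.mul_add, hA.2.1, hB.2.1],
        by rw [Matrix.add_mul, hA.2.2, hB.2.2]⟩
      zero_mem' := ⟨zero_mem _, by simp, by simp⟩
      smul_mem' := fun c A hA => ⟨Submodule.smul_mem _ _ hA.1, by rw [Matrix.mul_smul, hA.2.1],
        by rw [Matrix.smul_mul, hA.2.2]⟩ }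
  have hσi : Commute Φ.σ⁻¹ p := by
    have h := hp.commute_sigma.eq
    have : Φ.σ⁻¹ * (Φ.σ * p) * Φ.σ⁻¹ = Φ.σ⁻¹ * (p * Φ.σ) * Φ.σ⁻¹ := by rw [h]
    rw [← Matrix.mul_assoc, inv_mul_sigma, Matrix.one_mul, Matrix.mul_assoc, Matrix.mul_assoc,
      sigma_mul_inv, Matrix.mul_one] at this
    exact this.symm
  let Δ : Module.End ℂ (Matrix (Fin d) (Fin d) ℂ) :=
    LinearMap.mulLeft ℂ Φ.σ ∘ₗ LinearMap.mulRight ℂ Φ.σ⁻¹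
  have hΔ : ∀ A, Δ A = Φ.σ * A * Φ.σ⁻¹ := fun A => by
    simp [Δ, Matrix.mul_assoc]
  have hΔV : ∀ A ∈ V, Δ A ∈ V := by
    rintro A ⟨hA, hA1, hA2⟩
    rw [hΔ]
    refine ⟨modular_mem_twisted hν hA, ?_, ?_⟩
    · rw [← Matrix.mul_assoc, ← Matrix.mul_assoc, ← hp.commute_sigma.eq, Matrix.mul_assoc Φ.σ, hA1]
    · rw [Matrix.mul_assoc, hσi.eq, ← Matrix.mul_assoc, Matrix.mul_assoc Φ.σ, hA2]
  -- If W were nonzero, it would contain an eigenvector Z of Δ, which commutes with σ by the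
  -- preceding lemma. But the image of Δ - 1 is orthogonal to every matrix commuting with σ, so
  -- tr(Z†Z) = 0. Hence Δ is the identity on V; its diagonalisability is never needed.
  let W : Submodule ℂ (Matrix (Fin d) (Fin d) ℂ) := V.map (Δ - 1)
  have hWV : W ≤ V := by
    rintro _ ⟨A, hA, rfl⟩
    exact sub_mem (hΔV A hA) hA
  have hΔW : ∀ A ∈ W, Δ A ∈ W := by
    rintro _ ⟨A, hA, rfl⟩
    refine ⟨Δ A, hΔV A hA, ?_⟩
    simp
  have hW : W = ⊥ := by
    by_contra hne
    have : Nontrivial W := Submodule.nontrivial_iff_ne_bot.mpr hne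
    obtain ⟨c, hc⟩ := Module.End.exists_eigenvalue (Δ.restrict hΔW)
    obtain ⟨⟨Z, hZ⟩, hZe⟩ := hc.exists_hasEigenvector
    have hZ0 : Z ≠ 0 := fun h => hZe.2 (Subtype.ext h)
    have hZc : Φ.σ * Z * Φ.σ⁻¹ = c • Z := by
      rw [← hΔ]
      exact congrArg Subtype.val hZe.apply_eq_smul
    have hZV := hWV hZ
    have hcomm := hp.commute_of_modular_eigen hν (c := c) hZV.1 hZV.2.1 hZV.2.2 (by
      rw [← Matrix.smul_mul, ← hZc, Matrix.mul_assoc, inv_mul_sigma, Matrix.mul_one])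
    obtain ⟨A, hA, hAZ⟩ := hZ
    have hAZ' : Z = Φ.σ * A * Φ.σ⁻¹ - A := by rw [← hAZ, LinearMap.sub_apply, hΔ]; rfl
    have hσh : Φ.σᴴ = Φ.σ := Φ.posDef.isHermitian
    have hcomm' : Zᴴ * Φ.σ = Φ.σ * Zᴴ := by
      have := congrArg Matrix.conjTranspose hcomm
      simpa [Matrix.conjTranspose_mul, hσh] using this
    apply hZ0
    apply eq_zero_of_trace_conjTranspose_mul
    calc (Zᴴ * Z).trace = (Zᴴ * (Φ.σ * A * Φ.σ⁻¹)).trace - (Zᴴ * A).trace := by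
          rw [← Matrix.trace_sub, ← Matrix.mul_sub, ← hAZ']
      _ = 0 := by
          rw [← Matrix.mul_assoc, Matrix.trace_mul_comm, ← Matrix.mul_assoc Zᴴ, hcomm',
            Matrix.mul_assoc, ← Matrix.mul_assoc Φ.σ⁻¹, inv_mul_sigma, Matrix.one_mul, sub_self]
  have hmem : (Δ - 1) Y ∈ W := ⟨Y, ⟨hY, h1, h2⟩, rfl⟩
  rw [hW, Submodule.mem_bot, LinearMap.sub_apply, hΔ, sub_eq_zero] at hmem
  have h3 : Φ.σ * Y = Y * Φ.σ := by
    calc Φ.σ * Y = Φ.σ * Y * Φ.σ⁻¹ * Φ.σ := by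
          rw [Matrix.mul_assoc _ Φ.σ⁻¹, inv_mul_sigma, Matrix.mul_one]
      _ = _ := by rw [hmem]; rfl
  exact h3

lemma exists_scalar_of_mem (hp : Φ.IsBlock p) {Y : Matrix (Fin d) (Fin d) ℂ}
    (hY : Y ∈ Φ.twisted 1) (h1 : p * Y = Y) (h2 : Y * p = Y) : ∃ c : ℂ, Y = c • p :=
  hp.exists_scalar hY (hp.commute_sigma_of_mem norm_one hY h1 h2) h1 h2

lemma trace_pos (hp : Φ.IsBlock p) : 0 < p.trace := by
  have h : p.trace = (pᴴ * p).trace := by rw [hp.conjTranspose_eq, hp.mul_self]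
  rw [h]
  refine lt_of_le_of_ne (Matrix.posSemidef_conjTranspose_mul_self p).trace_nonneg ?_
  intro h'
  exact hp.ne_zero (eq_zero_of_trace_conjTranspose_mul h'.symm)

/-- A nonzero twisted intertwiner between blocks is a multiple of a partial isometry. -/
lemma exists_partialIsometry (hp : Φ.IsBlock p) (hq : Φ.IsBlock q) {ν : ℂ} (hν : ‖ν‖ = 1)
    {Y : Matrix (Fin d) (Fin d) ℂ} (hY : Y ∈ Φ.twisted ν) (h1 : p * Y = Y) (h2 : Y * q = Y)
    (hY0 : Y ≠ 0) : ∃ c : ℂ, c ≠ 0 ∧ (c • Y)ᴴ * (c • Y) = q ∧ (c • Y) * (c • Y)ᴴ = p := by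
  obtain ⟨l, hl⟩ := hq.exists_scalar_of_mem (conjTranspose_mul_mem hν hY hY)
    (by rw [← Matrix.mul_assoc, hq.mul_conjTranspose_eq h2]) (by rw [Matrix.mul_assoc, h2])
  obtain ⟨l', hl'⟩ := hp.exists_scalar_of_mem (mul_conjTranspose_mem hν hY hY)
    (by rw [← Matrix.mul_assoc, h1]) (by rw [Matrix.mul_assoc, hp.conjTranspose_mul_eq h1])
  have hll : l = l' := by
    have e : l • Y = l' • Y := by
      calc l • Y = Y * (Yᴴ * Y) := by rw [hl, Matrix.mul_smul, h2]
        _ = _ := by rw [← Matrix.mul_assoc, hl', Matrix.smul_mul, h1]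
    exact smul_left_injective _ hY0 e
  subst hll
  have hpos : 0 < (Yᴴ * Y).trace := by
    refine lt_of_le_of_ne (Matrix.posSemidef_conjTranspose_mul_self Y).trace_nonneg ?_
    intro h'
    exact hY0 (eq_zero_of_trace_conjTranspose_mul h'.symm)
  rw [hl, Matrix.trace_smul, smul_eq_mul] at hpos
  have hl0 : 0 < l := by
    by_contra h
    have := hq.trace_pos
    obtain ⟨t, ht⟩ : ∃ t : ℝ, (t : ℂ) = q.trace :=
      ⟨q.trace.re, (Complex.ext rfl (by simpa using (Complex.pos_iff.mp this).2))⟩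
    rw [← ht] at this hpos
    have ht0 : 0 < t := by exact_mod_cast this
    apply h
    have hx := Complex.pos_iff.mp hpos
    simp only [Complex.mul_re, Complex.mul_im, Complex.ofReal_re, Complex.ofReal_im, mul_zero,
      sub_zero, zero_add] at hx
    refine Complex.pos_iff.mpr ⟨?_, ?_⟩
    · exact (pos_iff_pos_of_mul_pos hx.1).mpr ht0
    · rcases mul_eq_zero.mp hx.2.symm with h | h
      · exact h.symm
      · exact absurd h ht0.ne'
  obtain ⟨hr, hi⟩ := Complex.pos_iff.mp hl0
  have hlr : l = (l.re : ℂ) := Complex.ext rfl (by simpa using hi.symm)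
  obtain ⟨t, ht⟩ : ∃ t : ℝ, t = (√l.re)⁻¹ := ⟨_, rfl⟩
  have hc2 : (t : ℂ) * t * l = 1 := by
    rw [hlr]
    norm_cast
    rw [ht, ← mul_inv, Real.mul_self_sqrt hr.le, inv_mul_cancel₀ hr.ne']
  have hs : star (t : ℂ) = t := Complex.conj_ofReal t
  refine ⟨t, ?_, ?_, ?_⟩
  · intro h
    rw [h, zero_mul, zero_mul] at hc2
    exact zero_ne_one hc2
  · rw [Matrix.conjTranspose_smul, hs, Matrix.smul_mul, Matrix.mul_smul, hl, smul_smul, smul_smul,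
      hc2, one_smul]
  · rw [Matrix.conjTranspose_smul, hs, Matrix.smul_mul, Matrix.mul_smul, hl', smul_smul, smul_smul,
      hc2, one_smul]

end IsBlock

/-- Every such phase is the conjugate of an eigenvalue of the channel, with eigenvector Yσ. -/
lemma finite_twisted (Φ : IUMPS d ds) : {ν : ℂ | ‖ν‖ = 1 ∧ ∃ Y ∈ Φ.twisted ν, Y ≠ 0}.Finite := by
  have h : ((fun z : ℂ => star z) ⁻¹' {ν : ℂ | Module.End.HasEigenvalue Φ.chan ν}).Finite :=
    (Module.End.finite_hasEigenvalue Φ.chan).preimage star_injective.injOn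
  refine h.subset ?_
  rintro ν ⟨hν, Y, hY, hY0⟩
  refine Module.End.hasEigenvalue_of_hasEigenvector (x := Y * Φ.σ)
    ⟨Module.End.mem_eigenspace_iff.mpr (chan_mul_sigma hν hY), ?_⟩
  intro h0
  apply hY0
  rw [← Matrix.mul_one Y, ← sigma_mul_inv Φ, ← Matrix.mul_assoc, h0, Matrix.zero_mul]

end IUMPS
namespace IUMPS

variable {d ds : ℕ} {Φ : IUMPS d ds}

/-! ### Cyclic structure of an irreducible component -/

/-- The cyclic projections of an irreducible component `p` of period `m`. -/
structure IsCyclicFamily (Φ : IUMPS d ds) (p : Matrix (Fin d) (Fin d) ℂ) (m : ℕ)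
    (R : ℕ → Matrix (Fin d) (Fin d) ℂ) : Prop where
  pos : 0 < m
  proj : ∀ k, IsStarProjection (R k)
  orthogonal : ∀ k l, k < m → l < m → k ≠ l → R k * R l = 0
  ne_zero : ∀ k, R k ≠ 0
  sum_eq : ∑ k ∈ Finset.range m, R k = p
  periodic : ∀ k, R (k + m) = R k
  shift : ∀ s k, Φ.M s * R k = R (k + 1) * Φ.M s
  sigma : ∀ k, Commute Φ.σ (R k)
  mem_peripheral : ∀ k, R k * Φ.σ ∈ Φ.peripheral
  spectral : ∀ ν : ℂ, ‖ν‖ = 1 → ∀ D ∈ Φ.twisted ν, p * D = D → D * p = D →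
    ∃ a : ℕ → ℂ, D = ∑ k ∈ Finset.range m, a k • R k

lemma twisted_pow {ν : ℂ} {U : Matrix (Fin d) (Fin d) ℂ} (hU : U ∈ Φ.twisted ν) (j : ℕ) :
    U ^ j ∈ Φ.twisted (ν ^ j) := by
  induction j with
  | zero => simpa using one_mem_twisted
  | succ j ih => rw [pow_succ, pow_succ]; exact twisted_mul ih hU

/-- A unitary of a block whose powers exhaust the twisted commutants of the block. -/
lemma IsBlock.exists_generator {p : Matrix (Fin d) (Fin d) ℂ} (hp : Φ.IsBlock p) :
    ∃ (m : ℕ) (ζ : ℂ) (U : Matrix (Fin d) (Fin d) ℂ), 0 < m ∧ IsPrimitiveRoot ζ m ∧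
      U ∈ Φ.twisted ζ ∧ p * U = U ∧ U * p = U ∧ Uᴴ * U = p ∧ U * Uᴴ = p ∧ U ^ m * p = p ∧
      ∀ ν : ℂ, ‖ν‖ = 1 → ∀ D ∈ Φ.twisted ν, p * D = D → D * p = D →
        ∃ (j : ℕ) (c : ℂ), D = c • (U ^ j * p) := by
  -- The phases carried by unitaries of the block form a finite subgroup of ℂˣ, which is therefore
  -- cyclic.
  let G : Subgroup ℂˣ :=
    { carrier := {u | ‖(u : ℂ)‖ = 1 ∧ ∃ Y ∈ Φ.twisted u, p * Y = Y ∧ Y * p = Y ∧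
        Yᴴ * Y = p ∧ Y * Yᴴ = p}
      one_mem' := ⟨by simp, p, by simpa using hp.mem_twisted, hp.mul_self, hp.mul_self, by
        rw [hp.conjTranspose_eq, hp.mul_self], by rw [hp.conjTranspose_eq, hp.mul_self]⟩
      mul_mem' := by
        rintro u v ⟨hu, Y, hY, y1, y2, y3, y4⟩ ⟨hv, Z, hZ, z1, z2, z3, z4⟩
        refine ⟨by simp [hu, hv], Y * Z, by simpa using twisted_mul hY hZ, ?_, ?_, ?_, ?_⟩
        · rw [← Matrix.mul_assoc, y1]
        · rw [Matrix.mul_assoc, z2]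
        · rw [Matrix.conjTranspose_mul, Matrix.mul_assoc, ← Matrix.mul_assoc Yᴴ, y3, z1, z3]
        · rw [Matrix.conjTranspose_mul, Matrix.mul_assoc, ← Matrix.mul_assoc Z, z4,
            ← Matrix.mul_assoc, y2, y4]
      inv_mem' := by
        rintro u ⟨hu, Y, hY, y1, y2, y3, y4⟩
        have hinv : ((u⁻¹ : ℂˣ) : ℂ) = star (u : ℂ) := by
          rw [Units.val_inv_eq_inv_val]
          exact (eq_inv_of_mul_eq_one_left (conj_mul_of_norm hu)).symm
        refine ⟨by simp [hu], Yᴴ, ?_, hp.mul_conjTranspose_eq y2, hp.conjTranspose_mul_eq y1, ?_, ?_⟩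
        · rw [hinv]; exact conjTranspose_mem_twisted hu hY
        · rw [Matrix.conjTranspose_conjTranspose, y4]
        · rw [Matrix.conjTranspose_conjTranspose, y3] }
  have hfin : Finite G := by
    have h1 : ((fun u : ℂˣ => (u : ℂ)) ⁻¹' {ν : ℂ | ‖ν‖ = 1 ∧ ∃ Y ∈ Φ.twisted ν, Y ≠ 0}).Finite :=
      Φ.finite_twisted.preimage Units.val_injective.injOn
    refine Set.Finite.to_subtype (h1.subset ?_)
    rintro u ⟨hu, Y, hY, y1, y2, y3, y4⟩
    refine ⟨hu, Y, hY, ?_⟩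
    rintro rfl
    exact hp.ne_zero (by rw [← y3, Matrix.mul_zero])
  have hcyc : IsCyclic G := inferInstance
  obtain ⟨g, hg⟩ := hcyc.exists_generator
  obtain ⟨hg1, Y, hY, y1, y2, y3, y4⟩ := g.2
  set m := orderOf g with hm
  have hmpos : 0 < m := orderOf_pos g
  have hζ : IsPrimitiveRoot (((g : ℂˣ) : ℂ)) m := by
    have h1 : IsPrimitiveRoot g m := IsPrimitiveRoot.orderOf g
    have h2 : IsPrimitiveRoot (g : ℂˣ) m :=
      h1.map_of_injective (f := G.subtype) (Subgroup.subtype_injective G)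
    exact IsPrimitiveRoot.coe_units_iff.mpr h2
  set ζ : ℂ := ((g : ℂˣ) : ℂ)
  have hYp : ∀ j, p * (Y ^ j * p) = Y ^ j * p := by
    intro j
    induction j with
    | zero => simp [hp.mul_self]
    | succ j ih => rw [pow_succ', Matrix.mul_assoc, ← Matrix.mul_assoc, y1]
  have hpow : Y ^ m * p ∈ Φ.twisted 1 := by
    have := twisted_mul (twisted_pow hY m) hp.mem_twisted
    rwa [hζ.pow_eq_one, one_mul] at this
  obtain ⟨c, hc⟩ := hp.exists_scalar_of_mem hpow (hYp m)
    (by rw [Matrix.mul_assoc, hp.mul_self])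
  have hunit : ∀ j, (Y ^ j * p)ᴴ * (Y ^ j * p) = p := by
    intro j
    induction j with
    | zero => simp [hp.conjTranspose_eq, hp.mul_self]
    | succ j ih =>
      rw [pow_succ', Matrix.mul_assoc, Matrix.conjTranspose_mul, Matrix.mul_assoc,
        ← Matrix.mul_assoc Yᴴ, y3, hYp, ih]
  have hcc : star c * c = 1 := by
    have h1 := hunit m
    rw [hc, Matrix.conjTranspose_smul, Matrix.smul_mul, Matrix.mul_smul, smul_smul,
      hp.conjTranspose_eq, hp.mul_self] at h1
    by_contra h
    have h2 : (star c * c - 1) • p = 0 := by rw [sub_smul, h1, one_smul, sub_self]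
    rcases smul_eq_zero.mp h2 with h3 | h3
    · exact h (sub_eq_zero.mp h3)
    · exact hp.ne_zero h3
  -- Since Y^m p = c p with |c| = 1, rescaling Y by an m-th root w of c̄ gives (wY)^m p = p.
  obtain ⟨w, hw⟩ := IsAlgClosed.exists_pow_nat_eq (star c) hmpos
  have hww : star w * w = 1 := by
    have h1 : ‖c‖ = 1 := by
      have := congrArg norm hcc
      rw [norm_mul, norm_star, norm_one] at this
      nlinarith [norm_nonneg c]
    have h2 : ‖w‖ ^ m = 1 := by rw [← norm_pow, hw, norm_star, h1]
    exact conj_mul_of_norm ((pow_eq_one_iff_of_nonneg (norm_nonneg w) hmpos.ne').mp h2)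
  refine ⟨m, ζ, w • Y, hmpos, hζ, Submodule.smul_mem _ _ hY, ?_, ?_, ?_, ?_, ?_, ?_⟩
  · rw [Matrix.mul_smul, y1]
  · rw [Matrix.smul_mul, y2]
  · rw [Matrix.conjTranspose_smul, Matrix.smul_mul, Matrix.mul_smul, smul_smul, y3, hww, one_smul]
  · rw [Matrix.conjTranspose_smul, Matrix.smul_mul, Matrix.mul_smul, smul_smul, y4, mul_comm, hww,
      one_smul]
  · rw [smul_pow, Matrix.smul_mul, hc, hw, smul_smul, hcc, one_smul]
  · intro ν hν D hD d1 d2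
    by_cases hD0 : D = 0
    · exact ⟨0, 0, by simp [hD0]⟩
    obtain ⟨t, ht0, t1, t2⟩ := hp.exists_partialIsometry hp hν hD d1 d2 hD0
    have hν0 : ν ≠ 0 := by
      rintro rfl
      simp at hν
    have hmem : Units.mk0 ν hν0 ∈ G :=
      ⟨hν, t • D, Submodule.smul_mem _ _ hD, by rw [Matrix.mul_smul, d1],
        by rw [Matrix.smul_mul, d2], t1, t2⟩
    obtain ⟨j, hj⟩ := (mem_powers_iff_mem_zpowers).mpr (hg ⟨_, hmem⟩)
    have hj' : ζ ^ j = ν := by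
      have := congrArg (fun u : G => ((u : ℂˣ) : ℂ)) hj
      simpa using this
    have hYj : Y ^ j * p ∈ Φ.twisted ν := by
      have := twisted_mul (twisted_pow hY j) hp.mem_twisted
      rwa [hj', mul_one] at this
    have hYj' : (Y ^ j * p) * (Y ^ j * p)ᴴ = p := by
      have : ∀ j, (Y ^ j * p) * (Y ^ j * p)ᴴ = p := by
        intro j
        induction j with
        | zero => simp [hp.conjTranspose_eq, hp.mul_self]
        | succ j ih =>
          rw [pow_succ', Matrix.mul_assoc Y, Matrix.conjTranspose_mul, Matrix.mul_assoc,
            ← Matrix.mul_assoc (Y ^ j * p), ih, ← Matrix.mul_assoc, y2, y4]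
      exact this j
    -- The phases of D and Y^j p agree, so (Y^j p)†D has phase one and is a scalar on the block.
    obtain ⟨e, he⟩ := hp.exists_scalar_of_mem (IsBlock.conjTranspose_mul_mem hν hYj hD)
      (by rw [← Matrix.mul_assoc, hp.mul_conjTranspose_eq (by rw [Matrix.mul_assoc, hp.mul_self])])
      (by rw [Matrix.mul_assoc, d2])
    have hD' : D = e • (Y ^ j * p) := by
      calc D = (Y ^ j * p) * ((Y ^ j * p)ᴴ * D) := by rw [← Matrix.mul_assoc, hYj', d1]
        _ = _ := by rw [he, Matrix.mul_smul, Matrix.mul_assoc, hp.mul_self]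
    refine ⟨j, e * star w ^ j, ?_⟩
    rw [smul_pow, Matrix.smul_mul, smul_smul, mul_assoc, ← mul_pow, hww, one_pow, mul_one]
    exact hD'

/-- R k is the spectral projection of U for the eigenvalue ζ^k, written as a discrete Fourier
transform of the powers of U. The relation U M^s = ζ M^s U says that M^s raises the eigenvalue from
ζ^k to ζ^(k+1), which is the cyclic shift. -/
lemma IsBlock.exists_cyclicFamily {p : Matrix (Fin d) (Fin d) ℂ} (hp : Φ.IsBlock p) :
    ∃ m R, Φ.IsCyclicFamily p m R := by
  obtain ⟨m, ζ, U, hm, hζ, hU, pU, Up, UU, UU', hUm, hgen⟩ := hp.exists_generator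
  have hm0 : (m : ℂ) ≠ 0 := by exact_mod_cast hm.ne'
  have hζ0 : ζ ≠ 0 := hζ.ne_zero hm.ne'
  have hζn : ‖ζ‖ = 1 := hζ.norm'_eq_one hm.ne'
  have hζi : ζ⁻¹ = star ζ := (eq_inv_of_mul_eq_one_left (conj_mul_of_norm hζn)).symm
  -- The factor p matters only for j = 0, where U ^ 0 is the identity of the whole space and not of
  -- the block.
  let u : ℕ → Matrix (Fin d) (Fin d) ℂ := fun j => U ^ j * p
  have hu_succ : ∀ j, U * u j = u (j + 1) := fun j => by
    change U * (U ^ j * p) = U ^ (j + 1) * p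
    rw [pow_succ', Matrix.mul_assoc]
  have hu_zero : u 0 = p := by simp [u]
  have hu_m : u m = p := hUm
  have hpu : ∀ j, p * u j = u j := by
    intro j
    cases j with
    | zero => rw [hu_zero, hp.mul_self]
    | succ j => rw [← hu_succ, ← Matrix.mul_assoc, pU]
  have hup : ∀ j, u j * p = u j := fun j => by
    change U ^ j * p * p = U ^ j * p
    rw [Matrix.mul_assoc, hp.mul_self]
  have hut : ∀ j, u j ∈ Φ.twisted (ζ ^ j) := fun j => by
    have := twisted_mul (twisted_pow hU j) hp.mem_twisted
    rwa [mul_one] at this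
  have hζj : ∀ j, ‖ζ ^ j‖ = 1 := fun j => by rw [norm_pow, hζn, one_pow]
  let R : ℕ → Matrix (Fin d) (Fin d) ℂ := fun k =>
    (m : ℂ)⁻¹ • ∑ j ∈ Finset.range m, (ζ⁻¹) ^ (j * k) • u j
  have hpR : ∀ k, p * R k = R k := fun k => by
    simp only [R, Matrix.mul_smul, Finset.mul_sum, hpu]
  have hUR : ∀ k, U * R k = ζ ^ k • R k := by
    intro k
    have h1 : U * R k = (m : ℂ)⁻¹ • (ζ ^ k • ∑ j ∈ Finset.range m, (ζ⁻¹) ^ ((j + 1) * k) • u (j + 1)) := by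
      simp only [R, Matrix.mul_smul, Finset.mul_sum, Finset.smul_sum, hu_succ]
      refine Finset.sum_congr rfl fun j _ => ?_
      rw [smul_smul (ζ ^ k), add_mul, pow_add, one_mul, mul_left_comm, ← mul_pow,
        mul_inv_cancel₀ hζ0, one_pow, mul_one]
    have h2 : ∑ j ∈ Finset.range m, (ζ⁻¹) ^ ((j + 1) * k) • u (j + 1) =
        ∑ j ∈ Finset.range m, (ζ⁻¹) ^ (j * k) • u j := by
      have h3 := Finset.sum_range_succ (fun j => (ζ⁻¹) ^ (j * k) • u j) m
      rw [Finset.sum_range_succ' (fun j => (ζ⁻¹) ^ (j * k) • u j) m] at h3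
      have h4 : (ζ⁻¹) ^ (m * k) • u m = (ζ⁻¹) ^ (0 * k) • u 0 := by
        rw [hu_m, hu_zero, pow_mul, inv_pow, hζ.pow_eq_one]
        simp
      rw [h4] at h3
      exact add_right_cancel h3
    rw [h1, h2, smul_comm]
  have hURs : ∀ k, Uᴴ * R k = (star ζ) ^ k • R k := by
    intro k
    have h1 : R k = ζ ^ k • (Uᴴ * R k) := by
      rw [← Matrix.mul_smul, ← hUR, ← Matrix.mul_assoc, UU, hpR]
    conv_rhs => rw [h1, smul_smul, ← mul_pow, conj_mul_of_norm hζn, one_pow, one_smul]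
  have hsum : ∑ k ∈ Finset.range m, R k = p := by
    simp only [R]
    rw [← Finset.smul_sum, Finset.sum_comm]
    have h1 : ∀ j ∈ Finset.range m, ∑ k ∈ Finset.range m, (ζ⁻¹) ^ (j * k) • u j =
        if j = 0 then (m : ℂ) • p else 0 := by
      intro j hj
      rw [← Finset.sum_smul]
      split_ifs with h0
      · subst h0
        simp [hu_zero]
      · have h2 : ∑ k ∈ Finset.range m, (ζ⁻¹) ^ (j * k) = 0 := by
          have hne : (ζ⁻¹) ^ j ≠ 1 := by
            rw [inv_pow]
            intro h
            exact hζ.pow_ne_one_of_pos_of_lt h0 (Finset.mem_range.mp hj) (inv_eq_one.mp h)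
          have h3 := mul_neg_geom_sum ((ζ⁻¹) ^ j) m
          rw [← pow_mul, mul_comm j m, pow_mul, inv_pow ζ m, hζ.pow_eq_one, inv_one, one_pow,
            sub_self] at h3
          rcases mul_eq_zero.mp h3 with h | h
          · exact absurd (sub_eq_zero.mp h).symm hne
          · simpa only [← pow_mul] using h
        rw [h2, zero_smul]
    rw [Finset.sum_congr rfl h1, Finset.sum_ite_eq' (Finset.range m) 0]
    rw [if_pos (Finset.mem_range.mpr hm), smul_smul, inv_mul_cancel₀ hm0, one_smul]
  -- Orthogonality of eigenvectors of a unitary for distinct eigenvalues. Together with ∑ R l = p it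
  -- also yields (R k)†R k = R k, so R k is a projection without any computation with Fourier sums.
  have horth' : ∀ k l, k < m → l < m → k ≠ l → (R l)ᴴ * R k = 0 := by
    intro k l hk hl hkl
    have h1 : (R l)ᴴ * Uᴴ = (star ζ) ^ l • (R l)ᴴ := by
      rw [← Matrix.conjTranspose_mul, hUR, Matrix.conjTranspose_smul, star_pow]
    have h2 : (star ζ) ^ l • ((R l)ᴴ * R k) = (star ζ) ^ k • ((R l)ᴴ * R k) := by
      rw [← Matrix.smul_mul, ← h1, Matrix.mul_assoc, hURs, Matrix.mul_smul]
    by_contra h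
    have h3 : (star ζ) ^ l = (star ζ) ^ k := smul_left_injective _ h h2
    rw [← star_pow, ← star_pow, star_inj] at h3
    exact hkl (hζ.pow_inj hk hl h3.symm)
  have hper : ∀ k, R (k + m) = R k := by
    intro k
    simp only [R]
    congr 1
    refine Finset.sum_congr rfl fun j _ => ?_
    rw [mul_add, pow_add, mul_comm j m, pow_mul _ m, inv_pow ζ m, hζ.pow_eq_one]
    simp
  have hmod : ∀ k, R (k % m) = R k := by
    intro k
    have h1 : ∀ i l, R (l + m * i) = R l := by
      intro i
      induction i with
      | zero => simp
      | succ i ih => intro l; rw [mul_add, mul_one, ← add_assoc, hper, ih]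
    conv_rhs => rw [← Nat.mod_add_div k m]
    rw [h1]
  have hRR : ∀ k, k < m → (R k)ᴴ * R k = R k := by
    intro k hk
    have h1 : (∑ l ∈ Finset.range m, R l)ᴴ * R k = R k := by
      rw [hsum, hp.conjTranspose_eq, hpR]
    rw [Matrix.conjTranspose_sum, Finset.sum_mul, Finset.sum_eq_single k] at h1
    · exact h1
    · intro l hl hlk
      exact horth' k l hk (Finset.mem_range.mp hl) hlk.symm
    · intro h
      exact absurd (Finset.mem_range.mpr hk) h
  have hproj' : ∀ k, k < m → IsStarProjection (R k) := by
    intro k hk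
    have hh : (R k)ᴴ = R k := by
      conv_lhs => rw [← hRR k hk, Matrix.conjTranspose_mul, Matrix.conjTranspose_conjTranspose]
      exact hRR k hk
    refine ⟨?_, hh⟩
    have := hRR k hk
    rwa [hh] at this
  have hproj : ∀ k, IsStarProjection (R k) := fun k => by
    rw [← hmod k]
    exact hproj' _ (Nat.mod_lt _ hm)
  have hshift : ∀ s k, Φ.M s * R k = R (k + 1) * Φ.M s := by
    intro s k
    simp only [R, Matrix.mul_smul, Matrix.smul_mul, Finset.mul_sum, Finset.sum_mul]
    congr 1
    refine Finset.sum_congr rfl fun j _ => ?_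
    rw [hut j s, smul_smul, mul_add, mul_one, pow_add, mul_assoc, ← mul_pow, inv_mul_cancel₀ hζ0,
      one_pow, mul_one]
  have hne : ∀ k, R k ≠ 0 := by
    intro k hk
    -- R (l + 1) M^s = M^s R l, so a vanishing projection makes the next one vanish on σ, and σ is
    -- invertible. Running round the cycle would give p = 0.
    have hstep : ∀ l, R l = 0 → R (l + 1) = 0 := by
      intro l hl
      have h1 : R (l + 1) * Φ.σ = 0 := by
        rw [← Φ.fixed, Finset.mul_sum]
        refine Finset.sum_eq_zero fun s _ => ?_
        rw [← Matrix.mul_assoc, ← Matrix.mul_assoc, ← hshift, hl, Matrix.mul_zero,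
          Matrix.zero_mul, Matrix.zero_mul]
      rw [← Matrix.mul_one (R (l + 1)), ← sigma_mul_inv Φ, ← Matrix.mul_assoc, h1,
        Matrix.zero_mul]
    have hall : ∀ i, R (k + i) = 0 := by
      intro i
      induction i with
      | zero => exact hk
      | succ i ih => exact hstep _ ih
    apply hp.ne_zero
    rw [← hsum]
    refine Finset.sum_eq_zero fun l _ => ?_
    -- Since m ≥ 1, the index l + m k is at least k, so it is among the indices already known to
    -- give zero.
    have h1 : R (l + m * k) = R l := by
      rw [← hmod, Nat.add_mul_mod_self_left, hmod]
    rw [← h1]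
    obtain ⟨i, hi⟩ := Nat.exists_eq_add_of_le
      ((Nat.le_mul_of_pos_left k hm).trans (Nat.le_add_left (m * k) l))
    rw [hi]
    exact hall i
  refine ⟨m, R, hm, hproj, ?_, hne, hsum, hper, hshift, ?_, ?_, ?_⟩
  · intro k l hk hl hkl
    have := horth' l k hl hk hkl.symm
    rwa [(hproj k).conjTranspose_eq] at this
  · intro k
    refine Commute.smul_right (Commute.sum_right _ _ _ fun j _ => Commute.smul_right ?_ _) _
    exact hp.commute_sigma_of_mem (hζj j) (hut j) (hpu j) (hup j)
  · intro k
    simp only [R, Matrix.smul_mul, Finset.sum_mul]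
    exact Submodule.smul_mem _ _ (Submodule.sum_mem _ fun j _ =>
      Submodule.smul_mem _ _ (mul_sigma_mem_peripheral (hζj j) (hut j)))
  · intro ν hν D hD d1 d2
    obtain ⟨j, c, hDj⟩ := hgen ν hν D hD d1 d2
    refine ⟨fun k => c * (ζ ^ k) ^ j, ?_⟩
    have h1 : ∀ i k, U ^ i * R k = (ζ ^ k) ^ i • R k := by
      intro i k
      induction i with
      | zero => simp
      | succ i ih =>
        rw [pow_succ, Matrix.mul_assoc, hUR, Matrix.mul_smul, ih, smul_smul, ← pow_succ']
    rw [hDj]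
    conv_lhs => rw [← hsum]
    rw [Finset.mul_sum, Finset.smul_sum]
    refine Finset.sum_congr rfl fun k _ => ?_
    rw [h1, smul_smul]

end IUMPS
-- Explicit form of the peripheral channel on an irreducible component
namespace IUMPS

variable {d ds : ℕ} {Φ : IUMPS d ds}

/-- The ranges of the M^s jointly span the space, because ∑ M^s σ M^s† = σ is invertible. -/
lemma eq_zero_of_mul_M {A : Matrix (Fin d) (Fin d) ℂ} (h : ∀ s, A * Φ.M s = 0) : A = 0 := by
  have h1 : A * Φ.σ = 0 := by
    rw [← Φ.fixed, Finset.mul_sum]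
    refine Finset.sum_eq_zero fun s _ => ?_
    rw [← Matrix.mul_assoc, ← Matrix.mul_assoc, h, Matrix.zero_mul, Matrix.zero_mul]
  rw [← Matrix.mul_one A, ← sigma_mul_inv Φ, ← Matrix.mul_assoc, h1, Matrix.zero_mul]

namespace IsCyclicFamily

variable {p : Matrix (Fin d) (Fin d) ℂ} {m : ℕ} {R : ℕ → Matrix (Fin d) (Fin d) ℂ}

lemma mod (h : Φ.IsCyclicFamily p m R) (k : ℕ) : R (k % m) = R k := by
  have h1 : ∀ i l, R (l + m * i) = R l := by
    intro i
    induction i with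
    | zero => simp
    | succ i ih => intro l; rw [mul_add, mul_one, ← add_assoc, h.periodic, ih]
  conv_rhs => rw [← Nat.mod_add_div k m]
  rw [h1]

lemma mul_eq_zero (h : Φ.IsCyclicFamily p m R) {k l : ℕ} (hkl : k % m ≠ l % m) :
    R k * R l = 0 := by
  rw [← h.mod k, ← h.mod l]
  exact h.orthogonal _ _ (Nat.mod_lt _ h.pos) (Nat.mod_lt _ h.pos) hkl

lemma mul_self (h : Φ.IsCyclicFamily p m R) (k : ℕ) : R k * R k = R k :=
  (h.proj k).isIdempotentElem

lemma conjTranspose_eq (h : Φ.IsCyclicFamily p m R) (k : ℕ) : (R k)ᴴ = R k :=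
  (h.proj k).conjTranspose_eq

lemma block_mul (h : Φ.IsCyclicFamily p m R) (k : ℕ) : p * R k = R k := by
  rw [← h.sum_eq, Finset.sum_mul, Finset.sum_eq_single (k % m)]
  · rw [h.mod, h.mul_self]
  · intro l hl hlk
    refine h.mul_eq_zero ?_
    rwa [Nat.mod_eq_of_lt (Finset.mem_range.mp hl)]
  · intro hk
    exact absurd (Finset.mem_range.mpr (Nat.mod_lt _ h.pos)) hk

lemma mul_block (h : Φ.IsCyclicFamily p m R) (hp : Φ.IsBlock p) (k : ℕ) : R k * p = R k := by
  have := congrArg Matrix.conjTranspose (h.block_mul k)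
  rwa [Matrix.conjTranspose_mul, h.conjTranspose_eq, hp.conjTranspose_eq] at this

/-- The shift relation and trace preservation make tr(R k σ) independent of k. -/
lemma trace_mul_sigma (h : Φ.IsCyclicFamily p m R) (k : ℕ) :
    (m : ℂ) * (R k * Φ.σ).trace = (p * Φ.σ).trace := by
  have hstep : ∀ k, (R (k + 1) * Φ.σ).trace = (R k * Φ.σ).trace := by
    intro k
    conv_lhs => rw [← Φ.fixed]
    rw [Finset.mul_sum, Matrix.trace_sum]
    calc ∑ s, (R (k + 1) * (Φ.M s * Φ.σ * (Φ.M s)ᴴ)).trace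
        = ∑ s, ((Φ.M s)ᴴ * Φ.M s * (R k * Φ.σ)).trace := by
          refine Finset.sum_congr rfl fun s _ => ?_
          rw [← Matrix.mul_assoc, ← Matrix.mul_assoc, ← h.shift, Matrix.trace_mul_comm]
          simp only [Matrix.mul_assoc]
      _ = _ := by rw [← Matrix.trace_sum, ← Finset.sum_mul, Φ.canonical, Matrix.one_mul]
  have hconst : ∀ k, (R k * Φ.σ).trace = (R 0 * Φ.σ).trace := by
    intro k
    induction k with
    | zero => rfl
    | succ k ih => rw [hstep, ih]
  rw [← h.sum_eq, Finset.sum_mul, Matrix.trace_sum, Finset.sum_congr rfl fun l _ => hconst l,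
    hconst k]
  simp

/-- D is diagonal with respect to the R k; comparing D M^s with ν M^s D on R k transports its
weights along the cycle. -/
lemma exists_weights (h : Φ.IsCyclicFamily p m R) {ν : ℂ} (hν : ‖ν‖ = 1)
    {D : Matrix (Fin d) (Fin d) ℂ} (hD : D ∈ Φ.twisted ν) (h1 : p * D = D) (h2 : D * p = D) :
    ∃ a : ℕ → ℂ, (∀ k, D * R k = a k • R k) ∧ (∀ k, R k * D = a k • R k) ∧
      ∀ k, a (k + 1) = ν * a k := by
  obtain ⟨a, ha⟩ := h.spectral ν hν D hD h1 h2
  have e1 : ∀ k, D * R k = a (k % m) • R k := by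
    intro k
    rw [ha, Finset.sum_mul, Finset.sum_eq_single (k % m)]
    · rw [Matrix.smul_mul, h.mod, h.mul_self]
    · intro l hl hlk
      rw [Matrix.smul_mul, h.mul_eq_zero, smul_zero]
      rwa [Nat.mod_eq_of_lt (Finset.mem_range.mp hl)]
    · intro hk
      exact absurd (Finset.mem_range.mpr (Nat.mod_lt _ h.pos)) hk
  have e2 : ∀ k, R k * D = a (k % m) • R k := by
    intro k
    rw [ha, Finset.mul_sum, Finset.sum_eq_single (k % m)]
    · rw [Matrix.mul_smul, h.mod, h.mul_self]
    · intro l hl hlk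
      rw [Matrix.mul_smul, h.mul_eq_zero, smul_zero]
      rw [Nat.mod_eq_of_lt (Finset.mem_range.mp hl)]
      exact hlk.symm
    · intro hk
      exact absurd (Finset.mem_range.mpr (Nat.mod_lt _ h.pos)) hk
  refine ⟨fun k => a (k % m), e1, e2, fun k => ?_⟩
  by_contra hne
  apply h.ne_zero (k + 1)
  refine eq_zero_of_mul_M (Φ := Φ) fun s => ?_
  have h3 : a ((k + 1) % m) • (R (k + 1) * Φ.M s) = (ν * a (k % m)) • (R (k + 1) * Φ.M s) := by
    calc a ((k + 1) % m) • (R (k + 1) * Φ.M s) = D * Φ.M s * R k := by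
          rw [← Matrix.smul_mul, ← e1, Matrix.mul_assoc, ← h.shift, Matrix.mul_assoc]
      _ = _ := by
          rw [hD s, Matrix.smul_mul, Matrix.mul_assoc, e1, Matrix.mul_smul, h.shift, smul_smul]
  by_contra h0
  exact hne (smul_left_injective _ h0 h3)

lemma weights_add {ν : ℂ} {a : ℕ → ℂ} (ha : ∀ k, a (k + 1) = ν * a k) (k b : ℕ) :
    a (k + b) = ν ^ b * a k := by
  induction b with
  | zero => simp
  | succ b ih => rw [← add_assoc, ha, ih, pow_succ]; ring

lemma finRotate (h : Φ.IsCyclicFamily p m R) (k : Fin m) : R (finRotate m k) = R (k + 1) := by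
  obtain ⟨n, rfl⟩ := Nat.exists_eq_succ_of_ne_zero h.pos.ne'
  rw [← h.mod (k + 1), finRotate_apply, Fin.val_add, Fin.val_one', Nat.add_mod_mod]

/-- It suffices to compare pairings with twisted Z. As X lives in the block, Z may be replaced by D
= pZp, which is diagonal in the R k with a (k + 1) = ν a k. The shift from k to k + 1 thus produces
the required factor ν̄. -/
lemma mapOf_Eper (h : Φ.IsCyclicFamily p m R) (hp : Φ.IsBlock p) {X : Matrix (Fin d) (Fin d) ℂ}
    (hX : p * X * p = X) :
    mapOf Φ.Eper X = ((m : ℂ) / (p * Φ.σ).trace) •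
      ∑ k : Fin m, (R k * X * R k).trace • (R (_root_.finRotate m k) * Φ.σ * R (_root_.finRotate m k)) := by
  have hq : (p * Φ.σ).trace ≠ 0 := hp.trace_sigma_pos.ne'
  have hRσ : ∀ k, R k * Φ.σ * R k = R k * Φ.σ := fun k => by
    rw [Matrix.mul_assoc, (h.sigma k).eq, ← Matrix.mul_assoc, h.mul_self]
  have hRX : ∀ k, (R k * X * R k).trace = (R k * X).trace := fun k => by
    rw [Matrix.trace_mul_comm, ← Matrix.mul_assoc, h.mul_self]
  simp only [hRσ, hRX, h.finRotate]
  rw [← Finset.sum_range (fun k => (R k * X).trace • (R (k + 1) * Φ.σ))]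
  have key := mapOf_Eper_pow (Φ := Φ) one_ne_zero (X := X)
    (R := ((m : ℂ) / (p * Φ.σ).trace) • ∑ k ∈ Finset.range m,
      (R k * X).trace • (R (k + 1) * Φ.σ)) ?_ ?_
  · rwa [pow_one] at key
  · exact Submodule.smul_mem _ _ (Submodule.sum_mem _ fun k _ =>
      Submodule.smul_mem _ _ (h.mem_peripheral _))
  · intro ν hν Z hZ
    have hD : p * Z * p ∈ Φ.twisted ν := by
      have := twisted_mul (twisted_mul hp.mem_twisted hZ) hp.mem_twisted
      rwa [one_mul, mul_one] at this
    have d1 : p * (p * Z * p) = p * Z * p := by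
      rw [← Matrix.mul_assoc, ← Matrix.mul_assoc, hp.mul_self]
    have d2 : p * Z * p * p = p * Z * p := by rw [Matrix.mul_assoc, hp.mul_self]
    obtain ⟨a, -, a2, a3⟩ := h.exists_weights hν hD d1 d2
    set D := p * Z * p
    have a4 : ∀ k, Dᴴ * R k = star (a k) • R k := by
      intro k
      have := congrArg Matrix.conjTranspose (a2 k)
      rwa [Matrix.conjTranspose_mul, Matrix.conjTranspose_smul, h.conjTranspose_eq] at this
    have hDh : Dᴴ = p * Zᴴ * p := by
      simp only [D, Matrix.conjTranspose_mul, hp.conjTranspose_eq, Matrix.mul_assoc]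
    have t1 : ∀ k, (Zᴴ * (R k * Φ.σ)).trace = star (a k) * (R k * Φ.σ).trace := by
      intro k
      rw [← smul_eq_mul (star (a k)), ← Matrix.trace_smul, ← Matrix.smul_mul, ← a4, hDh]
      calc (Zᴴ * (R k * Φ.σ)).trace = (Zᴴ * (p * R k * p * Φ.σ)).trace := by
            rw [h.block_mul, h.mul_block hp]
        _ = (p * Zᴴ * p * R k * Φ.σ).trace := by
            rw [Matrix.mul_assoc (p * R k), ← hp.commute_sigma.eq, ← Matrix.mul_assoc,
              ← Matrix.mul_assoc, Matrix.trace_mul_comm]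
            simp only [Matrix.mul_assoc]
    have t2 : (Zᴴ * X).trace = ∑ k ∈ Finset.range m, star (a k) * (R k * X).trace := by
      calc (Zᴴ * X).trace = (Dᴴ * (∑ k ∈ Finset.range m, R k) * X).trace := by
            conv_lhs => rw [← hX]
            rw [h.sum_eq, hDh, ← Matrix.mul_assoc, Matrix.trace_mul_comm]
            simp only [Matrix.mul_assoc]
            rw [← Matrix.mul_assoc p p, hp.mul_self]
        _ = _ := by
            rw [Finset.mul_sum, Finset.sum_mul, Matrix.trace_sum]
            refine Finset.sum_congr rfl fun k _ => ?_
            rw [a4, Matrix.smul_mul, Matrix.trace_smul, smul_eq_mul]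
    rw [t2, Matrix.mul_smul, Matrix.trace_smul, Finset.mul_sum, Matrix.trace_sum, smul_eq_mul,
      Finset.mul_sum, Finset.mul_sum]
    refine Finset.sum_congr rfl fun k _ => ?_
    rw [Matrix.mul_smul, Matrix.trace_smul, t1, smul_eq_mul, a3, star_mul', pow_one,
      ← h.trace_mul_sigma (k + 1)]
    have hm : (m : ℂ) ≠ 0 := by exact_mod_cast h.pos.ne'
    have hR : (R (k + 1) * Φ.σ).trace ≠ 0 := by
      intro h0
      rw [← h.trace_mul_sigma (k + 1), h0, mul_zero] at hq
      exact hq rfl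
    field_simp

end IsCyclicFamily

/-- A decomposition of the virtual space into irreducible components with their cyclic
projections. -/
structure BlockData (Φ : IUMPS d ds) where
  /-- the number of components -/
  N : ℕ
  /-- the projections onto the components -/
  blk : Fin N → Matrix (Fin d) (Fin d) ℂ
  /-- the periods -/
  m : Fin N → ℕ
  /-- the cyclic projections -/
  R : Fin N → ℕ → Matrix (Fin d) (Fin d) ℂ
  isBlock : ∀ α, Φ.IsBlock (blk α)
  orthogonal : ∀ α β, α ≠ β → blk α * blk β = 0
  sum_eq : ∑ α, blk α = 1
  cyclic : ∀ α, Φ.IsCyclicFamily (blk α) (m α) (R α)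

lemma nonempty_blockData (Φ : IUMPS d ds) : Nonempty Φ.BlockData := by
  obtain ⟨N, p, hp, horth, hsum⟩ := exists_minimal_decomposition Φ.gens_star
    (IsStarProjection.one (R := Matrix (Fin d) (Fin d) ℂ)) (fun A _ => Commute.one_right A)
  choose m R hR using fun α => IsBlock.exists_cyclicFamily (hp α)
  exact ⟨⟨N, p, m, R, hp, horth, hsum, hR⟩⟩

namespace BlockData

variable (D : Φ.BlockData)

lemma sum_R (α : Fin D.N) : ∑ k : Fin (D.m α), D.R α k = D.blk α := by
  rw [← (D.cyclic α).sum_eq, Finset.sum_range]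

lemma R_mul_R {α β : Fin D.N} (h : α ≠ β) (k l : ℕ) : D.R α k * D.R β l = 0 := by
  rw [← (D.cyclic α).mul_block (D.isBlock α), ← (D.cyclic β).block_mul, Matrix.mul_assoc,
    ← Matrix.mul_assoc (D.blk α), D.orthogonal α β h, Matrix.zero_mul, Matrix.mul_zero]

lemma isPeripheralDecomposition :
    Φ.IsPeripheralDecomposition D.m (fun α k => D.R α k) where
  period_pos α := (D.cyclic α).pos
  hermitian α k := (D.cyclic α).conjTranspose_eq k
  idempotent α k := (D.cyclic α).mul_self k
  ne_zero α k := (D.cyclic α).ne_zero k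
  orthogonal α k β l h := by
    by_cases hαβ : α = β
    · subst hαβ
      refine (D.cyclic α).orthogonal _ _ k.2 l.2 fun h' => h ?_
      rw [Fin.ext h']
    · exact D.R_mul_R hαβ k l
  sum_eq_one := by simp_rw [D.sum_R, D.sum_eq]
  sigma_eq := by
    have h1 : ∀ α k, D.R α k * Φ.σ * D.R α k = D.R α k * Φ.σ := fun α k => by
      rw [Matrix.mul_assoc, ((D.cyclic α).sigma k).eq, ← Matrix.mul_assoc, (D.cyclic α).mul_self]
    simp_rw [h1, ← Finset.sum_mul, D.sum_R, D.sum_eq, Matrix.one_mul]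
  channel α X hX := by
    rw [D.sum_R] at hX ⊢
    exact (D.cyclic α).mapOf_Eper (D.isBlock α) hX

end BlockData

end IUMPS
namespace IUMPS

variable {d ds : ℕ} {Φ : IUMPS d ds}

/-! ### Eigenbases of the fixed point -/

lemma sigmaMin_le_of_eigen {x : Fin d → ℂ} (hx : x ≠ 0) {l : ℝ} (h : Φ.σ *ᵥ x = (l : ℂ) • x) :
    Φ.sigmaMin ≤ l := by
  have hmem : l ∈ spectrum ℝ Φ.σ := by
    rw [spectrum.mem_iff, Matrix.isUnit_iff_isUnit_det, isUnit_iff_ne_zero, not_not,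
      ← Matrix.exists_mulVec_eq_zero_iff]
    refine ⟨x, hx, ?_⟩
    rw [Matrix.sub_mulVec, h, Algebra.algebraMap_eq_smul_one, Matrix.smul_mulVec,
      Matrix.one_mulVec]
    exact sub_self _
  rw [Φ.posDef.isHermitian.spectrum_real_eq_range_eigenvalues] at hmem
  obtain ⟨i, rfl⟩ := hmem
  exact ciInf_le (Set.finite_range _).bddBelow i

/-- A projection commuting with the fixed point is spanned by eigenvectors of the fixed point. -/
lemma exists_eigenbasis {R : Matrix (Fin d) (Fin d) ℂ} (hR : IsStarProjection R)
    (hσ : Commute Φ.σ R) : ∃ (n : ℕ) (B : Matrix (Fin d) (Fin n) ℂ) (s : Fin n → ℝ),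
      Bᴴ * B = 1 ∧ B * Bᴴ = R ∧ Φ.σ * B = B * Matrix.diagonal (fun i => (s i : ℂ)) ∧
      ∀ i, Φ.sigmaMin ≤ s i := by
  classical
  have hH : (R * Φ.σ).IsHermitian := by
    rw [Matrix.IsHermitian, Matrix.conjTranspose_mul, hR.conjTranspose_eq,
      Φ.posDef.isHermitian.eq, hσ.eq]
  set l := hH.eigenvalues
  set U : Matrix (Fin d) (Fin d) ℂ := hH.eigenvectorUnitary.1
  have hUU : Uᴴ * U = 1 := Unitary.coe_star_mul_self hH.eigenvectorUnitary
  have hUU' : U * Uᴴ = 1 := Unitary.coe_mul_star_self hH.eigenvectorUnitary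
  let u : Fin d → Fin d → ℂ := fun i => (hH.eigenvectorBasis i).ofLp
  have hu : ∀ i, (R * Φ.σ) *ᵥ u i = (l i : ℂ) • u i := fun i => hH.mulVec_eigenvectorBasis i
  have hu0 : ∀ i, u i ≠ 0 := by
    intro i h
    have h1 := hH.eigenvectorBasis.orthonormal.ne_zero i
    apply h1
    ext j
    exact congrFun h j
  have hcol : ∀ i j, U j i = u i j := fun i j => rfl
  -- Since Rσ = σR with σ invertible, Rσ and R have the same kernel: eigenvectors of Rσ for zero are
  -- killed by R, and the others lie in its range.
  have hRu : ∀ i, R *ᵥ u i = if l i = 0 then 0 else u i := by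
    intro i
    split_ifs with hi
    · have h1 : (R * Φ.σ) *ᵥ u i = 0 := by rw [hu, hi]; simp
      rw [← hσ.eq, ← Matrix.mulVec_mulVec] at h1
      have h2 := congrArg (Φ.σ⁻¹ *ᵥ ·) h1
      simpa [Matrix.mulVec_mulVec, ← Matrix.mul_assoc, inv_mul_sigma] using h2
    · have h1 : R *ᵥ ((R * Φ.σ) *ᵥ u i) = (R * Φ.σ) *ᵥ u i := by
        rw [Matrix.mulVec_mulVec, ← Matrix.mul_assoc, hR.isIdempotentElem.eq]
      rw [hu, Matrix.mulVec_smul] at h1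
      have hi' : (l i : ℂ) ≠ 0 := by exact_mod_cast hi
      exact smul_right_injective _ hi' h1
  have hσu : ∀ i, l i ≠ 0 → Φ.σ *ᵥ u i = (l i : ℂ) • u i := by
    intro i hi
    have h1 := hRu i
    rw [if_neg hi] at h1
    calc Φ.σ *ᵥ u i = Φ.σ *ᵥ (R *ᵥ u i) := by rw [h1]
      _ = _ := by rw [Matrix.mulVec_mulVec, hσ.eq, hu]
  let J := {i : Fin d // l i ≠ 0}
  let e := Fintype.equivFin J
  let f : Fin (Fintype.card J) → Fin d := fun a => (e.symm a).1
  have hf : Function.Injective f := Subtype.val_injective.comp e.symm.injective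
  refine ⟨Fintype.card J, U.submatrix id f, fun a => l (f a), ?_, ?_, ?_, ?_⟩
  · have h1 : (U.submatrix id f)ᴴ * U.submatrix id f = (Uᴴ * U).submatrix f f := rfl
    rw [h1, hUU, Matrix.submatrix_one _ hf]
  · have h1 : R = (R * U) * Uᴴ := by rw [Matrix.mul_assoc, hUU', Matrix.mul_one]
    rw [h1]
    ext a b
    rw [Matrix.mul_apply, Matrix.mul_apply]
    have h2 : ∀ i, (R * U) a i = if l i = 0 then 0 else U a i := by
      intro i
      have h3 := congrFun (hRu i) a
      rw [Matrix.mul_apply]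
      change ∑ j, R a j * u i j = _
      change ∑ j, R a j * u i j = _ at h3
      rw [h3]
      split_ifs <;> simp [hcol]
    have h4 : ∀ i, (R * U) a i * Uᴴ i b = if l i ≠ 0 then U a i * Uᴴ i b else 0 := by
      intro i
      rw [h2]
      by_cases hi : l i = 0 <;> simp [hi]
    rw [Finset.sum_congr rfl fun i _ => h4 i, ← Finset.sum_filter]
    rw [Finset.sum_subtype (p := fun i => l i ≠ 0) _ (by simp) (fun i => U a i * Uᴴ i b),
      ← e.symm.sum_comp]
    rfl
  · ext a b
    rw [Matrix.mul_diagonal]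
    have := congrFun (hσu (f b) (e.symm b).2) a
    rw [Matrix.mul_apply]
    change ∑ j, Φ.σ a j * u (f b) j = _
    change ∑ j, Φ.σ a j * u (f b) j = _ at this
    rw [this]
    simp [hcol, mul_comm]
  · intro a
    exact sigmaMin_le_of_eigen (hu0 _) (hσu (f a) (e.symm a).2)

/-! ### Normal form of the peripheral channel -/

/-- The irreducible components together with representatives of their unitary equivalence
classes, the intertwiners, and eigenbases of the fixed point adapted to the cyclic projections. -/
structure NormalForm (Φ : IUMPS d ds) extends BlockData Φ where
  /-- the representative of the class of a component -/
  rep : Fin N → Fin N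
  rep_rep : ∀ α, rep (rep α) = rep α
  /-- the phase of an intertwiner -/
  ph : Fin N → ℂ
  norm_ph : ∀ α, ‖ph α‖ = 1
  /-- the intertwiner from the representative -/
  T : Fin N → Matrix (Fin d) (Fin d) ℂ
  T_mem : ∀ α, T α ∈ Φ.twisted (ph α)
  T_init : ∀ α, (T α)ᴴ * T α = blk (rep α)
  T_final : ∀ α, T α * (T α)ᴴ = blk α
  separate : ∀ α β, rep α ≠ rep β → ∀ ν : ℂ, ‖ν‖ = 1 → ∀ Z ∈ Φ.twisted ν, blk α * Z * blk β = 0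
  /-- the rank of a cyclic projection -/
  n : Fin N → ℕ → ℕ
  /-- an orthonormal basis of a cyclic projection -/
  B : ∀ α k, Matrix (Fin d) (Fin (n α k)) ℂ
  /-- the eigenvalues of the fixed point -/
  s : ∀ α k, Fin (n α k) → ℝ
  B_isometry : ∀ α k, (B α k)ᴴ * B α k = 1
  B_range : ∀ α k, B α k * (B α k)ᴴ = R α k
  B_sigma : ∀ α k, Φ.σ * B α k = B α k * Matrix.diagonal (fun i => (s α k i : ℂ))
  s_ge : ∀ α k i, Φ.sigmaMin ≤ s α k i

lemma mul_eq_of_conjTranspose_mul_self {T p : Matrix (Fin d) (Fin d) ℂ} (h : Tᴴ * T = p)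
    (hp : IsStarProjection p) : T * p = T := by
  have h1 : (T * p - T)ᴴ * (T * p - T) = 0 := by
    have h2 : Tᴴ * (T * p) = p * p := by rw [← Matrix.mul_assoc, h]
    have hpp : p * p = p := hp.isIdempotentElem
    rw [Matrix.conjTranspose_sub, Matrix.conjTranspose_mul, hp.conjTranspose_eq, Matrix.sub_mul,
      Matrix.mul_sub, Matrix.mul_sub, Matrix.mul_assoc, Matrix.mul_assoc, h2, h, hpp, hpp]
    simp
  exact sub_eq_zero.mp (Matrix.conjTranspose_mul_self_eq_zero.mp h1)

lemma mul_eq_of_mul_conjTranspose_self {T p : Matrix (Fin d) (Fin d) ℂ} (h : T * Tᴴ = p)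
    (hp : IsStarProjection p) : p * T = T := by
  have h1 := mul_eq_of_conjTranspose_mul_self (T := Tᴴ) (p := p)
    (by rw [Matrix.conjTranspose_conjTranspose, h]) hp
  have := congrArg Matrix.conjTranspose h1
  rwa [Matrix.conjTranspose_mul, Matrix.conjTranspose_conjTranspose, hp.conjTranspose_eq] at this

/-- Blocks are identified when a partial isometry with a phase intertwines them. A nonzero
compression of a twisted commutant between two blocks is a multiple of such an intertwiner, so none
exists between different classes. -/
lemma nonempty_normalForm (Φ : IUMPS d ds) : Nonempty Φ.NormalForm := by
  obtain ⟨D⟩ := Φ.nonempty_blockData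
  let S : Setoid (Fin D.N) :=
    { r := fun α β => ∃ ν : ℂ, ‖ν‖ = 1 ∧ ∃ T ∈ Φ.twisted ν, Tᴴ * T = D.blk β ∧ T * Tᴴ = D.blk α
      iseqv :=
        { refl := fun α => ⟨1, norm_one, D.blk α, (D.isBlock α).mem_twisted, by
            rw [(D.isBlock α).conjTranspose_eq, (D.isBlock α).mul_self], by
            rw [(D.isBlock α).conjTranspose_eq, (D.isBlock α).mul_self]⟩
          symm := by
            rintro α β ⟨ν, hν, T, hT, h1, h2⟩
            exact ⟨star ν, norm_star_one hν, Tᴴ, conjTranspose_mem_twisted hν hT,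
              by rw [Matrix.conjTranspose_conjTranspose, h2],
              by rw [Matrix.conjTranspose_conjTranspose, h1]⟩
          trans := by
            rintro α β γ ⟨ν, hν, T, hT, h1, h2⟩ ⟨μ, hμ, T', hT', h1', h2'⟩
            refine ⟨ν * μ, by rw [norm_mul, hν, hμ, one_mul], T * T', twisted_mul hT hT', ?_, ?_⟩
            · rw [Matrix.conjTranspose_mul, Matrix.mul_assoc, ← Matrix.mul_assoc Tᴴ, h1,
                mul_eq_of_mul_conjTranspose_self h2' (D.isBlock β).proj, h1']
            · rw [Matrix.conjTranspose_mul, Matrix.mul_assoc, ← Matrix.mul_assoc T', h2',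
                ← Matrix.mul_assoc, mul_eq_of_conjTranspose_mul_self h1 (D.isBlock β).proj, h2] } }
  let rep : Fin D.N → Fin D.N := fun α => (Quotient.mk S α).out
  have hrep : ∀ α, S.r α (rep α) := fun α => S.symm (Quotient.mk_out (s := S) α)
  choose ph hph T hT hT1 hT2 using hrep
  choose n B s h1 h2 h3 h4 using fun α k =>
    exists_eigenbasis ((D.cyclic α).proj k) ((D.cyclic α).sigma k)
  refine ⟨⟨D, rep, ?_, ph, hph, T, hT, hT1, hT2, ?_, n, B, s, h1, h2, h3, h4⟩⟩
  · intro α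
    change (Quotient.mk S (Quotient.mk S α).out).out = (Quotient.mk S α).out
    rw [Quotient.out_eq]
  · intro α β hαβ ν hν Z hZ
    by_contra h0
    have hmem : D.blk α * Z * D.blk β ∈ Φ.twisted ν := by
      have := twisted_mul (twisted_mul (D.isBlock α).mem_twisted hZ) (D.isBlock β).mem_twisted
      rwa [one_mul, mul_one] at this
    obtain ⟨c, -, c1, c2⟩ := (D.isBlock α).exists_partialIsometry (D.isBlock β) hν hmem
      (by rw [← Matrix.mul_assoc, ← Matrix.mul_assoc, (D.isBlock α).mul_self])
      (by rw [Matrix.mul_assoc, (D.isBlock β).mul_self]) h0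
    apply hαβ
    change (Quotient.mk S α).out = (Quotient.mk S β).out
    congr 1
    exact Quotient.sound (s := S) ⟨ν, hν, _, Submodule.smul_mem _ c hmem, c1, c2⟩

end IUMPS
-- Kraus operators adapted to the normal form, and the expansion of words in them
namespace IUMPS

variable {d ds : ℕ} {Φ : IUMPS d ds}

lemma sigmaMin_pos (Φ : IUMPS d ds) : 0 < Φ.sigmaMin := by
  -- tr σ = 1 excludes d = 0, where the infimum would take the default value 0.
  have hd : Nonempty (Fin d) := by
    by_contra h
    rw [not_nonempty_iff] at h
    have := Φ.trace_one
    simp [Matrix.trace] at this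
  obtain ⟨i, hi⟩ := exists_eq_ciInf_of_finite (f := Φ.posDef.isHermitian.eigenvalues)
  rw [sigmaMin, ← hi]
  exact Φ.posDef.eigenvalues_pos i

lemma IsCyclicFamily.word_mul {p : Matrix (Fin d) (Fin d) ℂ} {m : ℕ}
    {R : ℕ → Matrix (Fin d) (Fin d) ℂ} (h : Φ.IsCyclicFamily p m R) {n : ℕ} (z : Fin n → Fin ds)
    (k : ℕ) : Φ.word z * R k = R (k + n) * Φ.word z := by
  induction n generalizing k with
  | zero => simp [word_zero]
  | succ n ih =>
    rw [word_succ, Matrix.mul_assoc, h.shift, ← Matrix.mul_assoc, ih, Matrix.mul_assoc,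
      show k + 1 + n = k + (n + 1) by ring]

lemma sum_mul_single_mul {l m n o : Type*} [Fintype m] [Fintype n] [DecidableEq m]
    [DecidableEq n] (A : Matrix l m ℂ) (X : Matrix m n ℂ) (C : Matrix n o ℂ) :
    ∑ x : n × m, A * Matrix.single x.2 x.1 (X x.2 x.1) * C = A * X * C := by
  rw [Fintype.sum_prod_type, Finset.sum_comm]
  simp_rw [← Matrix.sum_mul, ← Matrix.mul_sum]
  rw [← Matrix.matrix_eq_sum_single]

namespace NormalForm

variable (D : Φ.NormalForm)

lemma T_mul_blk (α : Fin D.N) : D.T α * D.blk (D.rep α) = D.T α :=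
  mul_eq_of_conjTranspose_mul_self (D.T_init α) (D.isBlock _).proj

lemma blk_mul_T (α : Fin D.N) : D.blk α * D.T α = D.T α :=
  mul_eq_of_mul_conjTranspose_self (D.T_final α) (D.isBlock _).proj

lemma conjTranspose_T_mul_blk (α : Fin D.N) : (D.T α)ᴴ * D.blk α = (D.T α)ᴴ :=
  (D.isBlock α).conjTranspose_mul_eq (D.blk_mul_T α)

lemma blk_mul_conjTranspose_T (α : Fin D.N) : D.blk (D.rep α) * (D.T α)ᴴ = (D.T α)ᴴ :=
  (D.isBlock _).mul_conjTranspose_eq (D.T_mul_blk α)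

lemma conjTranspose_T_mul_T {α β : Fin D.N} (h : α ≠ β) : (D.T α)ᴴ * D.T β = 0 := by
  rw [← D.conjTranspose_T_mul_blk α, ← D.blk_mul_T β, Matrix.mul_assoc, ← Matrix.mul_assoc (D.blk α),
    D.orthogonal α β h, Matrix.zero_mul, Matrix.mul_zero]

/-- The weight `tr (Π^α σ)` of a component. -/
def q (α : Fin D.N) : ℝ := ((D.blk α * Φ.σ).trace).re

lemma q_pos (α : Fin D.N) : 0 < D.q α := (Complex.pos_iff.mp (D.isBlock α).trace_sigma_pos).1

lemma ofReal_q (α : Fin D.N) : (D.q α : ℂ) = (D.blk α * Φ.σ).trace :=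
  Complex.ext rfl (by simpa using (Complex.pos_iff.mp (D.isBlock α).trace_sigma_pos).2)

lemma sum_q : ∑ α, D.q α = 1 := by
  have h : (∑ α, (D.q α : ℂ)) = 1 := by
    simp_rw [ofReal_q]
    rw [← Matrix.trace_sum, ← Finset.sum_mul, D.sum_eq, Matrix.one_mul, Φ.trace_one]
  exact_mod_cast h

lemma s_pos (α : Fin D.N) (k : ℕ) (i : Fin (D.n α k)) : 0 < D.s α k i :=
  Φ.sigmaMin_pos.trans_le (D.s_ge α k i)

lemma R_mul_B (α : Fin D.N) (k : ℕ) : D.R α k * D.B α k = D.B α k := by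
  rw [← D.B_range, Matrix.mul_assoc, D.B_isometry, Matrix.mul_one]

lemma conjTranspose_B_mul_R (α : Fin D.N) (k : ℕ) : (D.B α k)ᴴ * D.R α k = (D.B α k)ᴴ := by
  rw [← D.B_range, ← Matrix.mul_assoc, D.B_isometry, Matrix.one_mul]

lemma blk_mul_B (α : Fin D.N) (k : ℕ) : D.blk α * D.B α k = D.B α k := by
  rw [← D.R_mul_B, ← Matrix.mul_assoc, (D.cyclic α).block_mul]

lemma conjTranspose_B_mul_blk (α : Fin D.N) (k : ℕ) : (D.B α k)ᴴ * D.blk α = (D.B α k)ᴴ := by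
  rw [← D.conjTranspose_B_mul_R, Matrix.mul_assoc, (D.cyclic α).mul_block (D.isBlock α)]

lemma conjTranspose_B_mul_B {α : Fin D.N} {k l : ℕ} (h : k % D.m α ≠ l % D.m α) :
    (D.B α k)ᴴ * D.B α l = 0 := by
  rw [← D.conjTranspose_B_mul_R, ← D.R_mul_B α l, Matrix.mul_assoc, ← Matrix.mul_assoc (D.R α k),
    (D.cyclic α).mul_eq_zero h, Matrix.zero_mul, Matrix.mul_zero]

lemma sum_s (α : Fin D.N) (k : ℕ) : (D.m α : ℝ) * ∑ i, D.s α k i = D.q α := by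
  have h1 : (∑ i, (D.s α k i : ℂ)) = (D.R α k * Φ.σ).trace := by
    rw [← D.B_range, Matrix.mul_assoc, Matrix.trace_mul_comm, Matrix.mul_assoc, D.B_sigma,
      ← Matrix.mul_assoc, D.B_isometry, Matrix.one_mul, Matrix.trace_diagonal]
  have h2 := (D.cyclic α).trace_mul_sigma k
  rw [← h1, ← ofReal_q] at h2
  exact_mod_cast h2

/-- The components equivalent to a given representative. -/
def cls (β : Fin D.N) : Finset (Fin D.N) := Finset.univ.filter fun α => D.rep α = β

lemma mem_cls {α β : Fin D.N} : α ∈ D.cls β ↔ D.rep α = β := by simp [cls]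

/-- The representatives of the equivalence classes. -/
abbrev Rep : Type := {β : Fin D.N // D.rep β = β}

lemma sum_rep {V : Type*} [AddCommMonoid V] (f : Fin D.N → V) :
    ∑ β : D.Rep, ∑ α ∈ D.cls β, f α = ∑ α, f α := by
  have h1 : ∀ β : D.Rep, ∑ α ∈ D.cls β, f α = ∑ α, if (⟨D.rep α, D.rep_rep α⟩ : D.Rep) = β
      then f α else 0 := by
    intro β
    rw [cls, Finset.sum_filter]
    refine Finset.sum_congr rfl fun α _ => ?_
    simp only [Subtype.ext_iff]
  rw [Finset.sum_congr rfl fun β _ => h1 β, Finset.sum_comm]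
  refine Finset.sum_congr rfl fun α _ => ?_
  rw [Finset.sum_ite_eq]
  simp

/-- The amplification of an operator on a representative to its equivalence class. -/
def lift (b : ℕ) (β : Fin D.N) : Matrix (Fin d) (Fin d) ℂ →ₗ[ℂ] Matrix (Fin d) (Fin d) ℂ :=
  ∑ α ∈ D.cls β, star (D.ph α) ^ b • (LinearMap.mulLeft ℂ (D.T α) ∘ₗ
    LinearMap.mulRight ℂ (D.T α)ᴴ)

lemma lift_apply (b : ℕ) (β : Fin D.N) (h : Matrix (Fin d) (Fin d) ℂ) :
    D.lift b β h = ∑ α ∈ D.cls β, star (D.ph α) ^ b • (D.T α * h * (D.T α)ᴴ) := by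
  simp [lift, LinearMap.sum_apply, Matrix.mul_assoc]

lemma T_mul_T_comp {α α' : Fin D.N} (g h : Matrix (Fin d) (Fin d) ℂ) :
    D.T α * g * (D.T α)ᴴ * (D.T α' * h * (D.T α')ᴴ) =
      if α = α' then D.T α * (g * D.blk (D.rep α) * h) * (D.T α)ᴴ else 0 := by
  split_ifs with hα
  · subst hα
    rw [← D.T_init]
    simp only [Matrix.mul_assoc]
  · calc _ = D.T α * g * ((D.T α)ᴴ * D.T α') * h * (D.T α')ᴴ := by simp only [Matrix.mul_assoc]
      _ = 0 := by rw [D.conjTranspose_T_mul_T hα]; simp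

lemma phase_mul (α : Fin D.N) (b : ℕ) : D.ph α ^ b * star (D.ph α) ^ b = 1 := by
  rw [← mul_pow, mul_conj_of_norm (D.norm_ph α), one_pow]

lemma lift_conjTranspose_mul_lift (b : ℕ) (β : Fin D.N) (g h : Matrix (Fin d) (Fin d) ℂ) :
    (D.lift b β g)ᴴ * D.lift b β h =
      ∑ α ∈ D.cls β, D.T α * (gᴴ * D.blk β * h) * (D.T α)ᴴ := by
  rw [lift_apply, lift_apply, Matrix.conjTranspose_sum, Finset.sum_mul]
  refine Finset.sum_congr rfl fun α hα => ?_
  rw [Finset.mul_sum, Finset.sum_eq_single α]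
  · rw [Matrix.conjTranspose_smul, star_pow, star_star, Matrix.smul_mul, Matrix.mul_smul, smul_smul,
      phase_mul, one_smul, Matrix.conjTranspose_mul, Matrix.conjTranspose_mul,
      Matrix.conjTranspose_conjTranspose, ← Matrix.mul_assoc (D.T α), T_mul_T_comp, if_pos rfl,
      D.mem_cls.mp hα]
  · intro α' _ hne
    rw [Matrix.conjTranspose_smul, Matrix.smul_mul, Matrix.mul_smul, Matrix.conjTranspose_mul,
      Matrix.conjTranspose_mul, Matrix.conjTranspose_conjTranspose, ← Matrix.mul_assoc (D.T α),
      T_mul_T_comp, if_neg hne.symm, smul_zero, smul_zero]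
  · intro h; exact absurd hα h

lemma lift_conjTranspose_mul_lift_ne (b : ℕ) {β β' : Fin D.N} (hβ : β ≠ β')
    (g h : Matrix (Fin d) (Fin d) ℂ) : (D.lift b β g)ᴴ * D.lift b β' h = 0 := by
  rw [lift_apply, lift_apply, Matrix.conjTranspose_sum, Finset.sum_mul]
  refine Finset.sum_eq_zero fun α hα => ?_
  rw [Finset.mul_sum]
  refine Finset.sum_eq_zero fun α' hα' => ?_
  have hne : α ≠ α' := by
    rintro rfl
    exact hβ ((D.mem_cls.mp hα).symm.trans (D.mem_cls.mp hα'))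
  rw [Matrix.conjTranspose_smul, Matrix.smul_mul, Matrix.mul_smul, Matrix.conjTranspose_mul,
    Matrix.conjTranspose_mul, Matrix.conjTranspose_conjTranspose, ← Matrix.mul_assoc (D.T α),
    T_mul_T_comp, if_neg hne, smul_zero, smul_zero]

lemma sum_T_final : ∑ α, D.T α * (D.T α)ᴴ = 1 := by
  simp_rw [D.T_final, D.sum_eq]

/-- Intertwining of amplified operators with the twisted commutants. -/
lemma mul_lift {b : ℕ} {β : Fin D.N} {h : Matrix (Fin d) (Fin d) ℂ}
    (hh : ∀ μ : ℂ, ‖μ‖ = 1 → ∀ X ∈ Φ.twisted μ, D.blk β * X = X → X * D.blk β = X →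
      X * h = μ ^ b • (h * X))
    {ν : ℂ} (hν : ‖ν‖ = 1) {Z : Matrix (Fin d) (Fin d) ℂ} (hZ : Z ∈ Φ.twisted ν) :
    Z * D.lift b β h = ν ^ b • (D.lift b β h * Z) := by
  have hsep : ∀ α α', D.rep α ≠ D.rep α' → (D.T α)ᴴ * Z * D.T α' = 0 := by
    intro α α' hne
    have h1 := D.separate α α' hne ν hν Z hZ
    calc (D.T α)ᴴ * Z * D.T α' = (D.T α)ᴴ * (D.blk α * Z * D.blk α') * D.T α' := by
          conv_lhs => rw [← D.conjTranspose_T_mul_blk α, ← D.blk_mul_T α']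
          simp only [Matrix.mul_assoc]
      _ = 0 := by rw [h1]; simp
  -- T_α†ZT_α' acts inside the representative block and is twisted by the product of ν with the
  -- phase of α' and the conjugate phase of α. The hypothesis applies to it, and the b-th powers of
  -- these phases match those built into `lift`.
  have hin : ∀ α ∈ D.cls β, ∀ α' ∈ D.cls β, ((D.T α)ᴴ * Z * D.T α') * h =
      (star (D.ph α) * ν * D.ph α') ^ b • (h * ((D.T α)ᴴ * Z * D.T α')) := by
    intro α hα α' hα'
    have e1 := D.mem_cls.mp hα
    have e2 := D.mem_cls.mp hα'
    refine hh _ (by simp [D.norm_ph, hν]) _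
      (twisted_mul (twisted_mul (conjTranspose_mem_twisted (D.norm_ph α) (D.T_mem α)) hZ)
        (D.T_mem α')) ?_ ?_
    · rw [← Matrix.mul_assoc, ← Matrix.mul_assoc, ← e1, D.blk_mul_conjTranspose_T]
    · rw [Matrix.mul_assoc, ← e2, D.T_mul_blk]
  have hL : Z * D.lift b β h = ∑ α ∈ D.cls β, ∑ α' ∈ D.cls β,
      star (D.ph α') ^ b • (D.T α * (((D.T α)ᴴ * Z * D.T α') * h) * (D.T α')ᴴ) := by
    rw [lift_apply, Finset.mul_sum, Finset.sum_comm]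
    refine Finset.sum_congr rfl fun α' hα' => ?_
    conv_lhs => rw [← Matrix.one_mul Z, ← D.sum_T_final, Matrix.sum_mul, Matrix.sum_mul]
    rw [← Finset.sum_subset (Finset.subset_univ (D.cls β))]
    · refine Finset.sum_congr rfl fun α _ => ?_
      simp only [Matrix.mul_smul, Matrix.mul_assoc]
    · intro α _ hα
      have hne : D.rep α ≠ D.rep α' := by
        rw [D.mem_cls.mp hα']
        exact fun h => hα (D.mem_cls.mpr h)
      calc _ = star (D.ph α') ^ b • (D.T α * ((D.T α)ᴴ * Z * D.T α') * h * (D.T α')ᴴ) := by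
            simp only [Matrix.mul_smul, Matrix.mul_assoc]
        _ = 0 := by rw [hsep α α' hne]; simp
  have hR : D.lift b β h * Z = ∑ α ∈ D.cls β, ∑ α' ∈ D.cls β,
      star (D.ph α) ^ b • (D.T α * (h * ((D.T α)ᴴ * Z * D.T α')) * (D.T α')ᴴ) := by
    rw [lift_apply, Finset.sum_mul]
    refine Finset.sum_congr rfl fun α hα => ?_
    conv_lhs => rw [← Matrix.mul_one Z, ← D.sum_T_final, Matrix.mul_sum, Matrix.mul_sum]
    rw [← Finset.sum_subset (Finset.subset_univ (D.cls β))]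
    · refine Finset.sum_congr rfl fun α' _ => ?_
      simp only [Matrix.smul_mul, Matrix.mul_assoc]
    · intro α' _ hα'
      have hne : D.rep α ≠ D.rep α' := by
        rw [D.mem_cls.mp hα]
        exact fun h => hα' (D.mem_cls.mpr h.symm)
      calc _ = star (D.ph α) ^ b • (D.T α * h * ((D.T α)ᴴ * Z * D.T α') * (D.T α')ᴴ) := by
            simp only [Matrix.smul_mul, Matrix.mul_assoc]
        _ = 0 := by rw [hsep α α' hne]; simp
  rw [hL, hR, Finset.smul_sum]
  refine Finset.sum_congr rfl fun α hα => ?_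
  rw [Finset.smul_sum]
  refine Finset.sum_congr rfl fun α' hα' => ?_
  rw [hin α hα α' hα', Matrix.mul_smul, Matrix.smul_mul, smul_smul, smul_smul]
  congr 1
  rw [mul_pow, mul_pow]
  linear_combination (star (D.ph α) ^ b * ν ^ b) * D.phase_mul α' b

/-- Moving T_α past a word of length b costs the b-th power of its phase, which the conjugate phase
in `lift` cancels: up to this phase a word acts identically on all equivalent blocks. -/
lemma word_eq_sum_lift {b : ℕ} (y : Fin b → Fin ds) :
    Φ.word y = ∑ β : D.Rep, D.lift b β (Φ.word y * D.blk β) := by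
  have h1 : ∀ β : D.Rep, D.lift b β (Φ.word y * D.blk β) =
      ∑ α ∈ D.cls β, Φ.word y * D.blk α := by
    intro β
    rw [lift_apply]
    refine Finset.sum_congr rfl fun α hα => ?_
    rw [← D.mem_cls.mp hα, Matrix.mul_assoc, Matrix.mul_assoc (Φ.word y),
      D.blk_mul_conjTranspose_T, ← Matrix.mul_assoc, mul_word (D.T_mem α), Matrix.smul_mul,
      smul_smul, mul_comm, phase_mul, one_smul, Matrix.mul_assoc, D.T_final]
  rw [Finset.sum_congr rfl fun β _ => h1 β, D.sum_rep fun α => Φ.word y * D.blk α,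
    ← Finset.mul_sum, D.sum_eq, Matrix.mul_one]

/-- The labels of the cyclic projections of the representatives. -/
abbrev Lab : Type := Σ β : D.Rep, Fin (D.m β)

/-- The labels of the Kraus operators of the peripheral channel. -/
abbrev Idx (b : ℕ) : Type := Σ κ : D.Lab, Fin (D.n κ.1 κ.2) × Fin (D.n κ.1 (κ.2 + b))

/-- A matrix unit from the cyclic projection `k` to the cyclic projection `k + b`. -/
def unit (b : ℕ) (β : Fin D.N) (k : ℕ) (i : Fin (D.n β k)) (j : Fin (D.n β (k + b))) :
    Matrix (Fin d) (Fin d) ℂ :=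
  D.B β (k + b) * Matrix.single j i (1 : ℂ) * (D.B β k)ᴴ

/-- The normalization of a Kraus operator. -/
def coef (b : ℕ) (β : Fin D.N) (k : ℕ) (j : Fin (D.n β (k + b))) : ℝ :=
  √(D.m β / D.q β * D.s β (k + b) j)

lemma coef_pos (b : ℕ) (β : Fin D.N) (k : ℕ) (j : Fin (D.n β (k + b))) : 0 < D.coef b β k j := by
  have h1 := D.q_pos β
  have h2 := D.s_pos β (k + b) j
  have h3 : (0 : ℝ) < D.m β := by exact_mod_cast (D.cyclic β).pos
  exact Real.sqrt_pos.mpr (by positivity)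

lemma coef_sq (b : ℕ) (β : Fin D.N) (k : ℕ) (j : Fin (D.n β (k + b))) :
    D.coef b β k j * D.coef b β k j = D.m β / D.q β * D.s β (k + b) j := by
  have h1 := D.q_pos β
  have h2 := D.s_pos β (k + b) j
  exact Real.mul_self_sqrt (by positivity)

lemma sum_coef_sq (b : ℕ) (β : Fin D.N) (k : ℕ) :
    ∑ j, D.coef b β k j * D.coef b β k j = 1 := by
  simp_rw [coef_sq]
  rw [← Finset.mul_sum, div_mul_eq_mul_div, D.sum_s, div_self (D.q_pos β).ne']

/-- The Kraus operators of the power `b` of the peripheral channel. -/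
def kraus (b : ℕ) (g : D.Idx b) : Matrix (Fin d) (Fin d) ℂ :=
  (D.coef b g.1.1 g.1.2 g.2.2 : ℂ) • D.lift b g.1.1 (D.unit b g.1.1 g.1.2 g.2.1 g.2.2)

lemma unit_conjTranspose_mul_unit (b : ℕ) (β : Fin D.N) (k : ℕ) (i i' : Fin (D.n β k))
    (j j' : Fin (D.n β (k + b))) :
    (D.unit b β k i j)ᴴ * D.blk β * D.unit b β k i' j' =
      if j = j' then D.B β k * Matrix.single i i' (1 : ℂ) * (D.B β k)ᴴ else 0 := by
  have h1 : (D.unit b β k i j)ᴴ * D.blk β * D.unit b β k i' j' = D.B β k * (Matrix.single i j (1 : ℂ) *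
      ((D.B β (k + b))ᴴ * (D.blk β * D.B β (k + b))) * Matrix.single j' i' (1 : ℂ)) * (D.B β k)ᴴ := by
    simp only [unit, Matrix.conjTranspose_mul, Matrix.conjTranspose_conjTranspose,
      Matrix.conjTranspose_single, star_one, Matrix.mul_assoc]
  rw [h1, D.blk_mul_B, D.B_isometry, Matrix.mul_one]
  split_ifs with h
  · subst h
    rw [Matrix.single_mul_single_same, one_mul]
  · rw [Matrix.single_mul_single_of_ne _ _ _ _ h]
    simp

lemma unit_conjTranspose_mul_unit_ne (b : ℕ) {β : Fin D.N} {k k' : ℕ}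
    (hk : (k + b) % D.m β ≠ (k' + b) % D.m β) (i : Fin (D.n β k)) (i' : Fin (D.n β k'))
    (j : Fin (D.n β (k + b))) (j' : Fin (D.n β (k' + b))) :
    (D.unit b β k i j)ᴴ * D.blk β * D.unit b β k' i' j' = 0 := by
  have h1 : (D.unit b β k i j)ᴴ * D.blk β * D.unit b β k' i' j' = D.B β k * (Matrix.single i j (1 : ℂ) *
      ((D.B β (k + b))ᴴ * (D.blk β * D.B β (k' + b))) * Matrix.single j' i' (1 : ℂ)) * (D.B β k')ᴴ := by
    simp only [unit, Matrix.conjTranspose_mul, Matrix.conjTranspose_conjTranspose,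
      Matrix.conjTranspose_single, star_one, Matrix.mul_assoc]
  rw [h1, D.blk_mul_B, D.conjTranspose_B_mul_B hk]
  simp

/-- The sum over the output index is absorbed by `sum_coef_sq`, the sum over the input index gives R
k, and the intertwiners carry the representative block to each member of its class. -/
lemma sum_kraus_conjTranspose_mul (b : ℕ) : ∑ g, (D.kraus b g)ᴴ * D.kraus b g = 1 := by
  have h1 : ∀ g : D.Idx b, (D.kraus b g)ᴴ * D.kraus b g =
      ((D.coef b g.1.1 g.1.2 g.2.2 * D.coef b g.1.1 g.1.2 g.2.2 : ℝ) : ℂ) •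
        ∑ α ∈ D.cls g.1.1, D.T α * (D.B g.1.1 g.1.2 * Matrix.single g.2.1 g.2.1 (1 : ℂ) *
          (D.B g.1.1 g.1.2)ᴴ) * (D.T α)ᴴ := by
    intro g
    rw [kraus, Matrix.conjTranspose_smul, Matrix.smul_mul, Matrix.mul_smul, smul_smul,
      lift_conjTranspose_mul_lift]
    simp_rw [unit_conjTranspose_mul_unit, if_true]
    rw [Complex.star_def, Complex.conj_ofReal]
    push_cast
    rfl
  rw [Fintype.sum_sigma, Fintype.sum_sigma]
  have h3 : ∀ (β : D.Rep) (k : Fin (D.m β)),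
      ∑ x : Fin (D.n β k) × Fin (D.n β (k + b)), (D.kraus b ⟨⟨β, k⟩, x⟩)ᴴ * D.kraus b ⟨⟨β, k⟩, x⟩ =
        ∑ α ∈ D.cls β, D.T α * D.R β k * (D.T α)ᴴ := by
    intro β k
    rw [Fintype.sum_prod_type]
    have h5 : ∀ i, ∑ j, (D.kraus b ⟨⟨β, k⟩, (i, j)⟩)ᴴ * D.kraus b ⟨⟨β, k⟩, (i, j)⟩ =
        ∑ α ∈ D.cls β, D.T α * (D.B β k * Matrix.single i i (1 : ℂ) * (D.B β k)ᴴ) * (D.T α)ᴴ := by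
      intro i
      calc _ = ∑ j, ((D.coef b β k j * D.coef b β k j : ℝ) : ℂ) • ∑ α ∈ D.cls β,
            D.T α * (D.B β k * Matrix.single i i (1 : ℂ) * (D.B β k)ᴴ) * (D.T α)ᴴ :=
            Finset.sum_congr rfl fun j _ => h1 ⟨⟨β, k⟩, (i, j)⟩
        _ = _ := by
            rw [← Finset.sum_smul, ← Complex.ofReal_sum, sum_coef_sq, Complex.ofReal_one, one_smul]
    rw [Finset.sum_congr rfl fun i _ => h5 i]
    rw [Finset.sum_comm]
    refine Finset.sum_congr rfl fun α _ => ?_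
    rw [← Finset.sum_mul, ← Finset.mul_sum, ← Matrix.sum_mul, ← Matrix.mul_sum,
      Matrix.sum_single_one, Matrix.mul_one, D.B_range]
  simp_rw [h3]
  have h4 : ∀ β : D.Rep, ∑ k : Fin (D.m β), ∑ α ∈ D.cls β, D.T α * D.R β k * (D.T α)ᴴ =
      ∑ α ∈ D.cls β, D.blk α := by
    intro β
    rw [Finset.sum_comm]
    refine Finset.sum_congr rfl fun α hα => ?_
    rw [← Finset.sum_mul, ← Finset.mul_sum, D.sum_R, ← D.mem_cls.mp hα, D.T_mul_blk, D.T_final]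
  rw [Finset.sum_congr rfl fun β _ => h4 β, D.sum_rep, D.sum_eq]

/-- The density operator that is a multiple of each component. -/
def ω : Matrix (Fin d) (Fin d) ℂ := ∑ α, (D.q α : ℂ) • D.blk α

lemma ω_mul_T (α : Fin D.N) : D.ω * D.T α = (D.q α : ℂ) • D.T α := by
  rw [ω, Finset.sum_mul, Finset.sum_eq_single α]
  · rw [Matrix.smul_mul, D.blk_mul_T]
  · intro β _ h
    rw [Matrix.smul_mul, ← D.blk_mul_T, ← Matrix.mul_assoc, D.orthogonal β α h, Matrix.zero_mul,
      smul_zero]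
  · intro h; exact absurd (Finset.mem_univ _) h

/-- The weights of the Kraus operators. -/
def wt (b : ℕ) (g : D.Idx b) : ℝ :=
  D.m g.1.1 / D.q g.1.1 * D.s g.1.1 (g.1.2 + b) g.2.2 * ∑ α ∈ D.cls g.1.1, D.q α

/-- The class sum contains the weight of the representative and thereby compensates the division by
it. -/
lemma sigmaMin_le_wt (b : ℕ) (g : D.Idx b) : Φ.sigmaMin ≤ D.wt b g := by
  have h1 : D.q g.1.1 ≤ ∑ α ∈ D.cls g.1.1, D.q α :=
    Finset.single_le_sum (f := D.q) (fun α _ => (D.q_pos α).le) (D.mem_cls.mpr g.1.1.2)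
  have h2 := D.s_ge g.1.1 (g.1.2 + b) g.2.2
  have h3 := D.s_pos g.1.1 (g.1.2 + b) g.2.2
  have h4 : (1 : ℝ) ≤ D.m g.1.1 := by exact_mod_cast (D.cyclic g.1.1).pos
  have h5 := D.q_pos g.1.1
  calc Φ.sigmaMin ≤ D.s g.1.1 (g.1.2 + b) g.2.2 := h2
    _ ≤ D.m g.1.1 * D.s g.1.1 (g.1.2 + b) g.2.2 := by nlinarith
    _ = D.m g.1.1 / D.q g.1.1 * D.s g.1.1 (g.1.2 + b) g.2.2 * D.q g.1.1 := by field_simp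
    _ ≤ _ := by
      rw [wt]
      gcongr

/-- ω is a scalar on each block, so amplified matrix units remain orthogonal, and their squared
norms do not depend on the input index. -/
lemma trace_ω_kraus (b : ℕ) (g g' : D.Idx b) :
    (D.ω * ((D.kraus b g)ᴴ * D.kraus b g')).trace = if g = g' then (D.wt b g : ℂ) else 0 := by
  obtain ⟨⟨β, k⟩, i, j⟩ := g
  obtain ⟨⟨β', k'⟩, i', j'⟩ := g'
  simp only [kraus, Matrix.conjTranspose_smul, Matrix.smul_mul, Matrix.mul_smul]
  by_cases hβ : β = β'
  swap
  · rw [lift_conjTranspose_mul_lift_ne _ _ (fun h => hβ (Subtype.ext h)), if_neg]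
    · simp
    · intro h
      simp only [Sigma.mk.injEq] at h
      exact hβ h.1.1
  subst hβ
  rw [lift_conjTranspose_mul_lift]
  by_cases hk : k = k'
  swap
  · rw [unit_conjTranspose_mul_unit_ne, if_neg]
    · simp
    · intro h
      simp only [Sigma.mk.injEq, heq_eq_eq, true_and] at h
      exact hk h.1
    · intro h
      have h1 : (k : ℕ) ≡ k' [MOD D.m β] := Nat.ModEq.add_right_cancel' b h
      exact hk (Fin.ext (Nat.ModEq.eq_of_lt_of_lt h1 k.2 k'.2))
  subst hk
  rw [unit_conjTranspose_mul_unit]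
  have htr : ∀ α ∈ D.cls β, (D.ω * (D.T α * (D.B β k * Matrix.single i i' (1 : ℂ) * (D.B β k)ᴴ) *
      (D.T α)ᴴ)).trace = if i = i' then (D.q α : ℂ) else 0 := by
    intro α hα
    have e : D.ω * (D.T α * (D.B β k * Matrix.single i i' (1 : ℂ) * (D.B β k)ᴴ) * (D.T α)ᴴ) =
        (D.q α : ℂ) • (D.T α * (D.B β k * Matrix.single i i' (1 : ℂ) * (D.B β k)ᴴ) * (D.T α)ᴴ) := by
      rw [← Matrix.mul_assoc, ← Matrix.mul_assoc, ω_mul_T, Matrix.smul_mul, Matrix.smul_mul]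
    rw [e, Matrix.trace_smul, Matrix.trace_mul_comm, ← Matrix.mul_assoc, D.T_init, D.mem_cls.mp hα,
      ← Matrix.mul_assoc, ← Matrix.mul_assoc, D.blk_mul_B, Matrix.trace_mul_comm,
      ← Matrix.mul_assoc, D.B_isometry, Matrix.one_mul]
    by_cases hi : i = i'
    · subst hi
      rw [Matrix.trace_single_eq_same, if_pos rfl]; simp
    · rw [Matrix.trace_single_eq_of_ne _ _ _ hi, if_neg hi, smul_zero]
  by_cases hj : j = j'
  swap
  · rw [if_neg hj, if_neg]
    · simp
    · intro h
      simp only [Sigma.mk.injEq, heq_eq_eq, true_and, Prod.mk.injEq] at h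
      exact hj h.2
  subst hj
  rw [if_pos rfl, Finset.mul_sum, Matrix.trace_smul, Matrix.trace_smul, Matrix.trace_sum,
    Finset.sum_congr rfl htr]
  by_cases hi : i = i'
  swap
  · rw [if_neg]
    · simp [hi]
    · intro h
      simp only [Sigma.mk.injEq, heq_eq_eq, true_and, Prod.mk.injEq] at h
      exact hi h.1
  subst hi
  simp only [if_true, smul_eq_mul, wt]
  rw [Complex.star_def, Complex.conj_ofReal, ← mul_assoc]
  norm_cast
  rw [coef_sq]

/-- A word of length b maps R k into R (k + b), so on a representative it is a combination of the
chosen matrix units; lifting restores the whole word. -/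
lemma word_eq_sum_kraus {b : ℕ} (y : Fin b → Fin ds) :
    ∃ v : D.Idx b → ℂ, Φ.word y = ∑ g, v g • D.kraus b g := by
  refine ⟨fun g => ((D.B g.1.1 (g.1.2 + b))ᴴ * Φ.word y * D.B g.1.1 g.1.2) g.2.2 g.2.1 *
    (D.coef b g.1.1 g.1.2 g.2.2 : ℂ)⁻¹, ?_⟩
  have h1 : ∀ g : D.Idx b, (((D.B g.1.1 (g.1.2 + b))ᴴ * Φ.word y * D.B g.1.1 g.1.2) g.2.2 g.2.1 *
      (D.coef b g.1.1 g.1.2 g.2.2 : ℂ)⁻¹) • D.kraus b g = D.lift b g.1.1 (D.B g.1.1 (g.1.2 + b) *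
        Matrix.single g.2.2 g.2.1 (((D.B g.1.1 (g.1.2 + b))ᴴ * Φ.word y * D.B g.1.1 g.1.2)
          g.2.2 g.2.1) * (D.B g.1.1 g.1.2)ᴴ) := by
    intro g
    have hc : (D.coef b g.1.1 g.1.2 g.2.2 : ℂ) ≠ 0 := by
      exact_mod_cast (D.coef_pos b g.1.1 g.1.2 g.2.2).ne'
    rw [kraus, smul_smul, mul_assoc, inv_mul_cancel₀ hc, mul_one, ← map_smul, unit]
    congr 1
    rw [← Matrix.smul_mul, ← Matrix.mul_smul, Matrix.smul_single]
    simp only [smul_eq_mul, mul_one]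
  simp_rw [h1]
  rw [Fintype.sum_sigma, Fintype.sum_sigma]
  conv_lhs => rw [D.word_eq_sum_lift]
  refine Finset.sum_congr rfl fun β _ => ?_
  simp_rw [← map_sum]
  congr 1
  have h2 : ∀ k : Fin (D.m β), ∑ x : Fin (D.n β k) × Fin (D.n β (k + b)), D.B β (k + b) *
      Matrix.single x.2 x.1 (((D.B β (k + b))ᴴ * Φ.word y * D.B β k) x.2 x.1) * (D.B β k)ᴴ =
        Φ.word y * D.R β k := by
    intro k
    rw [sum_mul_single_mul]
    calc _ = (D.B β (k + b) * (D.B β (k + b))ᴴ) * Φ.word y * (D.B β k * (D.B β k)ᴴ) := by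
          simp only [Matrix.mul_assoc]
      _ = _ := by
          rw [D.B_range, D.B_range, ← (D.cyclic β).word_mul, Matrix.mul_assoc, (D.cyclic β).mul_self]
  rw [Finset.sum_congr rfl fun k _ => h2 k, ← Finset.mul_sum, D.sum_R]

end NormalForm
end IUMPS
namespace IUMPS

variable {d ds : ℕ} {Φ : IUMPS d ds}

/-! ### The canonical Kraus operators dilate the peripheral channel -/

namespace NormalForm

variable (D : Φ.NormalForm)

lemma R_mul_unit (b : ℕ) (β : Fin D.N) (k : ℕ) (i : Fin (D.n β k)) (j : Fin (D.n β (k + b))) :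
    D.R β (k + b) * D.unit b β k i j = D.unit b β k i j := by
  rw [unit, ← Matrix.mul_assoc, ← Matrix.mul_assoc, R_mul_B]

lemma unit_mul_R (b : ℕ) (β : Fin D.N) (k : ℕ) (i : Fin (D.n β k)) (j : Fin (D.n β (k + b))) :
    D.unit b β k i j * D.R β k = D.unit b β k i j := by
  rw [unit, Matrix.mul_assoc, conjTranspose_B_mul_R]

/-- A matrix unit from R k to R (k + b) meets the weight a (k + b) = ν^b a k on the left and a k on
the right. -/
lemma mul_kraus {b : ℕ} {ν : ℂ} (hν : ‖ν‖ = 1) {Z : Matrix (Fin d) (Fin d) ℂ}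
    (hZ : Z ∈ Φ.twisted ν) (g : D.Idx b) : Z * D.kraus b g = ν ^ b • (D.kraus b g * Z) := by
  rw [kraus, Matrix.mul_smul, D.mul_lift _ hν hZ, Matrix.smul_mul, smul_comm]
  intro μ hμ X hX h1 h2
  obtain ⟨a, ha1, ha2, ha3⟩ := (D.cyclic _).exists_weights hμ hX h1 h2
  conv_lhs => rw [← D.R_mul_unit, ← Matrix.mul_assoc, ha1, Matrix.smul_mul, D.R_mul_unit]
  conv_rhs => rw [← D.unit_mul_R, Matrix.mul_assoc, ha2, Matrix.mul_smul, D.unit_mul_R]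
  rw [smul_smul, IsCyclicFamily.weights_add ha3]

lemma lift_mul_mul_lift (b : ℕ) (β : Fin D.N) (h X : Matrix (Fin d) (Fin d) ℂ) :
    D.lift b β h * X * (D.lift b β h)ᴴ = ∑ α ∈ D.cls β, ∑ α' ∈ D.cls β,
      (star (D.ph α) ^ b * D.ph α' ^ b) •
        (D.T α * (h * ((D.T α)ᴴ * X * D.T α') * hᴴ) * (D.T α')ᴴ) := by
  rw [lift_apply, Matrix.conjTranspose_sum, Finset.sum_mul, Finset.sum_mul]
  refine Finset.sum_congr rfl fun α _ => ?_
  rw [Finset.mul_sum]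
  refine Finset.sum_congr rfl fun α' _ => ?_
  rw [Matrix.conjTranspose_smul, star_pow, star_star, Matrix.smul_mul, Matrix.smul_mul,
    Matrix.mul_smul, smul_smul]
  simp only [Matrix.conjTranspose_mul, Matrix.conjTranspose_conjTranspose, Matrix.mul_assoc]

lemma unit_mul_mul_unit (b : ℕ) (β : Fin D.N) (k : ℕ) (i : Fin (D.n β k))
    (j : Fin (D.n β (k + b))) (Y : Matrix (Fin d) (Fin d) ℂ) :
    D.unit b β k i j * Y * (D.unit b β k i j)ᴴ = ((D.B β k)ᴴ * Y * D.B β k) i i •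
      (D.B β (k + b) * Matrix.single j j (1 : ℂ) * (D.B β (k + b))ᴴ) := by
  have h1 : D.unit b β k i j * Y * (D.unit b β k i j)ᴴ = D.B β (k + b) *
      (Matrix.single j i (1 : ℂ) * ((D.B β k)ᴴ * Y * D.B β k) * Matrix.single i j (1 : ℂ)) *
        (D.B β (k + b))ᴴ := by
    simp only [unit, Matrix.conjTranspose_mul, Matrix.conjTranspose_conjTranspose,
      Matrix.conjTranspose_single, star_one, Matrix.mul_assoc]
  rw [h1, Matrix.single_mul_mul_single, one_mul, mul_one, ← Matrix.smul_mul, ← Matrix.mul_smul,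
    Matrix.smul_single, smul_eq_mul, mul_one]

lemma sum_coef_unit (b : ℕ) (β : Fin D.N) (k : ℕ) :
    ∑ j, ((D.coef b β k j * D.coef b β k j : ℝ) : ℂ) •
      (D.B β (k + b) * Matrix.single j j (1 : ℂ) * (D.B β (k + b))ᴴ) =
        ((D.m β / D.q β : ℝ) : ℂ) • (D.R β (k + b) * Φ.σ) := by
  have h1 : ∀ j, ((D.coef b β k j * D.coef b β k j : ℝ) : ℂ) •
      (D.B β (k + b) * Matrix.single j j (1 : ℂ) * (D.B β (k + b))ᴴ) =
        ((D.m β / D.q β : ℝ) : ℂ) • (D.B β (k + b) *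
          Matrix.single j j (D.s β (k + b) j : ℂ) * (D.B β (k + b))ᴴ) := by
    intro j
    have h2 : Matrix.single j j (D.s β (k + b) j : ℂ) =
        (D.s β (k + b) j : ℂ) • Matrix.single j j (1 : ℂ) := by
      rw [Matrix.smul_single, smul_eq_mul, mul_one]
    rw [coef_sq, Complex.ofReal_mul, mul_smul, h2, Matrix.mul_smul, Matrix.smul_mul]
  rw [Finset.sum_congr rfl fun j _ => h1 j, ← Finset.smul_sum, ← Matrix.sum_mul, ← Matrix.mul_sum,
    ← (((D.cyclic β).sigma (k + b)).eq), ← D.B_range, ← Matrix.mul_assoc, D.B_sigma]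
  congr 4
  ext i j
  rw [Matrix.sum_apply, Matrix.diagonal_apply]
  simp only [Matrix.single_apply]
  split_ifs with h
  · subst h; simp
  · refine Finset.sum_eq_zero fun c _ => ?_
    rw [if_neg]
    rintro ⟨rfl, rfl⟩
    exact h rfl

/-- Summing over the output index with its squared coefficient replaces the diagonal matrix units by
a multiple of R (k + b) σ, which is peripheral and stays so between intertwiners. -/
lemma sum_kraus_mem_peripheral (b : ℕ) (X : Matrix (Fin d) (Fin d) ℂ) :
    ∑ g, D.kraus b g * X * (D.kraus b g)ᴴ ∈ Φ.peripheral := by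
  rw [Fintype.sum_sigma]
  refine Submodule.sum_mem _ fun κ _ => ?_
  obtain ⟨β, k⟩ := κ
  rw [Fintype.sum_prod_type]
  refine Submodule.sum_mem _ fun i _ => ?_
  have h1 : ∀ j, D.kraus b ⟨⟨β, k⟩, (i, j)⟩ * X * (D.kraus b ⟨⟨β, k⟩, (i, j)⟩)ᴴ =
      ∑ α ∈ D.cls β, ∑ α' ∈ D.cls β, (star (D.ph α) ^ b * D.ph α' ^ b *
        ((D.B β k)ᴴ * ((D.T α)ᴴ * X * D.T α') * D.B β k) i i) •
        (D.T α * (((D.coef b β k j * D.coef b β k j : ℝ) : ℂ) • (D.B β (k + b) *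
          Matrix.single j j (1 : ℂ) * (D.B β (k + b))ᴴ)) * (D.T α')ᴴ) := by
    intro j
    simp only [kraus]
    rw [Matrix.conjTranspose_smul, Matrix.smul_mul, Matrix.smul_mul, Matrix.mul_smul, smul_smul,
      lift_mul_mul_lift, Finset.smul_sum]
    refine Finset.sum_congr rfl fun α _ => ?_
    rw [Finset.smul_sum]
    refine Finset.sum_congr rfl fun α' _ => ?_
    rw [unit_mul_mul_unit, Complex.star_def, Complex.conj_ofReal]
    simp only [Matrix.mul_smul, Matrix.smul_mul, smul_smul]
    congr 1
    push_cast
    ring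
  rw [Finset.sum_congr rfl fun j _ => h1 j, Finset.sum_comm]
  refine Submodule.sum_mem _ fun α _ => ?_
  rw [Finset.sum_comm]
  refine Submodule.sum_mem _ fun α' _ => ?_
  rw [← Finset.smul_sum, ← Finset.sum_mul, ← Finset.mul_sum, sum_coef_unit]
  refine Submodule.smul_mem _ _ (peripheral_mul_mul (D.norm_ph α) (norm_star_one (D.norm_ph α'))
    (D.T_mem α) (conjTranspose_mem_twisted (D.norm_ph α') (D.T_mem α')) ?_)
  exact Submodule.smul_mem _ _ ((D.cyclic β).mem_peripheral _)

/-- Commuting Z† past K_g produces ν̄^b, and normalisation of the K_g removes them; this is how Ẽ^b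
acts on the pairings. -/
lemma sum_kraus_mul {b : ℕ} (hb : b ≠ 0) (X : Matrix (Fin d) (Fin d) ℂ) :
    ∑ g, D.kraus b g * X * (D.kraus b g)ᴴ = mapOf (Φ.Eper ^ b) X := by
  refine (mapOf_Eper_pow hb (D.sum_kraus_mem_peripheral b X) fun ν hν Z hZ => ?_).symm
  have hZ' := conjTranspose_mem_twisted hν hZ
  rw [Finset.mul_sum, Matrix.trace_sum]
  calc ∑ g, (Zᴴ * (D.kraus b g * X * (D.kraus b g)ᴴ)).trace
      = ∑ g, star ν ^ b * ((D.kraus b g)ᴴ * D.kraus b g * (Zᴴ * X)).trace := by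
        refine Finset.sum_congr rfl fun g _ => ?_
        rw [← Matrix.mul_assoc, ← Matrix.mul_assoc, D.mul_kraus (norm_star_one hν) hZ',
          Matrix.smul_mul, Matrix.smul_mul, Matrix.trace_smul, smul_eq_mul, Matrix.trace_mul_comm]
        simp only [Matrix.mul_assoc]
    _ = _ := by
        rw [← Finset.mul_sum, ← Matrix.trace_sum, ← Finset.sum_mul, sum_kraus_conjTranspose_mul,
          Matrix.one_mul]

end NormalForm
end IUMPS
/-! ### The Frobenius norm -/

section Frobenius

variable {m n l : Type*} [Fintype m] [Fintype n] [Fintype l] [DecidableEq m] [DecidableEq n]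
  [DecidableEq l]

/-- The square of the Frobenius norm. -/
def frobSq (A : Matrix m n ℂ) : ℝ := ∑ i, ∑ j, ‖A i j‖ ^ 2

lemma frobSq_nonneg (A : Matrix m n ℂ) : 0 ≤ frobSq A :=
  Finset.sum_nonneg fun _ _ => Finset.sum_nonneg fun _ _ => by positivity

lemma trace_conjTranspose_mul_self (A : Matrix m n ℂ) : (Aᴴ * A).trace = (frobSq A : ℂ) := by
  simp only [Matrix.trace, Matrix.diag_apply, Matrix.mul_apply, Matrix.conjTranspose_apply, frobSq]
  rw [Finset.sum_comm]
  push_cast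
  refine Finset.sum_congr rfl fun i _ => Finset.sum_congr rfl fun j _ => ?_
  rw [← Complex.conj_mul', Complex.star_def]

lemma sum_norm_sq_mulVec_le (A : Matrix m n ℂ) (x : n → ℂ) :
    ∑ i, ‖(A *ᵥ x) i‖ ^ 2 ≤ frobSq A * ∑ j, ‖x j‖ ^ 2 := by
  rw [frobSq, Finset.sum_mul]
  refine Finset.sum_le_sum fun i _ => ?_
  calc ‖(A *ᵥ x) i‖ ^ 2 ≤ (∑ j, ‖A i j‖ * ‖x j‖) ^ 2 := by
        gcongr
        exact (norm_sum_le _ _).trans_eq (by simp)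
    _ ≤ _ := Finset.sum_mul_sq_le_sq_mul_sq _ _ _

lemma frobSq_mul_le (A : Matrix m n ℂ) (B : Matrix n l ℂ) :
    frobSq (A * B) ≤ ‖A‖ ^ 2 * frobSq B := by
  rw [frobSq, frobSq, Finset.sum_comm, Finset.sum_comm (f := fun i j => ‖B i j‖ ^ 2),
    Finset.mul_sum]
  refine Finset.sum_le_sum fun j _ => ?_
  have h1 := A.l2_opNorm_mulVec (WithLp.toLp 2 fun i => B i j)
  have h2 := pow_le_pow_left₀ (norm_nonneg _) h1 2
  rw [mul_pow, EuclideanSpace.norm_sq_eq, EuclideanSpace.norm_sq_eq] at h2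
  exact h2

/-- Spectral decomposition by a unitary matrix. -/
lemma exists_diagonalization {A : Matrix n n ℂ} (hA : A.IsHermitian) :
    ∃ U : Matrix n n ℂ, Uᴴ * U = 1 ∧ U * Uᴴ = 1 ∧
      A = U * Matrix.diagonal (fun i => (hA.eigenvalues i : ℂ)) * Uᴴ :=
  ⟨hA.eigenvectorUnitary.1, Unitary.coe_star_mul_self hA.eigenvectorUnitary,
    Unitary.coe_mul_star_self hA.eigenvectorUnitary, hA.spectral_theorem⟩

lemma frobSq_mul_mul_conjTranspose {H : Matrix m n ℂ} {w : n → ℝ}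
    (hH : Hᴴ * H = Matrix.diagonal fun g => (w g : ℂ)) (A : Matrix n n ℂ) :
    frobSq (H * A * Hᴴ) = ∑ g, ∑ g', w g * w g' * ‖A g g'‖ ^ 2 := by
  have h1 : (frobSq (H * A * Hᴴ) : ℂ) = (Aᴴ * (Hᴴ * H) * A * (Hᴴ * H)).trace := by
    rw [← trace_conjTranspose_mul_self, Matrix.conjTranspose_mul, Matrix.conjTranspose_mul,
      Matrix.conjTranspose_conjTranspose, Matrix.mul_assoc, Matrix.trace_mul_comm]
    simp only [Matrix.mul_assoc]
  have h2 : ((∑ g, ∑ g', w g * w g' * ‖A g g'‖ ^ 2 : ℝ) : ℂ) =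
      (Aᴴ * (Hᴴ * H) * A * (Hᴴ * H)).trace := by
    rw [hH, Finset.sum_comm]
    rw [Matrix.trace]
    push_cast
    refine Finset.sum_congr rfl fun i _ => ?_
    rw [Matrix.diag_apply, Matrix.mul_diagonal, Matrix.mul_apply, Finset.sum_mul]
    refine Finset.sum_congr rfl fun j _ => ?_
    rw [Matrix.mul_diagonal, ← Complex.conj_mul', Matrix.conjTranspose_apply, Complex.star_def]
    ring
  exact_mod_cast h1.trans h2.symm

lemma eigenvalues_sub_one_sq_le {A : Matrix n n ℂ} (hA : A.IsHermitian) (i : n) :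
    (hA.eigenvalues i - 1) ^ 2 ≤ frobSq (A - 1) := by
  set x : n → ℂ := (hA.eigenvectorBasis i).ofLp with hx
  have h1 : (A - 1) *ᵥ x = ((hA.eigenvalues i - 1 : ℝ) : ℂ) • x := by
    rw [Matrix.sub_mulVec, Matrix.one_mulVec, hx, hA.mulVec_eigenvectorBasis]
    push_cast
    rw [sub_smul, one_smul]
    rfl
  have h2 : ∑ j, ‖x j‖ ^ 2 = 1 := by
    rw [← EuclideanSpace.norm_sq_eq, hA.eigenvectorBasis.orthonormal.1 i, one_pow]
  have h3 := sum_norm_sq_mulVec_le (A - 1) x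
  rw [h1, h2, mul_one] at h3
  simp only [Pi.smul_apply, smul_eq_mul, norm_mul, mul_pow, Complex.norm_real, Real.norm_eq_abs,
    sq_abs] at h3
  rwa [← Finset.mul_sum, h2, mul_one] at h3

/-- Square roots of Hermitian matrices near the identity. -/
lemma exists_sqrt_near_one {A : Matrix n n ℂ} (hA : A.IsHermitian)
    (h : frobSq (A - 1) ≤ (3 / 4) ^ 2) :
    ∃ S T : Matrix n n ℂ, Sᴴ = S ∧ Tᴴ = T ∧ S * T = 1 ∧ T * S = 1 ∧ S * S = A ∧
      ((A - 1) * (A - 1) - (2 : ℂ) • ((S - 1) * (S - 1))).PosSemidef := by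
  obtain ⟨U, hU, hU', hAU⟩ := exists_diagonalization hA
  set e := hA.eigenvalues with he
  -- The radius 3/4 leaves eigenvalues t² ≥ 1/4, so t ≥ 1/2 and (t + 1)² ≥ 9/4 ≥ 2. This gives (t² -
  -- 1)² ≥ 2(t - 1)², the source of the factor 2.
  have hle : ∀ i, 1 / 4 ≤ e i := by
    intro i
    have h1 := abs_le_of_sq_le_sq ((eigenvalues_sub_one_sq_le hA i).trans h) (by norm_num)
    have h2 := (abs_le.mp h1).1
    rw [← he] at h2
    linarith
  have hs : ∀ i, 1 / 2 ≤ √(e i) := fun i => Real.le_sqrt_of_sq_le (by linarith [hle i])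
  have hmul : ∀ f g : n → ℝ, (U * Matrix.diagonal (fun i => (f i : ℂ)) * Uᴴ) *
      (U * Matrix.diagonal (fun i => (g i : ℂ)) * Uᴴ) =
        U * Matrix.diagonal (fun i => ((f i * g i : ℝ) : ℂ)) * Uᴴ := by
    intro f g
    calc _ = U * (Matrix.diagonal (fun i => (f i : ℂ)) * (Uᴴ * U) *
          Matrix.diagonal (fun i => (g i : ℂ))) * Uᴴ := by simp only [Matrix.mul_assoc]
      _ = _ := by
          rw [hU, Matrix.mul_one, Matrix.diagonal_mul_diagonal]
          simp
  have hsub : ∀ f g : n → ℝ, U * Matrix.diagonal (fun i => (f i : ℂ)) * Uᴴ -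
      U * Matrix.diagonal (fun i => (g i : ℂ)) * Uᴴ =
        U * Matrix.diagonal (fun i => ((f i - g i : ℝ) : ℂ)) * Uᴴ := by
    intro f g
    rw [← Matrix.sub_mul, ← Matrix.mul_sub, Matrix.diagonal_sub]
    simp
  have hone : (1 : Matrix n n ℂ) = U * Matrix.diagonal (fun _ => ((1 : ℝ) : ℂ)) * Uᴴ := by
    rw [Complex.ofReal_one, Matrix.diagonal_one, Matrix.mul_one, hU']
  have hherm : ∀ f : n → ℝ, (U * Matrix.diagonal (fun i => (f i : ℂ)) * Uᴴ)ᴴ =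
      U * Matrix.diagonal (fun i => (f i : ℂ)) * Uᴴ := by
    intro f
    rw [Matrix.conjTranspose_mul, Matrix.conjTranspose_mul, Matrix.conjTranspose_conjTranspose,
      Matrix.diagonal_conjTranspose, ← Matrix.mul_assoc]
    congr 3
    ext i
    simp
  refine ⟨U * Matrix.diagonal (fun i => ((√(e i) : ℝ) : ℂ)) * Uᴴ,
    U * Matrix.diagonal (fun i => (((√(e i))⁻¹ : ℝ) : ℂ)) * Uᴴ, hherm _, hherm _, ?_, ?_, ?_, ?_⟩
  · rw [hmul, hone]
    congr 4
    ext i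
    rw [mul_inv_cancel₀ (by linarith [hs i])]
  · rw [hmul, hone]
    congr 4
    ext i
    rw [inv_mul_cancel₀ (by linarith [hs i])]
  · rw [hmul, hAU]
    congr 4
    ext i
    rw [Real.mul_self_sqrt (by linarith [hle i])]
  · have h2 : ∀ f : n → ℝ, (2 : ℂ) • (U * Matrix.diagonal (fun i => (f i : ℂ)) * Uᴴ) =
        U * Matrix.diagonal (fun i => ((2 * f i : ℝ) : ℂ)) * Uᴴ := by
      intro f
      rw [← Matrix.smul_mul, ← Matrix.mul_smul, ← Matrix.diagonal_smul]
      congr 3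
      ext i
      simp
    rw [hAU, hone, hsub, hsub, hmul, hmul, h2, hsub]
    refine Matrix.PosSemidef.mul_mul_conjTranspose_same (Matrix.PosSemidef.diagonal ?_) U
    intro i
    simp only [Pi.zero_apply]
    rw [← Complex.ofReal_zero, Complex.real_le_real]
    have h3 : e i = √(e i) * √(e i) := (Real.mul_self_sqrt (by linarith [hle i])).symm
    have h4 := hs i
    generalize √(e i) = t at h3 h4
    rw [h3]
    have h5 : (t * t - 1) * (t * t - 1) - 2 * ((t - 1) * (t - 1)) =
        (t - 1) ^ 2 * ((t + 1) ^ 2 - 2) := by ring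
    rw [h5]
    have h6 : 0 ≤ (t + 1) ^ 2 - 2 := by nlinarith
    positivity

/-- A family of coefficients whose Gram matrix is close to the identity is close to an isometric
family. -/
lemma exists_isometric_near (v : Matrix m n ℂ) {w : m → ℝ} {μ δ : ℝ} (hμ : 0 < μ)
    (hw : ∀ g, μ ≤ w g) (hδ0 : 0 ≤ δ)
    (h : ∑ g, ∑ g', w g * w g' * ‖(v * vᴴ - 1 : Matrix m m ℂ) g g'‖ ^ 2 ≤ δ ^ 2) (hδ : δ ≤ 3 / 4 * μ) :
    ∃ u : Matrix m n ℂ, u * uᴴ = 1 ∧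
      ∑ g, w g * (((v - u) * (v - u)ᴴ) g g).re ≤ δ ^ 2 / (2 * μ) := by
  have hH : (v * vᴴ).IsHermitian := Matrix.isHermitian_mul_conjTranspose_self v
  have hw0 : ∀ g, 0 ≤ w g := fun g => hμ.le.trans (hw g)
  have hsmall : frobSq (v * vᴴ - 1) ≤ (3 / 4) ^ 2 := by
    have h1 : μ ^ 2 * frobSq (v * vᴴ - 1) ≤ δ ^ 2 := by
      refine le_trans ?_ h
      rw [frobSq, Finset.mul_sum]
      refine Finset.sum_le_sum fun g _ => ?_
      rw [Finset.mul_sum]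
      refine Finset.sum_le_sum fun g' _ => ?_
      rw [sq μ]
      gcongr
      · exact hw0 g
      · exact hw g
      · exact hw g'
    have h2 : δ ^ 2 ≤ μ ^ 2 * (3 / 4) ^ 2 := by
      rw [← mul_pow]
      exact pow_le_pow_left₀ hδ0 (by linarith) 2
    exact le_of_mul_le_mul_left (h1.trans h2) (by positivity)
  obtain ⟨S, T, hS, hT, hST, hTS, hSS, hpos⟩ := exists_sqrt_near_one hH hsmall
  -- u is the polar part of v: S is the square root of vv† and T its inverse, so (v - u)(v - u)† =
  -- (S - 1)².
  refine ⟨T * v, ?_, ?_⟩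
  · rw [Matrix.conjTranspose_mul, hT]
    calc T * v * (vᴴ * T) = T * (v * vᴴ) * T := by simp only [Matrix.mul_assoc]
      _ = (T * S) * (S * T) := by rw [← hSS]; simp only [Matrix.mul_assoc]
      _ = 1 := by rw [hTS, hST, Matrix.mul_one]
  · have h1 : (v - T * v) * (v - T * v)ᴴ = (S - 1) * (S - 1) := by
      have h2 : v - T * v = (1 - T) * v := by rw [Matrix.sub_mul, Matrix.one_mul]
      rw [h2, Matrix.conjTranspose_mul, Matrix.conjTranspose_sub, Matrix.conjTranspose_one, hT]
      calc (1 - T) * v * (vᴴ * (1 - T)) = (1 - T) * (v * vᴴ) * (1 - T) := by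
            simp only [Matrix.mul_assoc]
        _ = ((1 - T) * S) * (S * (1 - T)) := by rw [← hSS]; simp only [Matrix.mul_assoc]
        _ = _ := by rw [Matrix.sub_mul, Matrix.mul_sub, hTS, hST, Matrix.one_mul, Matrix.mul_one]
    rw [h1]
    set A := v * vᴴ - 1 with hA
    have hAH : Aᴴ = A := by
      rw [hA, Matrix.conjTranspose_sub, hH.eq, Matrix.conjTranspose_one]
    have h3 : ∀ g, 2 * (((S - 1) * (S - 1)) g g).re ≤ ∑ g', ‖A g g'‖ ^ 2 := by
      intro g
      have h4 := (Complex.nonneg_iff.mp (hpos.diag_nonneg (i := g))).1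
      have h5 : ((A * A) g g).re = ∑ g', ‖A g g'‖ ^ 2 := by
        conv_lhs => rw [← hAH]
        nth_rewrite 1 [hAH]
        rw [Matrix.mul_apply, Complex.re_sum]
        refine Finset.sum_congr rfl fun g' _ => ?_
        rw [Matrix.conjTranspose_apply, Complex.star_def, Complex.mul_conj', ← Complex.ofReal_pow,
          Complex.ofReal_re]
      rw [Matrix.sub_apply, Matrix.smul_apply, Complex.sub_re, h5, smul_eq_mul] at h4
      have h6 : ((2 : ℂ) * ((S - 1) * (S - 1)) g g).re = 2 * (((S - 1) * (S - 1)) g g).re := by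
        simp
      linarith
    -- The spare factor μ is exchanged for the second weight w g', turning the row bound into the
    -- weighted double sum of the hypothesis.
    rw [le_div_iff₀ (by positivity), Finset.sum_mul]
    refine le_trans ?_ h
    refine Finset.sum_le_sum fun g _ => ?_
    calc w g * (((S - 1) * (S - 1)) g g).re * (2 * μ)
        = w g * μ * (2 * (((S - 1) * (S - 1)) g g).re) := by ring
      _ ≤ w g * μ * ∑ g', ‖A g g'‖ ^ 2 := by
          have := hw0 g
          gcongr
          exact h3 g
      _ ≤ _ := by
          rw [Finset.mul_sum]
          refine Finset.sum_le_sum fun g' _ => ?_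
          have := hw0 g
          gcongr
          exact hw g'

lemma smul_trace_sub_posSemidef {A : Matrix n n ℂ} (hA : A.PosSemidef) :
    (A.trace • (1 : Matrix n n ℂ) - A).PosSemidef := by
  obtain ⟨U, hU, hU', hAU⟩ := exists_diagonalization hA.isHermitian
  have htr : A.trace = ((∑ i, hA.isHermitian.eigenvalues i : ℝ) : ℂ) := by
    rw [hA.isHermitian.trace_eq_sum_eigenvalues]
    push_cast
    rfl
  have h1 : A.trace • (1 : Matrix n n ℂ) - A = U * Matrix.diagonal (fun i =>
      ((∑ j, hA.isHermitian.eigenvalues j - hA.isHermitian.eigenvalues i : ℝ) : ℂ)) * Uᴴ := by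
    have h2 : (((∑ i, hA.isHermitian.eigenvalues i : ℝ) : ℂ) • (U * Uᴴ)) =
        U * Matrix.diagonal (fun _ => ((∑ i, hA.isHermitian.eigenvalues i : ℝ) : ℂ)) * Uᴴ := by
      rw [← Matrix.smul_one_eq_diagonal, Matrix.mul_smul, Matrix.smul_mul, Matrix.mul_one]
    rw [htr, ← hU', h2]
    refine (congrArg _ hAU).trans ?_
    rw [← Matrix.sub_mul, ← Matrix.mul_sub, Matrix.diagonal_sub]
    simp
  rw [h1]
  refine Matrix.PosSemidef.mul_mul_conjTranspose_same (Matrix.PosSemidef.diagonal fun i => ?_) U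
  simp only [Pi.zero_apply]
  rw [← Complex.ofReal_zero, Complex.real_le_real, sub_nonneg]
  exact Finset.single_le_sum (fun j _ => hA.eigenvalues_nonneg j) (Finset.mem_univ i)

end Frobenius
/-! ### The dilation -/

section Combinations

variable {n I Y : Type*} [Fintype n] [Fintype I] [Fintype Y]

lemma sum_combination (u w : Matrix I Y ℂ) (G : I → Matrix n n ℂ) (X : Matrix n n ℂ) :
    ∑ y, (∑ g, u g y • G g) * X * (∑ g, w g y • G g)ᴴ =
      ∑ g, ∑ g', (u * wᴴ) g g' • (G g * X * (G g')ᴴ) := by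
  have h1 : ∀ g g', (u * wᴴ) g g' • (G g * X * (G g')ᴴ) =
      ∑ y, (u g y * star (w g' y)) • (G g * X * (G g')ᴴ) := by
    intro g g'
    rw [Matrix.mul_apply, Finset.sum_smul]
    rfl
  simp_rw [h1]
  rw [Finset.sum_congr rfl fun g _ => Finset.sum_comm, Finset.sum_comm]
  refine Finset.sum_congr rfl fun y _ => ?_
  rw [Finset.sum_mul, Finset.sum_mul]
  refine Finset.sum_congr rfl fun g _ => ?_
  rw [Matrix.conjTranspose_sum, Finset.mul_sum]
  refine Finset.sum_congr rfl fun g' _ => ?_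
  rw [Matrix.conjTranspose_smul, Matrix.smul_mul, Matrix.smul_mul, Matrix.mul_smul, smul_smul]

lemma sum_conjTranspose_combination (u : Matrix I Y ℂ) (G : I → Matrix n n ℂ) :
    ∑ y, (∑ g, u g y • G g)ᴴ * (∑ g, u g y • G g) =
      ∑ g, ∑ g', (u * uᴴ) g' g • ((G g)ᴴ * G g') := by
  have h1 : ∀ g g', (u * uᴴ) g' g • ((G g)ᴴ * G g') =
      ∑ y, (u g' y * star (u g y)) • ((G g)ᴴ * G g') := by
    intro g g'
    rw [Matrix.mul_apply, Finset.sum_smul]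
    rfl
  simp_rw [h1]
  rw [Finset.sum_congr rfl fun g _ => Finset.sum_comm, Finset.sum_comm]
  refine Finset.sum_congr rfl fun y _ => ?_
  rw [Matrix.conjTranspose_sum, Finset.sum_mul]
  refine Finset.sum_congr rfl fun g _ => ?_
  rw [Finset.mul_sum]
  refine Finset.sum_congr rfl fun g' _ => ?_
  rw [Matrix.conjTranspose_smul, Matrix.smul_mul, Matrix.mul_smul, smul_smul, mul_comm]

end Combinations

lemma frobSq_kronecker_star {d : ℕ} (r : Matrix (Fin d) (Fin d) ℂ) :
    frobSq (r ⊗ₖ r.map star) = frobSq r ^ 2 := by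
  simp_rw [frobSq, Fintype.sum_prod_type, Matrix.kroneckerMap_apply, norm_mul, mul_pow]
  rw [sq, Finset.sum_mul_sum]
  refine Finset.sum_congr rfl fun j _ => Finset.sum_congr rfl fun j' _ => ?_
  rw [Finset.sum_mul_sum]
  simp

lemma mul_kronecker_star_apply {d : ℕ} (T : Matrix (Fin d × Fin d) (Fin d × Fin d) ℂ)
    (r : Matrix (Fin d) (Fin d) ℂ) (p q : Fin d × Fin d) :
    (T * (r ⊗ₖ r.map star)) p q =
      mapOf T (r * Matrix.single q.1 q.2 (1 : ℂ) * rᴴ) p.1 p.2 := by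
  have h1 : ∀ k k', (r * Matrix.single q.1 q.2 (1 : ℂ) * rᴴ) k k' = r k q.1 * star (r k' q.2) := by
    intro k k'
    rw [Matrix.mul_assoc, Matrix.mul_apply, Finset.sum_eq_single q.1]
    · rw [Matrix.single_mul_apply_same, one_mul, Matrix.conjTranspose_apply]
    · intro a _ ha
      rw [Matrix.single_mul_apply_of_ne _ _ _ _ _ ha, mul_zero]
    · simp
  simp_rw [mapOf, h1]
  rw [Matrix.mul_apply, Fintype.sum_prod_type]
  rfl

namespace IUMPS

variable {d ds : ℕ} {Φ : IUMPS d ds}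

lemma mapOf_E_pow (n : ℕ) (X : Matrix (Fin d) (Fin d) ℂ) :
    mapOf (Φ.E ^ n) X = (Φ.chan ^ n) X := by
  apply flat.injective
  rw [flat_mapOf, E_pow_mulVec_flat]

lemma mapOf_sub (S T : Matrix (Fin d × Fin d) (Fin d × Fin d) ℂ) (X : Matrix (Fin d) (Fin d) ℂ) :
    mapOf (S - T) X = mapOf S X - mapOf T X := by
  ext i j
  simp [mapOf, sub_mul, Finset.sum_sub_distrib]

namespace NormalForm

variable (D : Φ.NormalForm)

/-- The trace of `ω`. -/
def size : ℝ := ∑ α, D.q α * (D.blk α).rank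

lemma size_nonneg : 0 ≤ D.size :=
  Finset.sum_nonneg fun α _ => mul_nonneg (D.q_pos α).le (Nat.cast_nonneg _)

lemma size_le : D.size ≤ d := by
  calc D.size ≤ ∑ α, D.q α * d := by
        refine Finset.sum_le_sum fun α _ => mul_le_mul_of_nonneg_left ?_ (D.q_pos α).le
        have := (D.blk α).rank_le_card_width
        rw [Fintype.card_fin] at this
        exact_mod_cast this
    _ = d := by rw [← Finset.sum_mul, sum_q, one_mul]

/-- The square root of `ω`. -/
def rootω : Matrix (Fin d) (Fin d) ℂ := ∑ α, (√(D.q α) : ℂ) • D.blk α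

lemma conjTranspose_rootω : D.rootωᴴ = D.rootω := by
  rw [rootω, Matrix.conjTranspose_sum]
  refine Finset.sum_congr rfl fun α _ => ?_
  rw [Matrix.conjTranspose_smul, (D.isBlock α).conjTranspose_eq, Complex.star_def,
    Complex.conj_ofReal]

lemma rootω_mul_rootω : D.rootω * D.rootω = D.ω := by
  rw [rootω, ω, Finset.sum_mul]
  refine Finset.sum_congr rfl fun α _ => ?_
  rw [Finset.mul_sum, Finset.sum_eq_single α]
  · rw [Matrix.smul_mul, Matrix.mul_smul, smul_smul, (D.isBlock α).mul_self, ← Complex.ofReal_mul,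
      Real.mul_self_sqrt (D.q_pos α).le]
  · intro β _ h
    rw [Matrix.smul_mul, Matrix.mul_smul, D.orthogonal α β h.symm, smul_zero, smul_zero]
  · intro h; exact absurd (Finset.mem_univ _) h

lemma frobSq_rootω : frobSq D.rootω = D.size := by
  have h1 := trace_conjTranspose_mul_self D.rootω
  rw [conjTranspose_rootω, rootω_mul_rootω, ω, Matrix.trace_sum] at h1
  have h2 : ((D.size : ℝ) : ℂ) = ∑ α, ((D.q α : ℂ) • D.blk α).trace := by
    rw [size]
    push_cast
    refine Finset.sum_congr rfl fun α _ => ?_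
    rw [Matrix.trace_smul, trace_eq_rank_of_idempotent (D.isBlock α).mul_self, smul_eq_mul]
  exact_mod_cast (h2.trans h1).symm

/-- The coefficients of the products of the matrices in terms of the Kraus operators. -/
def wordCoef (b : ℕ) : Matrix (D.Idx b) (Fin b → Fin ds) ℂ :=
  fun g y => (D.word_eq_sum_kraus y).choose g

lemma sum_wordCoef {b : ℕ} (y : Fin b → Fin ds) :
    ∑ g, D.wordCoef b g y • D.kraus b g = Φ.word y :=
  (D.word_eq_sum_kraus y).choose_spec.symm

lemma mapOf_E_sub {b : ℕ} (hb : b ≠ 0) (X : Matrix (Fin d) (Fin d) ℂ) :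
    mapOf (Φ.E ^ b - Φ.Eper ^ b) X = ∑ g, ∑ g',
      (D.wordCoef b * (D.wordCoef b)ᴴ - 1 : Matrix (D.Idx b) (D.Idx b) ℂ) g g' •
        (D.kraus b g * X * (D.kraus b g')ᴴ) := by
  rw [mapOf_sub, mapOf_E_pow, ← D.sum_kraus_mul hb, ← sum_word_mul]
  simp_rw [← D.sum_wordCoef]
  rw [sum_combination, ← Finset.sum_sub_distrib]
  refine Finset.sum_congr rfl fun g _ => ?_
  simp_rw [Matrix.sub_apply, sub_smul]
  rw [Finset.sum_sub_distrib]
  congr 1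
  simp_rw [Matrix.one_apply, ite_smul, one_smul, zero_smul]
  rw [Finset.sum_ite_eq]
  simp

lemma trace_kraus_ω (b : ℕ) (g g' : D.Idx b) :
    (D.kraus b g * D.ω * (D.kraus b g')ᴴ).trace = if g = g' then (D.wt b g : ℂ) else 0 := by
  rw [Matrix.trace_mul_comm, ← Matrix.mul_assoc, Matrix.trace_mul_comm, trace_ω_kraus]
  by_cases h : g = g'
  · subst h; rfl
  · rw [if_neg h, if_neg (Ne.symm h)]

/-- Let the columns of H be the vectorised K_g √ω; they are orthogonal with squared norms `wt`. Then
H(vv† - 1)H† is (E^b - Ẽ^b)(√ω ⊗ √ω̄) with its indices realigned. Realignment preserves the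
Frobenius norm, and the Frobenius norm of √ω ⊗ √ω̄ is tr ω. -/
lemma sum_wt_le {b : ℕ} (hb : b ≠ 0) : ∑ g, ∑ g', D.wt b g * D.wt b g' *
    ‖(D.wordCoef b * (D.wordCoef b)ᴴ - 1 : Matrix (D.Idx b) (D.Idx b) ℂ) g g'‖ ^ 2 ≤
      (‖Φ.E ^ b - Φ.Eper ^ b‖ * D.size) ^ 2 := by
  let H : Matrix (Fin d × Fin d) (D.Idx b) ℂ := fun p g => (D.kraus b g * D.rootω) p.1 p.2
  set A := (D.wordCoef b * (D.wordCoef b)ᴴ - 1 : Matrix (D.Idx b) (D.Idx b) ℂ) with hA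
  have hH : Hᴴ * H = Matrix.diagonal fun g => (D.wt b g : ℂ) := by
    ext g g'
    have h1 : (Hᴴ * H) g g' = ((D.kraus b g * D.rootω)ᴴ * (D.kraus b g' * D.rootω)).trace := by
      rw [Matrix.mul_apply, Fintype.sum_prod_type, Finset.sum_comm, Matrix.trace]
      refine Finset.sum_congr rfl fun i _ => ?_
      rw [Matrix.diag_apply, Matrix.mul_apply]
      rfl
    rw [h1, Matrix.conjTranspose_mul, conjTranspose_rootω, Matrix.diagonal_apply,
      ← D.trace_ω_kraus, ← D.rootω_mul_rootω, Matrix.mul_assoc D.rootω D.rootω,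
      Matrix.trace_mul_comm D.rootω (D.rootω * _)]
    simp only [Matrix.mul_assoc]
  rw [← frobSq_mul_mul_conjTranspose hH]
  have hE : ∀ p q, ((Φ.E ^ b - Φ.Eper ^ b) * (D.rootω ⊗ₖ D.rootω.map star)) p q =
      (H * A * Hᴴ) (p.1, q.1) (p.2, q.2) := by
    intro p q
    rw [mul_kronecker_star_apply, D.mapOf_E_sub hb, ← hA]
    simp only [Matrix.sum_apply, Matrix.smul_apply, smul_eq_mul]
    have h2 : ∀ g g', (D.kraus b g * (D.rootω * Matrix.single q.1 q.2 (1 : ℂ) * D.rootωᴴ) *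
        (D.kraus b g')ᴴ) p.1 p.2 = H (p.1, q.1) g * star (H (p.2, q.2) g') := by
      intro g g'
      have h3 : D.kraus b g * (D.rootω * Matrix.single q.1 q.2 (1 : ℂ) * D.rootωᴴ) *
          (D.kraus b g')ᴴ = (D.kraus b g * D.rootω) * (Matrix.single q.1 q.2 (1 : ℂ) *
            (D.kraus b g' * D.rootω)ᴴ) := by
        rw [Matrix.conjTranspose_mul]
        simp only [Matrix.mul_assoc]
      rw [h3, Matrix.mul_apply, Finset.sum_eq_single q.1]
      · rw [Matrix.single_mul_apply_same, one_mul, Matrix.conjTranspose_apply]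
      · intro a _ ha
        rw [Matrix.single_mul_apply_of_ne _ _ _ _ _ ha, mul_zero]
      · simp
    simp_rw [h2]
    rw [Matrix.mul_assoc, Matrix.mul_apply]
    refine Finset.sum_congr rfl fun g _ => ?_
    rw [Matrix.mul_apply, Finset.mul_sum]
    refine Finset.sum_congr rfl fun g' _ => ?_
    rw [Matrix.conjTranspose_apply]
    ring
  have h4 : frobSq (H * A * Hᴴ) =
      frobSq ((Φ.E ^ b - Φ.Eper ^ b) * (D.rootω ⊗ₖ D.rootω.map star)) := by
    simp_rw [frobSq, hE, Fintype.sum_prod_type]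
    exact Finset.sum_congr rfl fun j _ => Finset.sum_comm
  rw [h4, mul_pow, ← D.frobSq_rootω, ← frobSq_kronecker_star]
  exact frobSq_mul_le _ _

/-- σ is block diagonal, and a positive matrix on a block is at most its trace times the block
projection. -/
lemma ω_sub_sigma_posSemidef : (D.ω - Φ.σ).PosSemidef := by
  have h1 : D.ω - Φ.σ = ∑ α, ((D.q α : ℂ) • D.blk α - D.blk α * Φ.σ) := by
    rw [Finset.sum_sub_distrib, ← Finset.sum_mul, D.sum_eq, Matrix.one_mul, ω]
  rw [h1]
  refine Matrix.posSemidef_sum _ fun α _ => ?_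
  have h2 : D.blk α * Φ.σ * D.blk α = D.blk α * Φ.σ := by
    rw [Matrix.mul_assoc, (D.isBlock α).commute_sigma.eq, ← Matrix.mul_assoc,
      (D.isBlock α).mul_self]
  have h3 : (D.blk α * Φ.σ).PosSemidef := by
    rw [← h2]
    conv => rw [← (D.isBlock α).conjTranspose_eq]
    nth_rewrite 1 [(D.isBlock α).conjTranspose_eq]
    exact Φ.posDef.posSemidef.mul_mul_conjTranspose_same _
  have h4 := (smul_trace_sub_posSemidef h3).mul_mul_conjTranspose_same (D.blk α)
  rwa [(D.isBlock α).conjTranspose_eq, Matrix.mul_sub, Matrix.sub_mul, Matrix.mul_smul,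
    Matrix.smul_mul, Matrix.mul_one, (D.isBlock α).mul_self, ← Matrix.mul_assoc,
    (D.isBlock α).mul_self, h2, ← ofReal_q] at h4

lemma trace_sigma_le_trace_ω (Y : Matrix (Fin d) (Fin d) ℂ) :
    (Y * Φ.σ * Yᴴ).trace.re ≤ (Y * D.ω * Yᴴ).trace.re := by
  have h1 := (D.ω_sub_sigma_posSemidef.mul_mul_conjTranspose_same Y).trace_nonneg
  rw [Matrix.mul_sub, Matrix.sub_mul, Matrix.trace_sub] at h1
  have h2 := (Complex.nonneg_iff.mp h1).1
  rw [Complex.sub_re] at h2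
  linarith

/-- The dilation of the peripheral channel with given coefficients. -/
def dilation {b : ℕ} (u : Matrix (D.Idx b) (Fin b → Fin ds) ℂ) (y : Fin b → Fin ds) :
    Matrix (Fin d) (Fin d) ℂ := ∑ g, u g y • D.kraus b g

lemma sum_sum_one_smul {I V : Type*} [Fintype I] [DecidableEq I] [AddCommGroup V] [Module ℂ V]
    (f : I → I → V) : ∑ g, ∑ g', (1 : Matrix I I ℂ) g g' • f g g' = ∑ g, f g g := by
  refine Finset.sum_congr rfl fun g _ => ?_
  simp_rw [Matrix.one_apply, ite_smul, one_smul, zero_smul]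
  rw [Finset.sum_ite_eq]
  simp

lemma isPeripheralDilation_dilation {b : ℕ} (hb : b ≠ 0)
    {u : Matrix (D.Idx b) (Fin b → Fin ds) ℂ} (hu : u * uᴴ = 1) :
    Φ.IsPeripheralDilation (D.dilation u) := by
  constructor
  · simp_rw [dilation]
    rw [sum_conjTranspose_combination, hu, Finset.sum_comm,
      sum_sum_one_smul fun g' g => (D.kraus b g)ᴴ * D.kraus b g', sum_kraus_conjTranspose_mul]
  · intro X
    simp_rw [dilation]
    rw [sum_combination, hu, sum_sum_one_smul fun g g' => D.kraus b g * X * (D.kraus b g')ᴴ,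
      D.sum_kraus_mul hb]

/-- Once σ is replaced by the larger ω, orthogonality of the K_g turns the left side into the
weighted diagonal of (v - u)(v - u)†. Smallness is stated with d ≥ tr ω, so that the threshold does
not depend on the decomposition. -/
lemma exists_dilation {b : ℕ} (hb : b ≠ 0)
    (h : ‖Φ.E ^ b - Φ.Eper ^ b‖ * d ≤ 3 / 4 * Φ.sigmaMin) (hσ : 0 < Φ.sigmaMin) :
    ∃ u : Matrix (D.Idx b) (Fin b → Fin ds) ℂ, u * uᴴ = 1 ∧
      ∑ y, ((Φ.word y - D.dilation u y) * Φ.σ * (Φ.word y - D.dilation u y)ᴴ).trace.re ≤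
        (‖Φ.E ^ b - Φ.Eper ^ b‖ * D.size) ^ 2 / (2 * Φ.sigmaMin) := by
  obtain ⟨u, hu, hu'⟩ := exists_isometric_near (D.wordCoef b) hσ (D.sigmaMin_le_wt b)
    (mul_nonneg (norm_nonneg _) D.size_nonneg) (D.sum_wt_le hb)
    ((mul_le_mul_of_nonneg_left D.size_le (norm_nonneg _)).trans h)
  refine ⟨u, hu, le_trans ?_ hu'⟩
  have h1 : ∀ y, Φ.word y - D.dilation u y = ∑ g, (D.wordCoef b - u) g y • D.kraus b g := by
    intro y
    simp_rw [Matrix.sub_apply, sub_smul]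
    rw [Finset.sum_sub_distrib, D.sum_wordCoef, dilation]
  calc _ ≤ ∑ y, ((Φ.word y - D.dilation u y) * D.ω * (Φ.word y - D.dilation u y)ᴴ).trace.re :=
        Finset.sum_le_sum fun y _ => D.trace_sigma_le_trace_ω _
    _ = (∑ y, (Φ.word y - D.dilation u y) * D.ω * (Φ.word y - D.dilation u y)ᴴ).trace.re := by
        rw [Matrix.trace_sum, Complex.re_sum]
    _ = _ := by
        simp_rw [h1]
        rw [sum_combination, Matrix.trace_sum, Complex.re_sum]
        refine Finset.sum_congr rfl fun g _ => ?_
        rw [Matrix.trace_sum, Finset.sum_eq_single g]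
        · rw [Matrix.trace_smul, trace_kraus_ω, if_pos rfl, smul_eq_mul, Complex.re_mul_ofReal,
            mul_comm]
        · intro g' _ hg
          rw [Matrix.trace_smul, trace_kraus_ω, if_neg hg.symm, smul_zero]
        · intro h; exact absurd (Finset.mem_univ _) h

end NormalForm
end IUMPS
/-! ### The trace norm -/

section TraceNorm

variable {m n : Type} [Fintype m] [DecidableEq m] [Fintype n] [DecidableEq n]

lemma norm_le_one_of_isometry {m n : Type*} [Fintype m] [DecidableEq m] [Fintype n]
    [DecidableEq n] {W : Matrix m n ℂ} (h : Wᴴ * W = 1) : ‖W‖ ≤ 1 := by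
  have h1 := Matrix.l2_opNorm_conjTranspose_mul_self W
  have h2 : ‖(1 : Matrix n n ℂ)‖ ≤ 1 := by
    rw [← Matrix.diagonal_one, Matrix.l2_opNorm_diagonal, pi_norm_le_iff_of_nonneg zero_le_one]
    simp
  rw [h] at h1
  nlinarith [norm_nonneg W]

lemma norm_trace_mul_conjTranspose_le (P Q : Matrix m n ℂ) :
    ‖(P * Qᴴ).trace‖ ≤ √(frobSq P) * √(frobSq Q) := by
  have h1 : (P * Qᴴ).trace = ∑ p : m × n, P p.1 p.2 * star (Q p.1 p.2) := by
    rw [Fintype.sum_prod_type]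
    rfl
  rw [h1, ← Real.sqrt_mul (frobSq_nonneg P)]
  refine Real.le_sqrt_of_sq_le ?_
  calc _ ≤ (∑ p : m × n, ‖P p.1 p.2‖ * ‖Q p.1 p.2‖) ^ 2 := by
        gcongr
        exact (norm_sum_le _ _).trans_eq (by simp)
    _ ≤ _ := Finset.sum_mul_sq_le_sq_mul_sq _ _ _
    _ = _ := by
        rw [Fintype.sum_prod_type, Fintype.sum_prod_type]
        rfl

/-- Polar decomposition: the trace norm is attained on a contraction. -/
lemma exists_contraction_traceNorm (A : Matrix n n ℂ) :
    ∃ U : Matrix n n ℂ, ‖U‖ ≤ 1 ∧ (traceNorm A : ℂ) = (U * A).trace := by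
  have hA := Matrix.isHermitian_conjTranspose_mul_self A
  obtain ⟨W, hW, hW', hAW⟩ := exists_diagonalization hA
  set e := hA.eigenvalues with he
  have he0 : ∀ i, 0 ≤ e i := (Matrix.posSemidef_conjTranspose_mul_self A).eigenvalues_nonneg
  have hinv : ∀ i, (√(e i))⁻¹ * e i = √(e i) := by
    intro i
    by_cases h : √(e i) = 0
    · rw [h, inv_zero, zero_mul]
    · rw [inv_mul_eq_iff_eq_mul₀ h, Real.mul_self_sqrt (he0 i)]
  -- The contraction is (A†A)^(-1/2) A†; the convention 0⁻¹ = 0 makes the first factor a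
  -- pseudo-inverse, so A need not be invertible.
  let Δ : Matrix n n ℂ := Matrix.diagonal fun i => (((√(e i))⁻¹ : ℝ) : ℂ)
  have hΔ : Δᴴ = Δ := by
    rw [Matrix.diagonal_conjTranspose]
    congr 1
    ext i
    simp
  have hWn : ‖W‖ ≤ 1 := norm_le_one_of_isometry hW
  refine ⟨W * Δ * Wᴴ * Aᴴ, ?_, ?_⟩
  · have h1 : (W * Δ * Wᴴ * Aᴴ)ᴴᴴ * (W * Δ * Wᴴ * Aᴴ)ᴴ =
        W * Matrix.diagonal (fun i => (((√(e i))⁻¹ * √(e i) : ℝ) : ℂ)) * Wᴴ := by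
      calc _ = W * Δ * Wᴴ * (Aᴴ * A) * W * Δ * Wᴴ := by
            simp only [Matrix.conjTranspose_conjTranspose, Matrix.conjTranspose_mul, hΔ,
              Matrix.mul_assoc]
        _ = W * (Δ * (Wᴴ * W) * Matrix.diagonal (fun i => (e i : ℂ)) * (Wᴴ * W) * Δ) * Wᴴ := by
            rw [hAW]
            simp only [Matrix.mul_assoc]
        _ = _ := by
            rw [hW, Matrix.mul_one, Matrix.mul_one, Matrix.diagonal_mul_diagonal,
              Matrix.diagonal_mul_diagonal]
            congr 3
            ext i
            rw [← Complex.ofReal_mul, ← Complex.ofReal_mul, hinv, mul_comm]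
    have h2 := Matrix.l2_opNorm_conjTranspose_mul_self (W * Δ * Wᴴ * Aᴴ)ᴴ
    rw [h1, Matrix.l2_opNorm_conjTranspose] at h2
    have h3 : ‖Matrix.diagonal (fun i => (((√(e i))⁻¹ * √(e i) : ℝ) : ℂ))‖ ≤ 1 := by
      rw [Matrix.l2_opNorm_diagonal, pi_norm_le_iff_of_nonneg zero_le_one]
      intro i
      rw [Complex.norm_real, Real.norm_eq_abs]
      by_cases h : √(e i) = 0
      · rw [h]; simp
      · rw [inv_mul_cancel₀ h]; simp
    have h4 : ‖W * Matrix.diagonal (fun i => (((√(e i))⁻¹ * √(e i) : ℝ) : ℂ)) * Wᴴ‖ ≤ 1 * 1 * 1 := by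
      refine (Matrix.l2_opNorm_mul _ _).trans (mul_le_mul ((Matrix.l2_opNorm_mul _ _).trans
        (mul_le_mul hWn h3 (norm_nonneg _) zero_le_one)) ?_ (norm_nonneg _) (by norm_num))
      rwa [Matrix.l2_opNorm_conjTranspose]
    rw [h2] at h4
    nlinarith [norm_nonneg (W * Δ * Wᴴ * Aᴴ)]
  · have h1 : W * Δ * Wᴴ * Aᴴ * A = W * Matrix.diagonal (fun i => ((√(e i) : ℝ) : ℂ)) * Wᴴ := by
      calc _ = W * (Δ * (Wᴴ * W) * Matrix.diagonal (fun i => (e i : ℂ))) * Wᴴ := by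
            rw [Matrix.mul_assoc _ Aᴴ A, hAW]
            simp only [Matrix.mul_assoc]
        _ = _ := by
            rw [hW, Matrix.mul_one, Matrix.diagonal_mul_diagonal]
            congr 3
            ext i
            rw [← Complex.ofReal_mul, hinv]
    rw [h1, Matrix.mul_assoc, Matrix.trace_mul_comm, Matrix.mul_assoc, hW, Matrix.mul_one,
      Matrix.trace_diagonal, traceNorm]
    push_cast
    rfl

lemma frobSq_mul_le_of_norm_le_one {U : Matrix m m ℂ} (hU : ‖U‖ ≤ 1) (A : Matrix m n ℂ) :
    frobSq (U * A) ≤ frobSq A :=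
  (frobSq_mul_le U A).trans (mul_le_of_le_one_left (frobSq_nonneg A)
    (pow_le_one₀ (norm_nonneg _) hU))

/-- Write XX† - YY† = (X - Y)X† + Y(X - Y)†, test against the contraction attaining the trace norm,
and apply Cauchy–Schwarz for the Frobenius inner product. -/
lemma traceNorm_sub_le {X Y : Matrix m n ℂ} (hX : frobSq X ≤ 1) (hY : frobSq Y ≤ 1) :
    traceNorm (X * Xᴴ - Y * Yᴴ) ≤ 2 * √(frobSq (X - Y)) := by
  obtain ⟨U, hU, h⟩ := exists_contraction_traceNorm (X * Xᴴ - Y * Yᴴ)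
  have h1 : U * (X * Xᴴ - Y * Yᴴ) = U * (X - Y) * Xᴴ + U * Y * (X - Y)ᴴ := by
    rw [Matrix.conjTranspose_sub]
    simp only [Matrix.mul_sub, Matrix.sub_mul, Matrix.mul_assoc]
    abel
  have h2 : traceNorm (X * Xᴴ - Y * Yᴴ) ≤ ‖(U * (X * Xᴴ - Y * Yᴴ)).trace‖ := by
    rw [← h, Complex.norm_real]
    exact le_abs_self _
  refine h2.trans ?_
  rw [h1, Matrix.trace_add]
  refine (norm_add_le _ _).trans ?_
  have h3 : ‖(U * (X - Y) * Xᴴ).trace‖ ≤ √(frobSq (X - Y)) * 1 :=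
    (norm_trace_mul_conjTranspose_le _ _).trans (mul_le_mul
      (Real.sqrt_le_sqrt (frobSq_mul_le_of_norm_le_one hU _)) (Real.sqrt_le_one.mpr hX)
      (Real.sqrt_nonneg _) (Real.sqrt_nonneg _))
  have h4 : ‖(U * Y * (X - Y)ᴴ).trace‖ ≤ 1 * √(frobSq (X - Y)) :=
    (norm_trace_mul_conjTranspose_le _ _).trans (mul_le_mul
      (Real.sqrt_le_one.mpr ((frobSq_mul_le_of_norm_le_one hU _).trans hY)) le_rfl
      (Real.sqrt_nonneg _) zero_le_one)
  linarith

end TraceNorm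

-- From the distance of dilations to the trace distance of states

namespace IUMPS

variable {d ds : ℕ} (Φ : IUMPS d ds)

/-- The sum over C disappears because words form an isometry, the sum over A because σ is fixed;
this is what makes all estimates uniform in A and C. -/
lemma trace_blockState {a b c : ℕ} (G : (Fin b → Fin ds) → Matrix (Fin d) (Fin d) ℂ) :
    (Φ.blockState (a := a) (c := c) G).trace = ∑ y, (G y * Φ.σ * (G y)ᴴ).trace := by
  have h1 : (Φ.blockState (a := a) (c := c) G).trace = ∑ x : Fin a → Fin ds, ∑ y,
      ∑ z : Fin c → Fin ds, ((Φ.word z)ᴴ * Φ.word z *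
        (G y * (Φ.word x * Φ.σ * (Φ.word x)ᴴ) * (G y)ᴴ)).trace := by
    rw [Matrix.trace, Fintype.sum_prod_type]
    refine Finset.sum_congr rfl fun x _ => ?_
    rw [Fintype.sum_prod_type]
    refine Finset.sum_congr rfl fun y _ => Finset.sum_congr rfl fun z _ => ?_
    rw [Matrix.diag_apply, blockState, Matrix.mul_assoc (Φ.word z)ᴴ, Matrix.trace_mul_comm (Φ.word z)ᴴ]
    simp only [Matrix.conjTranspose_mul, Matrix.mul_assoc]
  rw [h1, Finset.sum_comm]
  refine Finset.sum_congr rfl fun y _ => ?_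
  have h2 : ∀ x : Fin a → Fin ds, ∑ z : Fin c → Fin ds, ((Φ.word z)ᴴ * Φ.word z *
        (G y * (Φ.word x * Φ.σ * (Φ.word x)ᴴ) * (G y)ᴴ)).trace =
      (G y * (Φ.word x * Φ.σ * (Φ.word x)ᴴ) * (G y)ᴴ).trace := by
    intro x
    rw [← Matrix.trace_sum, ← Finset.sum_mul, sum_word_conjTranspose_mul, Matrix.one_mul]
  rw [Finset.sum_congr rfl fun x _ => h2 x, ← Matrix.trace_sum, ← Finset.sum_mul, ← Finset.mul_sum,
    sum_word_sigma]

/-- The amplitudes of a purification of the state of three consecutive regions. -/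
def amplitude (r : Matrix (Fin d) (Fin d) ℂ) {a b c : ℕ}
    (F : (Fin b → Fin ds) → Matrix (Fin d) (Fin d) ℂ) :
    Matrix ((Fin a → Fin ds) × (Fin b → Fin ds) × (Fin c → Fin ds)) (Fin d × Fin d) ℂ :=
  fun u p => (Φ.word u.2.2 * F u.2.1 * Φ.word u.1 * r) p.1 p.2

lemma amplitude_mul_conjTranspose {r : Matrix (Fin d) (Fin d) ℂ} (hr : r * rᴴ = Φ.σ) {a b c : ℕ}
    (F : (Fin b → Fin ds) → Matrix (Fin d) (Fin d) ℂ) :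
    Φ.amplitude r (a := a) (c := c) F * (Φ.amplitude r F)ᴴ = Φ.blockState F := by
  ext u v
  have h1 : Φ.blockState F u v = ((Φ.word u.2.2 * F u.2.1 * Φ.word u.1 * r) *
      (Φ.word v.2.2 * F v.2.1 * Φ.word v.1 * r)ᴴ).trace := by
    rw [blockState, ← hr, Matrix.conjTranspose_mul _ r]
    simp only [Matrix.mul_assoc]
  rw [h1, Matrix.mul_apply, Fintype.sum_prod_type]
  rfl

open scoped MatrixOrder in
lemma exists_sigma_root : ∃ r : Matrix (Fin d) (Fin d) ℂ, r * rᴴ = Φ.σ := by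
  obtain ⟨B, hB⟩ := CStarAlgebra.nonneg_iff_eq_star_mul_self.mp Φ.posDef.posSemidef.nonneg
  exact ⟨Bᴴ, by rw [Matrix.conjTranspose_conjTranspose, hB]; rfl⟩

lemma frobSq_amplitude {r : Matrix (Fin d) (Fin d) ℂ} (hr : r * rᴴ = Φ.σ) {a b c : ℕ}
    (F : (Fin b → Fin ds) → Matrix (Fin d) (Fin d) ℂ) :
    frobSq (Φ.amplitude r (a := a) (c := c) F) = ∑ y, (F y * Φ.σ * (F y)ᴴ).trace.re := by
  have h1 := trace_conjTranspose_mul_self (Φ.amplitude r (a := a) (c := c) F)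
  rw [Matrix.trace_mul_comm, amplitude_mul_conjTranspose Φ hr, trace_blockState] at h1
  have h2 := congrArg Complex.re h1
  rw [Complex.ofReal_re, Complex.re_sum] at h2
  exact h2.symm

lemma sum_trace_of_isometry {b : ℕ} {F : (Fin b → Fin ds) → Matrix (Fin d) (Fin d) ℂ}
    (hF : ∑ y, (F y)ᴴ * F y = 1) : ∑ y, (F y * Φ.σ * (F y)ᴴ).trace = 1 := by
  calc _ = ∑ y, ((F y)ᴴ * F y * Φ.σ).trace := by
        refine Finset.sum_congr rfl fun y _ => ?_
        rw [Matrix.trace_mul_comm, Matrix.mul_assoc]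
    _ = 1 := by
        rw [← Matrix.trace_sum, ← Finset.sum_mul, hF, Matrix.one_mul, Φ.trace_one]

lemma isDensity_blockState {a b c : ℕ} {F : (Fin b → Fin ds) → Matrix (Fin d) (Fin d) ℂ}
    (hF : ∑ y, (F y)ᴴ * F y = 1) : IsDensity (Φ.blockState (a := a) (c := c) F) := by
  obtain ⟨r, hr⟩ := Φ.exists_sigma_root
  constructor
  · rw [← amplitude_mul_conjTranspose Φ hr]
    exact Matrix.posSemidef_self_mul_conjTranspose _
  · rw [trace_blockState, Φ.sum_trace_of_isometry hF]

/-- Both states have purifications with amplitudes linear in the middle family, so the difference of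
amplitudes is the amplitude of word minus F. -/
lemma traceNorm_rho_sub_le (a c : ℕ) {b : ℕ} {F : (Fin b → Fin ds) → Matrix (Fin d) (Fin d) ℂ}
    (hF : ∑ y, (F y)ᴴ * F y = 1) : traceNorm (Φ.rho a b c - Φ.blockState F) ≤
      2 * √(∑ y, ((Φ.word y - F y) * Φ.σ * (Φ.word y - F y)ᴴ).trace.re) := by
  obtain ⟨r, hr⟩ := Φ.exists_sigma_root
  have hone : ∀ G : (Fin b → Fin ds) → Matrix (Fin d) (Fin d) ℂ, ∑ y, (G y)ᴴ * G y = 1 →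
      frobSq (Φ.amplitude r (a := a) (c := c) G) ≤ 1 := by
    intro G hG
    rw [frobSq_amplitude Φ hr, ← Complex.re_sum, Φ.sum_trace_of_isometry hG, Complex.one_re]
  have h1 := traceNorm_sub_le (hone _ (Φ.sum_word_conjTranspose_mul b)) (hone _ hF)
  have h2 : Φ.amplitude r (a := a) (c := c) Φ.word - Φ.amplitude r F =
      Φ.amplitude r (fun y => Φ.word y - F y) := by
    ext u p
    simp only [Matrix.sub_apply, amplitude]
    rw [Matrix.mul_sub, Matrix.sub_mul, Matrix.sub_mul, Matrix.sub_apply]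
  rwa [h2, frobSq_amplitude Φ hr, amplitude_mul_conjTranspose Φ hr,
    amplitude_mul_conjTranspose Φ hr] at h1

namespace NormalForm

variable {Φ} (D : Φ.NormalForm)

lemma period_le_rank (α : Fin D.N) : D.m α ≤ (D.blk α).rank := by
  have h1 : (D.blk α).rank = ∑ k : Fin (D.m α), (D.R α k).rank := by
    have h2 : ((D.blk α).rank : ℂ) = ∑ k : Fin (D.m α), ((D.R α k).rank : ℂ) := by
      rw [← trace_eq_rank_of_idempotent (D.isBlock α).mul_self, ← D.sum_R, Matrix.trace_sum]
      exact Finset.sum_congr rfl fun k _ =>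
        trace_eq_rank_of_idempotent ((D.cyclic α).mul_self k)
    exact_mod_cast h2
  rw [h1]
  calc D.m α = ∑ k : Fin (D.m α), 1 := by simp
    _ ≤ _ := by
      refine Finset.sum_le_sum fun k _ => ?_
      rw [Nat.one_le_iff_ne_zero]
      intro h
      apply (D.cyclic α).ne_zero k
      apply eq_zero_of_trace_conjTranspose_mul
      rw [(D.cyclic α).conjTranspose_eq, (D.cyclic α).mul_self,
        trace_eq_rank_of_idempotent ((D.cyclic α).mul_self k), h, Nat.cast_zero]

/-- The trace of ω is a convex combination of the block dimensions r, and r ≤ √(r³/m) because the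
period m is at most r. -/
lemma size_le_iSup : D.size ≤ ⨆ α, √(((D.blk α).rank : ℝ) ^ 3 / D.m α) := by
  calc D.size ≤ ∑ α, D.q α * ⨆ α, √(((D.blk α).rank : ℝ) ^ 3 / D.m α) := by
        refine Finset.sum_le_sum fun α _ => mul_le_mul_of_nonneg_left ?_ (D.q_pos α).le
        refine le_trans ?_ (le_ciSup (f := fun α => √(((D.blk α).rank : ℝ) ^ 3 / D.m α))
          (Set.finite_range _).bddAbove α)
        refine Real.le_sqrt_of_sq_le ?_
        have h1 : (0 : ℝ) < D.m α := by exact_mod_cast (D.cyclic α).pos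
        have h2 : (D.m α : ℝ) ≤ (D.blk α).rank := by exact_mod_cast D.period_le_rank α
        rw [le_div_iff₀ h1]
        calc ((D.blk α).rank : ℝ) ^ 2 * D.m α ≤ ((D.blk α).rank : ℝ) ^ 2 * (D.blk α).rank := by
              gcongr
          _ = _ := by ring
    _ = _ := by rw [← Finset.sum_mul, sum_q, one_mul]

lemma iSup_le : ⨆ α, √(((D.blk α).rank : ℝ) ^ 3 / D.m α) ≤ d * √d := by
  refine Real.iSup_le (fun α => ?_) (by positivity)
  have h1 : (1 : ℝ) ≤ D.m α := by exact_mod_cast (D.cyclic α).pos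
  have h2 : ((D.blk α).rank : ℝ) ≤ d := by
    have := (D.blk α).rank_le_card_width
    rw [Fintype.card_fin] at this
    exact_mod_cast this
  refine Real.sqrt_le_iff.mpr ⟨by positivity, ?_⟩
  rw [mul_pow, Real.sq_sqrt (Nat.cast_nonneg d)]
  calc ((D.blk α).rank : ℝ) ^ 3 / D.m α ≤ ((D.blk α).rank : ℝ) ^ 3 :=
        div_le_self (by positivity) h1
    _ ≤ (d : ℝ) ^ 3 := by gcongr
    _ = _ := by ring

lemma traceNorm_dilation_le {b : ℕ} (a c : ℕ) {u : Matrix (D.Idx b) (Fin b → Fin ds) ℂ}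
    (hF : ∑ y, (D.dilation u y)ᴴ * D.dilation u y = 1)
    (hu : ∑ y, ((Φ.word y - D.dilation u y) * Φ.σ * (Φ.word y - D.dilation u y)ᴴ).trace.re ≤
        (‖Φ.E ^ b - Φ.Eper ^ b‖ * D.size) ^ 2 / (2 * Φ.sigmaMin)) :
    traceNorm (Φ.rho a b c - Φ.blockState (D.dilation u)) ≤
      (⨆ α, √(((D.blk α).rank : ℝ) ^ 3 / D.m α)) * √(2 / Φ.sigmaMin) *
        ‖Φ.E ^ b - Φ.Eper ^ b‖ := by
  have hσ := Φ.sigmaMin_pos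
  refine (Φ.traceNorm_rho_sub_le a c hF).trans ?_
  have h1 : 2 * √((‖Φ.E ^ b - Φ.Eper ^ b‖ * D.size) ^ 2 / (2 * Φ.sigmaMin)) =
      ‖Φ.E ^ b - Φ.Eper ^ b‖ * D.size * √(2 / Φ.sigmaMin) := by
    have h2 : (‖Φ.E ^ b - Φ.Eper ^ b‖ * D.size) ^ 2 / (2 * Φ.sigmaMin) =
        (‖Φ.E ^ b - Φ.Eper ^ b‖ * D.size / 2) ^ 2 * (2 / Φ.sigmaMin) := by
      field_simp
    have h3 := D.size_nonneg
    rw [h2, Real.sqrt_mul (by positivity), Real.sqrt_sq (by positivity)]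
    ring
  calc _ ≤ 2 * √((‖Φ.E ^ b - Φ.Eper ^ b‖ * D.size) ^ 2 / (2 * Φ.sigmaMin)) := by gcongr
    _ = D.size * √(2 / Φ.sigmaMin) * ‖Φ.E ^ b - Φ.Eper ^ b‖ := by rw [h1]; ring
    _ ≤ _ := by
      gcongr
      exact D.size_le_iSup

end NormalForm
end IUMPS
/-! ### Entropy of block matrices -/

section Entropy

variable {n : Type} [Fintype n] [DecidableEq n]

lemma entropy_eq {A : Matrix n n ℂ} (hA : A.IsHermitian) :
    entropy A = ∑ i, Real.negMulLog (hA.eigenvalues i) := by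
  rw [entropy, dif_pos hA]

lemma isHermitian_mul_diagonal_mul {I : Type} [Fintype I] [DecidableEq I] (W : Matrix n I ℂ)
    (D : I → ℝ) : (W * Matrix.diagonal (fun i => (D i : ℂ)) * Wᴴ).IsHermitian := by
  refine Matrix.isHermitian_mul_mul_conjTranspose W ?_
  rw [Matrix.IsHermitian, Matrix.diagonal_conjTranspose]
  congr 1
  ext i
  simp

/-- The characteristic polynomials of W D W† and D differ only by powers of X, and the eigenvalue
zero contributes nothing to the entropy. -/
lemma entropy_of_isometry {I : Type} [Fintype I] [DecidableEq I] {W : Matrix n I ℂ}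
    (hW : Wᴴ * W = 1) (D : I → ℝ) :
    entropy (W * Matrix.diagonal (fun i => (D i : ℂ)) * Wᴴ) = ∑ i, Real.negMulLog (D i) := by
  have hH := isHermitian_mul_diagonal_mul W D
  rw [entropy_eq hH]
  have h1 := Matrix.charpoly_mul_comm' (W * Matrix.diagonal (fun i => (D i : ℂ))) Wᴴ
  rw [← Matrix.mul_assoc, hW, Matrix.one_mul, Matrix.charpoly_diagonal] at h1
  have h2 := congrArg Polynomial.roots h1
  rw [Polynomial.roots_mul (mul_ne_zero (pow_ne_zero _ Polynomial.X_ne_zero)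
      (Matrix.charpoly_monic _).ne_zero), Polynomial.roots_mul (mul_ne_zero
      (pow_ne_zero _ Polynomial.X_ne_zero) (Finset.prod_ne_zero_iff.mpr fun i _ =>
        Polynomial.X_sub_C_ne_zero _)), Polynomial.roots_X_pow, Polynomial.roots_X_pow,
      hH.roots_charpoly_eq_eigenvalues, Polynomial.roots_prod _ _
        (Finset.prod_ne_zero_iff.mpr fun i _ => Polynomial.X_sub_C_ne_zero _)] at h2
  simp only [Polynomial.roots_X_sub_C, Multiset.bind_singleton] at h2
  have h3 := congrArg (fun s => (Multiset.map (fun z : ℂ => Real.negMulLog z.re) s).sum) h2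
  simpa [Multiset.map_nsmul, Multiset.sum_nsmul] using h3

lemma entropy_directSum {K : Type} [Fintype K] [DecidableEq K] {A : K → Type} [∀ κ, Fintype (A κ)]
    [∀ κ, DecidableEq (A κ)] {V : ∀ κ, Matrix n (A κ) ℂ} (hV : ∀ κ, (V κ)ᴴ * V κ = 1)
    (hV' : ∀ κ κ', κ ≠ κ' → (V κ)ᴴ * V κ' = 0) (D : ∀ κ, A κ → ℝ) :
    entropy (∑ κ, V κ * Matrix.diagonal (fun a => (D κ a : ℂ)) * (V κ)ᴴ) =
      ∑ κ, ∑ a, Real.negMulLog (D κ a) := by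
  let W : Matrix n (Σ κ, A κ) ℂ := fun a p => V p.1 a p.2
  have hW : Wᴴ * W = 1 := by
    ext ⟨κ, a⟩ ⟨κ', a'⟩
    change ((V κ)ᴴ * V κ') a a' = _
    by_cases h : κ = κ'
    · subst h
      rw [hV]
      simp [Matrix.one_apply]
    · rw [hV' κ κ' h, Matrix.one_apply_ne]
      · rfl
      · exact fun h' => h (congrArg Sigma.fst h')
  have h1 : ∑ κ, V κ * Matrix.diagonal (fun a => (D κ a : ℂ)) * (V κ)ᴴ =
      W * Matrix.diagonal (fun p : Σ κ, A κ => (D p.1 p.2 : ℂ)) * Wᴴ := by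
    ext a b
    rw [Matrix.sum_apply, Matrix.mul_apply, Fintype.sum_sigma]
    refine Finset.sum_congr rfl fun κ _ => ?_
    rw [Matrix.mul_apply]
    refine Finset.sum_congr rfl fun c _ => ?_
    rw [Matrix.mul_diagonal, Matrix.mul_diagonal]
    rfl
  rw [h1, entropy_of_isometry hW, Fintype.sum_sigma]

lemma trace_re_eq_sum_eigenvalues {A : Matrix n n ℂ} (hA : A.IsHermitian) :
    A.trace.re = ∑ i, hA.eigenvalues i := by
  rw [hA.trace_eq_sum_eigenvalues, Complex.re_sum]
  rfl

/-- -xy log(xy) splits additively with weights y and x; the summands need not be normalised, which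
is why their traces appear. -/
lemma entropy_sum_kronecker {K : Type} [Fintype K] [DecidableEq K] {A B : K → Type}
    [∀ κ, Fintype (A κ)] [∀ κ, DecidableEq (A κ)] [∀ κ, Fintype (B κ)] [∀ κ, DecidableEq (B κ)]
    {V : ∀ κ, Matrix n (A κ × B κ) ℂ} (hV : ∀ κ, (V κ)ᴴ * V κ = 1)
    (hV' : ∀ κ κ', κ ≠ κ' → (V κ)ᴴ * V κ' = 0) {L : ∀ κ, Matrix (A κ) (A κ) ℂ}
    {R : ∀ κ, Matrix (B κ) (B κ) ℂ} (hL : ∀ κ, (L κ).IsHermitian) (hR : ∀ κ, (R κ).IsHermitian) :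
    entropy (∑ κ, V κ * (L κ ⊗ₖ R κ) * (V κ)ᴴ) =
      ∑ κ, (entropy (L κ) * (R κ).trace.re + (L κ).trace.re * entropy (R κ)) := by
  choose U hU _ hLU using fun κ => exists_diagonalization (hL κ)
  choose W hW _ hRW using fun κ => exists_diagonalization (hR κ)
  have hUW : ∀ κ, (U κ ⊗ₖ W κ)ᴴ * (U κ ⊗ₖ W κ) = 1 := by
    intro κ
    rw [Matrix.conjTranspose_kronecker, ← Matrix.mul_kronecker_mul, hU, hW,
      Matrix.one_kronecker_one]
  have h1 : ∀ κ, V κ * (L κ ⊗ₖ R κ) * (V κ)ᴴ = (V κ * (U κ ⊗ₖ W κ)) *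
      Matrix.diagonal (fun p : A κ × B κ =>
        (((hL κ).eigenvalues p.1 * (hR κ).eigenvalues p.2 : ℝ) : ℂ)) *
      (V κ * (U κ ⊗ₖ W κ))ᴴ := by
    intro κ
    have h2 : Matrix.diagonal (fun p : A κ × B κ =>
        (((hL κ).eigenvalues p.1 * (hR κ).eigenvalues p.2 : ℝ) : ℂ)) =
          Matrix.diagonal (fun a => ((hL κ).eigenvalues a : ℂ)) ⊗ₖ
            Matrix.diagonal (fun a => ((hR κ).eigenvalues a : ℂ)) := by
      rw [Matrix.diagonal_kronecker_diagonal]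
      simp
    have h3 : L κ ⊗ₖ R κ = (U κ ⊗ₖ W κ) * (Matrix.diagonal (fun a => ((hL κ).eigenvalues a : ℂ)) ⊗ₖ
        Matrix.diagonal (fun a => ((hR κ).eigenvalues a : ℂ))) * (U κ ⊗ₖ W κ)ᴴ := by
      rw [Matrix.conjTranspose_kronecker, ← Matrix.mul_kronecker_mul, ← Matrix.mul_kronecker_mul]
      exact congrArg₂ _ (hLU κ) (hRW κ)
    rw [h2, h3, Matrix.conjTranspose_mul]
    simp only [Matrix.mul_assoc]
  rw [Finset.sum_congr rfl fun κ _ => h1 κ,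
    entropy_directSum (V := fun κ => V κ * (U κ ⊗ₖ W κ)) _ _
      (fun κ p => (hL κ).eigenvalues p.1 * (hR κ).eigenvalues p.2)]
  · refine Finset.sum_congr rfl fun κ _ => ?_
    rw [entropy_eq (hL κ), entropy_eq (hR κ), trace_re_eq_sum_eigenvalues (hL κ),
      trace_re_eq_sum_eigenvalues (hR κ), Fintype.sum_prod_type, Finset.sum_mul_sum,
      Finset.sum_mul_sum, ← Finset.sum_add_distrib]
    refine Finset.sum_congr rfl fun i _ => ?_
    rw [← Finset.sum_add_distrib]
    refine Finset.sum_congr rfl fun j _ => ?_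
    rw [Real.negMulLog_mul]
    ring
  · intro κ
    rw [Matrix.conjTranspose_mul, Matrix.mul_assoc, ← Matrix.mul_assoc (V κ)ᴴ, hV, Matrix.one_mul,
      hUW]
  · intro κ κ' h
    rw [Matrix.conjTranspose_mul, Matrix.mul_assoc, ← Matrix.mul_assoc (V κ)ᴴ, hV' κ κ' h,
      Matrix.zero_mul, Matrix.mul_zero]

end Entropy

-- Vanishing conditional mutual information of a direct sum of products

section Markov

variable {n X Y Z K : Type} [Fintype n] [DecidableEq n] [Fintype X] [DecidableEq X] [Fintype Y]
  [DecidableEq Y] [Fintype Z] [DecidableEq Z] [Fintype K] [DecidableEq K] {I J : K → Type}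
  [∀ κ, Fintype (I κ)] [∀ κ, DecidableEq (I κ)] [∀ κ, Fintype (J κ)] [∀ κ, DecidableEq (J κ)]

/-- The embedding of one summand into a chain of three systems, the middle one being transformed
by an isometry. -/
def middleEmbedding (e : n ≃ X × Y × Z) {κ : K} (u : Matrix (I κ × J κ) Y ℂ) :
    Matrix n ((X × I κ) × (J κ × Z)) ℂ :=
  fun a p => if (e a).1 = p.1.1 ∧ (e a).2.2 = p.2.2 then u (p.1.2, p.2.1) (e a).2.1 else 0

lemma middleEmbedding_conjTranspose_mul (e : n ≃ X × Y × Z) {κ κ' : K}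
    (u : Matrix (I κ × J κ) Y ℂ) (v : Matrix (I κ' × J κ') Y ℂ)
    (p : (X × I κ) × (J κ × Z)) (q : (X × I κ') × (J κ' × Z)) :
    ((middleEmbedding e u)ᴴ * middleEmbedding e v) p q =
      if p.1.1 = q.1.1 ∧ p.2.2 = q.2.2 then (v * uᴴ) (q.1.2, q.2.1) (p.1.2, p.2.1) else 0 := by
  rw [Matrix.mul_apply, ← e.symm.sum_comp, Fintype.sum_prod_type, Finset.sum_eq_single p.1.1,
    Fintype.sum_prod_type]
  · simp only [Matrix.conjTranspose_apply, middleEmbedding, Equiv.apply_symm_apply, true_and]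
    split_ifs with h
    · rw [Matrix.mul_apply]
      refine Finset.sum_congr rfl fun y _ => ?_
      rw [Finset.sum_eq_single p.2.2]
      · rw [if_pos rfl, if_pos h, mul_comm]
        rfl
      · intro z _ hz
        rw [if_neg hz, star_zero, zero_mul]
      · simp
    · refine Finset.sum_eq_zero fun y _ => Finset.sum_eq_zero fun z _ => ?_
      by_cases hz : z = p.2.2
      · subst hz
        rw [if_neg h, mul_zero]
      · rw [if_neg hz, star_zero, zero_mul]
  · intro x _ hx
    refine Finset.sum_eq_zero fun y _ => ?_
    rw [Matrix.conjTranspose_apply, middleEmbedding, Equiv.apply_symm_apply, if_neg fun h => hx h.1,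
      star_zero, zero_mul]
  · simp

lemma middleEmbedding_mul_mul (e : n ≃ X × Y × Z) {κ : K} (u : Matrix (I κ × J κ) Y ℂ)
    (L : Matrix (X × I κ) (X × I κ) ℂ) (R : Matrix (J κ × Z) (J κ × Z) ℂ) (a b : n) :
    (middleEmbedding e u * (L ⊗ₖ R) * (middleEmbedding e u)ᴴ) a b =
      ∑ p : I κ × J κ, ∑ q : I κ × J κ, u p (e a).2.1 * star (u q (e b).2.1) *
        (L ((e a).1, p.1) ((e b).1, q.1) * R (p.2, (e a).2.2) (q.2, (e b).2.2)) := by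
  have hsum : ∀ (f : (X × I κ) × (J κ × Z) → ℂ) (x : X) (z : Z),
      (∑ p, if x = p.1.1 ∧ z = p.2.2 then f p else 0) =
        ∑ p : I κ × J κ, f ((x, p.1), (p.2, z)) := by
    intro f x z
    rw [Fintype.sum_prod_type, Fintype.sum_prod_type, Finset.sum_eq_single x, Fintype.sum_prod_type]
    · refine Finset.sum_congr rfl fun i _ => ?_
      rw [Fintype.sum_prod_type]
      refine Finset.sum_congr rfl fun j _ => ?_
      rw [Finset.sum_eq_single z]
      · simp
      · intro z' _ h
        rw [if_neg fun h' => h h'.2.symm]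
      · simp
    · intro x' _ h
      refine Finset.sum_eq_zero fun i _ => Finset.sum_eq_zero fun p _ => ?_
      rw [if_neg fun h' => h h'.1.symm]
    · simp
  rw [Matrix.mul_assoc, Matrix.mul_apply]
  simp only [middleEmbedding, ite_mul, zero_mul]
  rw [hsum]
  refine Finset.sum_congr rfl fun p _ => ?_
  rw [Matrix.mul_apply, Finset.mul_sum]
  have h1 : ∀ q : (X × I κ) × (J κ × Z), u (p.1, p.2) (e a).2.1 *
      ((L ⊗ₖ R) (((e a).1, p.1), (p.2, (e a).2.2)) q * (middleEmbedding e u)ᴴ q b) =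
        if (e b).1 = q.1.1 ∧ (e b).2.2 = q.2.2 then u p (e a).2.1 *
          star (u (q.1.2, q.2.1) (e b).2.1) * (L ((e a).1, p.1) q.1 * R (p.2, (e a).2.2) q.2)
        else 0 := by
    intro q
    rw [Matrix.conjTranspose_apply, middleEmbedding, Matrix.kroneckerMap_apply]
    split_ifs
    · ring
    · simp
  exact (Finset.sum_congr rfl fun q _ => h1 q).trans (hsum _ _ _)

/-- The entropy of a direct sum of products whose middle parts are transformed isometrically. -/
lemma entropy_middle (e : n ≃ X × Y × Z) {u : ∀ κ, Matrix (I κ × J κ) Y ℂ}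
    (hu : ∀ κ, u κ * (u κ)ᴴ = 1) (hu' : ∀ κ κ', κ ≠ κ' → u κ * (u κ')ᴴ = 0)
    {L : ∀ κ, Matrix (X × I κ) (X × I κ) ℂ} {R : ∀ κ, Matrix (J κ × Z) (J κ × Z) ℂ}
    (hL : ∀ κ, (L κ).IsHermitian) (hR : ∀ κ, (R κ).IsHermitian) {ρ : Matrix n n ℂ}
    (hρ : ∀ a b, ρ a b = ∑ κ, ∑ p : I κ × J κ, ∑ q : I κ × J κ,
      u κ p (e a).2.1 * star (u κ q (e b).2.1) *
        (L κ ((e a).1, p.1) ((e b).1, q.1) * R κ (p.2, (e a).2.2) (q.2, (e b).2.2))) :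
    entropy ρ = ∑ κ, (entropy (L κ) * (R κ).trace.re + (L κ).trace.re * entropy (R κ)) := by
  have h1 : ρ = ∑ κ, middleEmbedding e (u κ) * (L κ ⊗ₖ R κ) * (middleEmbedding e (u κ))ᴴ := by
    ext a b
    rw [hρ, Matrix.sum_apply]
    exact Finset.sum_congr rfl fun κ _ => (middleEmbedding_mul_mul e _ _ _ a b).symm
  rw [h1]
  refine entropy_sum_kronecker ?_ ?_ hL hR
  · intro κ
    ext p q
    obtain ⟨⟨x, i⟩, j, z⟩ := p
    obtain ⟨⟨x', i'⟩, j', z'⟩ := q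
    rw [middleEmbedding_conjTranspose_mul, hu]
    simp only [Matrix.one_apply, Prod.mk.injEq]
    split_ifs <;> grind
  · intro κ κ' h
    ext p q
    rw [middleEmbedding_conjTranspose_mul, hu' _ _ h.symm]
    simp

/-- Tracing out A affects only the left factors and tracing out C only the right ones, and neither
changes their traces. In the alternating sum each left and each right entropy therefore occurs twice
with opposite signs. -/
lemma qcmi_eq_zero {u : ∀ κ, Matrix (I κ × J κ) Y ℂ}
    (hu : ∀ κ, u κ * (u κ)ᴴ = 1) (hu' : ∀ κ κ', κ ≠ κ' → u κ * (u κ')ᴴ = 0)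
    {L : ∀ κ, Matrix (X × I κ) (X × I κ) ℂ} {R : ∀ κ, Matrix (J κ × Z) (J κ × Z) ℂ}
    (hL : ∀ κ, (L κ).IsHermitian) (hR : ∀ κ, (R κ).IsHermitian)
    {ρ : Matrix (X × Y × Z) (X × Y × Z) ℂ}
    (hρ : ∀ a b, ρ a b = ∑ κ, ∑ p : I κ × J κ, ∑ q : I κ × J κ,
      u κ p a.2.1 * star (u κ q b.2.1) *
        (L κ (a.1, p.1) (b.1, q.1) * R κ (p.2, a.2.2) (q.2, b.2.2))) :
    qcmi ρ = 0 := by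
  -- `Unit` stands for a region that has been traced out, so `entropy_middle` covers all four
  -- reduced states.
  let L' : ∀ κ, Matrix (Unit × I κ) (Unit × I κ) ℂ := fun κ p q => ∑ x, L κ (x, p.2) (x, q.2)
  let R' : ∀ κ, Matrix (J κ × Unit) (J κ × Unit) ℂ := fun κ p q => ∑ z, R κ (p.1, z) (q.1, z)
  have hL' : ∀ κ, (L' κ).IsHermitian := by
    intro κ
    ext p q
    rw [Matrix.conjTranspose_apply]
    simp only [L', star_sum]
    exact Finset.sum_congr rfl fun x _ => (hL κ).apply _ _
  have hR' : ∀ κ, (R' κ).IsHermitian := by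
    intro κ
    ext p q
    rw [Matrix.conjTranspose_apply]
    simp only [R', star_sum]
    exact Finset.sum_congr rfl fun x _ => (hR κ).apply _ _
  have htL : ∀ κ, (L' κ).trace = (L κ).trace := by
    intro κ
    rw [Matrix.trace, Matrix.trace, Fintype.sum_prod_type, Fintype.sum_prod_type_right]
    simp [L']
    rfl
  have htR : ∀ κ, (R' κ).trace = (R κ).trace := by
    intro κ
    rw [Matrix.trace, Matrix.trace, Fintype.sum_prod_type, Fintype.sum_prod_type]
    simp [R']
    rfl
  have h1 := entropy_middle (Equiv.refl _) hu hu' hL hR hρ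
  have h2 := entropy_middle (n := X × Y) (Z := Unit)
    ⟨fun a => (a.1, a.2, ()), fun a => (a.1, a.2.1), fun _ => rfl, fun _ => rfl⟩ hu hu' hL hR'
    (ρ := margAB ρ) (by
      intro a b
      simp only [margAB, hρ, R', Equiv.coe_fn_mk, Finset.mul_sum]
      rw [Finset.sum_comm]
      refine Finset.sum_congr rfl fun κ _ => ?_
      rw [Finset.sum_comm]
      exact Finset.sum_congr rfl fun p _ => Finset.sum_comm)
  have h3 := entropy_middle (n := Y × Z) (X := Unit)
    ⟨fun a => ((), a.1, a.2), fun a => a.2, fun _ => rfl, fun _ => rfl⟩ hu hu' hL' hR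
    (ρ := margBC ρ) (by
      intro a b
      simp only [margBC, hρ, L', Equiv.coe_fn_mk, Finset.mul_sum, Finset.sum_mul]
      rw [Finset.sum_comm]
      refine Finset.sum_congr rfl fun κ _ => ?_
      rw [Finset.sum_comm]
      exact Finset.sum_congr rfl fun p _ => Finset.sum_comm)
  have h4 := entropy_middle (n := Y) (X := Unit) (Z := Unit)
    ⟨fun a => ((), a, ()), fun a => a.2.1, fun _ => rfl, fun _ => rfl⟩ hu hu' hL' hR'
    (ρ := margB ρ) (by
      intro a b
      simp only [margB, hρ, L', R', Equiv.coe_fn_mk, Finset.sum_mul_sum]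
      simp only [Finset.mul_sum]
      rw [Finset.sum_congr rfl fun x _ => Finset.sum_comm, Finset.sum_comm]
      refine Finset.sum_congr rfl fun κ _ => ?_
      rw [Finset.sum_congr rfl fun x _ => Finset.sum_comm, Finset.sum_comm]
      refine Finset.sum_congr rfl fun p _ => ?_
      rw [Finset.sum_congr rfl fun x _ => Finset.sum_comm, Finset.sum_comm])
  simp_rw [htL, htR] at h2 h3 h4
  rw [qcmi, h1, h2, h3, h4]
  simp_rw [Finset.sum_add_distrib]
  ring

end Markov
/-! ### The dilated state is a quantum Markov chain -/

namespace IUMPS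

variable {d ds : ℕ} {Φ : IUMPS d ds}

/-- The phase gained on passing one word is undone by the adjoint of the other word of equal length.
-/
lemma mul_conjTranspose_word_mul_word {ν : ℂ} (hν : ‖ν‖ = 1) {Z : Matrix (Fin d) (Fin d) ℂ}
    (hZ : Z ∈ Φ.twisted ν) {n : ℕ} (x y : Fin n → Fin ds) :
    Z * ((Φ.word x)ᴴ * Φ.word y) = (Φ.word x)ᴴ * Φ.word y * Z := by
  have h1 := congrArg Matrix.conjTranspose (mul_word (conjTranspose_mem_twisted hν hZ) x)
  rw [Matrix.conjTranspose_smul, Matrix.conjTranspose_mul, Matrix.conjTranspose_mul,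
    Matrix.conjTranspose_conjTranspose, star_pow, star_star] at h1
  have h2 := congrArg (star ν ^ n • ·) h1
  simp only [smul_smul] at h2
  rw [← mul_pow, conj_mul_of_norm hν, one_pow, one_smul] at h2
  rw [← Matrix.mul_assoc, ← h2, Matrix.smul_mul, Matrix.mul_assoc, mul_word hZ, Matrix.mul_smul,
    smul_smul, ← mul_pow, conj_mul_of_norm hν, one_pow, one_smul, Matrix.mul_assoc]

lemma IsCyclicFamily.mul_conjTranspose_word_mul_word {p : Matrix (Fin d) (Fin d) ℂ} {m : ℕ}
    {R : ℕ → Matrix (Fin d) (Fin d) ℂ} (h : Φ.IsCyclicFamily p m R) (k : ℕ) {n : ℕ}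
    (x y : Fin n → Fin ds) :
    R k * ((Φ.word x)ᴴ * Φ.word y) = (Φ.word x)ᴴ * Φ.word y * R k := by
  have h1 := congrArg Matrix.conjTranspose (h.word_mul x k)
  rw [Matrix.conjTranspose_mul, Matrix.conjTranspose_mul, h.conjTranspose_eq,
    h.conjTranspose_eq] at h1
  rw [← Matrix.mul_assoc, h1, Matrix.mul_assoc, ← h.word_mul, Matrix.mul_assoc]

namespace NormalForm

variable (D : Φ.NormalForm)

lemma mul_lift_of_commute {Y : Matrix (Fin d) (Fin d) ℂ}
    (hY : ∀ ν : ℂ, ‖ν‖ = 1 → ∀ Z ∈ Φ.twisted ν, Z * Y = Y * Z) (b : ℕ) (β : Fin D.N)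
    (h : Matrix (Fin d) (Fin d) ℂ) : Y * D.lift b β h = D.lift b β (Y * h) := by
  rw [lift_apply, lift_apply, Finset.mul_sum]
  refine Finset.sum_congr rfl fun α _ => ?_
  rw [Matrix.mul_smul, ← Matrix.mul_assoc, ← Matrix.mul_assoc, ← hY _ (D.norm_ph α) _ (D.T_mem α),
    Matrix.mul_assoc (D.T α)]

lemma conjTranspose_unit_mul_mul_unit (b : ℕ) (β : Fin D.N) (k k' : ℕ)
    (Y : Matrix (Fin d) (Fin d) ℂ) (i : Fin (D.n β k)) (i' : Fin (D.n β k'))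
    (j : Fin (D.n β (k + b))) (j' : Fin (D.n β (k' + b))) :
    (D.unit b β k i j)ᴴ * D.blk β * (Y * D.unit b β k' i' j') =
      ((D.B β (k + b))ᴴ * Y * D.B β (k' + b)) j j' •
        (D.B β k * Matrix.single i i' (1 : ℂ) * (D.B β k')ᴴ) := by
  have h1 : (D.unit b β k i j)ᴴ * D.blk β * (Y * D.unit b β k' i' j') =
      D.B β k * (Matrix.single i j (1 : ℂ) * ((D.B β (k + b))ᴴ * D.blk β * Y * D.B β (k' + b)) *
        Matrix.single j' i' (1 : ℂ)) * (D.B β k')ᴴ := by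
    simp only [unit, Matrix.conjTranspose_mul, Matrix.conjTranspose_conjTranspose,
      Matrix.conjTranspose_single, star_one, Matrix.mul_assoc]
  rw [h1, D.conjTranspose_B_mul_blk, Matrix.single_mul_mul_single, one_mul, mul_one,
    ← Matrix.smul_mul, ← Matrix.mul_smul, Matrix.smul_single, smul_eq_mul, mul_one]

lemma conjTranspose_B_mul_mul_B {α : Fin D.N} {k l : ℕ} (h : k % D.m α ≠ l % D.m α)
    {Y : Matrix (Fin d) (Fin d) ℂ} (hY : D.R α k * Y = Y * D.R α k) :
    (D.B α k)ᴴ * Y * D.B α l = 0 := by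
  rw [← D.conjTranspose_B_mul_R, ← D.R_mul_B α l, Matrix.mul_assoc _ _ Y, hY]
  calc _ = (D.B α k)ᴴ * Y * (D.R α k * D.R α l) * D.B α l := by simp only [Matrix.mul_assoc]
    _ = 0 := by rw [(D.cyclic α).mul_eq_zero h]; simp

/-- Y commutes with the intertwiners and with the cyclic projections, so it cannot connect outputs
belonging to different labels. Applied to the words on C, this removes coherences between labels. -/
lemma kraus_conjTranspose_mul_mul_ne {b : ℕ} {Y : Matrix (Fin d) (Fin d) ℂ}
    (hY : ∀ ν : ℂ, ‖ν‖ = 1 → ∀ Z ∈ Φ.twisted ν, Z * Y = Y * Z)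
    (hR : ∀ α k, D.R α k * Y = Y * D.R α k) {g g' : D.Idx b} (h : g.1 ≠ g'.1) :
    (D.kraus b g)ᴴ * (Y * D.kraus b g') = 0 := by
  obtain ⟨⟨β, k⟩, i, j⟩ := g
  obtain ⟨⟨β', k'⟩, i', j'⟩ := g'
  simp only [kraus]
  rw [Matrix.conjTranspose_smul, Matrix.smul_mul, Matrix.mul_smul, Matrix.mul_smul,
    D.mul_lift_of_commute hY]
  by_cases hβ : β = β'
  · subst hβ
    rw [lift_conjTranspose_mul_lift]
    have h1 : ((k : ℕ) + b) % D.m β ≠ (k' + b) % D.m β := by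
      intro h2
      have h3 : (k : ℕ) ≡ k' [MOD D.m β] := Nat.ModEq.add_right_cancel' b h2
      exact h (congrArg (Sigma.mk β) (Fin.ext (Nat.ModEq.eq_of_lt_of_lt h3 k.2 k'.2)))
    simp_rw [conjTranspose_unit_mul_mul_unit, D.conjTranspose_B_mul_mul_B h1 (hR _ _)]
    simp
  · rw [D.lift_conjTranspose_mul_lift_ne b fun h' => hβ (Subtype.ext h')]
    simp

/-- Y meets only the output indices, with the same coefficient on every equivalent block, while the
input indices survive as a matrix unit. This separation is the origin of the product of a left and a
right factor. -/
lemma kraus_conjTranspose_mul_mul {b : ℕ} {Y : Matrix (Fin d) (Fin d) ℂ}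
    (hY : ∀ ν : ℂ, ‖ν‖ = 1 → ∀ Z ∈ Φ.twisted ν, Z * Y = Y * Z) (κ : D.Lab)
    (p q : Fin (D.n κ.1 κ.2) × Fin (D.n κ.1 (κ.2 + b))) :
    (D.kraus b ⟨κ, q⟩)ᴴ * (Y * D.kraus b ⟨κ, p⟩) =
      ((D.coef b κ.1 κ.2 q.2 * D.coef b κ.1 κ.2 p.2 : ℂ) *
        ((D.B κ.1 (κ.2 + b))ᴴ * Y * D.B κ.1 (κ.2 + b)) q.2 p.2) • ∑ α ∈ D.cls κ.1,
          D.T α * (D.B κ.1 κ.2 * Matrix.single q.1 p.1 (1 : ℂ) * (D.B κ.1 κ.2)ᴴ) * (D.T α)ᴴ := by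
  simp only [kraus]
  rw [Matrix.conjTranspose_smul, Matrix.smul_mul, Matrix.mul_smul, Matrix.mul_smul,
    D.mul_lift_of_commute hY, lift_conjTranspose_mul_lift, Complex.star_def, Complex.conj_ofReal,
    smul_smul]
  simp_rw [conjTranspose_unit_mul_mul_unit, Matrix.mul_smul, Matrix.smul_mul]
  rw [← Finset.smul_sum, smul_smul]

/-- The left tensor factors of the dilated state. -/
def leftFactor (a : ℕ) (κ : D.Lab) : Matrix ((Fin a → Fin ds) × Fin (D.n κ.1 κ.2))
    ((Fin a → Fin ds) × Fin (D.n κ.1 κ.2)) ℂ :=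
  fun p q => ∑ α ∈ D.cls κ.1, ((D.B κ.1 κ.2)ᴴ * ((D.T α)ᴴ *
    (Φ.word p.1 * Φ.σ * (Φ.word q.1)ᴴ) * D.T α) * D.B κ.1 κ.2) p.2 q.2

lemma leftFactor_isHermitian (a : ℕ) (κ : D.Lab) : (D.leftFactor a κ).IsHermitian := by
  ext p q
  rw [Matrix.conjTranspose_apply]
  simp only [leftFactor, star_sum]
  refine Finset.sum_congr rfl fun α _ => ?_
  rw [← Matrix.conjTranspose_apply]
  simp only [Matrix.conjTranspose_mul, Matrix.conjTranspose_conjTranspose, Matrix.mul_assoc,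
    Φ.posDef.isHermitian.eq]

/-- The right tensor factors of the dilated state. -/
def rightFactor (b c : ℕ) (κ : D.Lab) : Matrix (Fin (D.n κ.1 (κ.2 + b)) × (Fin c → Fin ds))
    (Fin (D.n κ.1 (κ.2 + b)) × (Fin c → Fin ds)) ℂ :=
  fun p q => (D.coef b κ.1 κ.2 q.1 * D.coef b κ.1 κ.2 p.1 : ℂ) *
    ((D.B κ.1 (κ.2 + b))ᴴ * ((Φ.word q.2)ᴴ * Φ.word p.2) * D.B κ.1 (κ.2 + b)) q.1 p.1

lemma rightFactor_isHermitian (b c : ℕ) (κ : D.Lab) :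
    (D.rightFactor b c κ).IsHermitian := by
  ext p q
  rw [Matrix.conjTranspose_apply]
  simp only [rightFactor, star_mul, Complex.star_def, Complex.conj_ofReal]
  rw [← Complex.star_def, ← Matrix.conjTranspose_apply]
  simp only [Matrix.conjTranspose_mul, Matrix.conjTranspose_conjTranspose, Matrix.mul_assoc]
  ring

lemma trace_kraus_words {a b c : ℕ} (g g' : D.Idx b) (x x' : Fin a → Fin ds)
    (z z' : Fin c → Fin ds) :
    ((Φ.word z * D.kraus b g * Φ.word x) * Φ.σ * (Φ.word z' * D.kraus b g' * Φ.word x')ᴴ).trace =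
      ((D.kraus b g')ᴴ * ((Φ.word z')ᴴ * Φ.word z * D.kraus b g) *
        (Φ.word x * Φ.σ * (Φ.word x')ᴴ)).trace := by
  have h1 : (Φ.word z * D.kraus b g * Φ.word x) * Φ.σ *
      (Φ.word z' * D.kraus b g' * Φ.word x')ᴴ = (Φ.word z * D.kraus b g *
        (Φ.word x * Φ.σ * (Φ.word x')ᴴ)) * ((D.kraus b g')ᴴ * (Φ.word z')ᴴ) := by
    simp only [Matrix.conjTranspose_mul, Matrix.mul_assoc]
  rw [h1, Matrix.trace_mul_comm]
  simp only [Matrix.mul_assoc]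

lemma trace_mul_single_mul {m n : Type*} [Fintype m] [Fintype n] [DecidableEq m] [DecidableEq n]
    (B : Matrix m n ℂ) (i i' : n) (S X : Matrix m m ℂ) :
    (S * (B * Matrix.single i' i (1 : ℂ) * Bᴴ) * Sᴴ * X).trace =
      (Bᴴ * (Sᴴ * X * S) * B) i i' := by
  have h1 : (S * (B * Matrix.single i' i (1 : ℂ) * Bᴴ) * Sᴴ * X).trace =
      (Matrix.single i' i (1 : ℂ) * (Bᴴ * (Sᴴ * X * S) * B)).trace := by
    have h2 : S * (B * Matrix.single i' i (1 : ℂ) * Bᴴ) * Sᴴ * X =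
        (S * B) * (Matrix.single i' i (1 : ℂ) * Bᴴ * Sᴴ * X) := by simp only [Matrix.mul_assoc]
    rw [h2, Matrix.trace_mul_comm]
    simp only [Matrix.mul_assoc]
  rw [h1, Matrix.trace_single_mul, one_smul]

lemma trace_kraus_words_eq {a b c : ℕ} (κ : D.Lab)
    (p q : Fin (D.n κ.1 κ.2) × Fin (D.n κ.1 (κ.2 + b))) (x x' : Fin a → Fin ds)
    (z z' : Fin c → Fin ds) :
    ((Φ.word z * D.kraus b ⟨κ, p⟩ * Φ.word x) * Φ.σ *
      (Φ.word z' * D.kraus b ⟨κ, q⟩ * Φ.word x')ᴴ).trace =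
      D.leftFactor a κ (x, p.1) (x', q.1) * D.rightFactor b c κ (p.2, z) (q.2, z') := by
  rw [trace_kraus_words, D.kraus_conjTranspose_mul_mul
    (fun ν hν Z hZ => mul_conjTranspose_word_mul_word hν hZ z' z), Matrix.smul_mul,
    Matrix.trace_smul, Finset.sum_mul, Matrix.trace_sum, smul_eq_mul, mul_comm]
  simp_rw [trace_mul_single_mul]
  rfl

lemma trace_kraus_words_ne {a b c : ℕ} {g g' : D.Idx b} (h : g.1 ≠ g'.1) (x x' : Fin a → Fin ds)
    (z z' : Fin c → Fin ds) :
    ((Φ.word z * D.kraus b g * Φ.word x) * Φ.σ *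
      (Φ.word z' * D.kraus b g' * Φ.word x')ᴴ).trace = 0 := by
  rw [trace_kraus_words, D.kraus_conjTranspose_mul_mul_ne
    (fun ν hν Z hZ => mul_conjTranspose_word_mul_word hν hZ z' z)
    (fun α k => (D.cyclic α).mul_conjTranspose_word_mul_word k z' z) h.symm, Matrix.zero_mul,
    Matrix.trace_zero]

lemma blockState_dilation {a b c : ℕ} (u : Matrix (D.Idx b) (Fin b → Fin ds) ℂ)
    (v w : (Fin a → Fin ds) × (Fin b → Fin ds) × (Fin c → Fin ds)) :
    Φ.blockState (D.dilation u) v w = ∑ g, ∑ g', u g v.2.1 * star (u g' w.2.1) *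
      ((Φ.word v.2.2 * D.kraus b g * Φ.word v.1) * Φ.σ *
        (Φ.word w.2.2 * D.kraus b g' * Φ.word w.1)ᴴ).trace := by
  have h1 : ∀ v : (Fin a → Fin ds) × (Fin b → Fin ds) × (Fin c → Fin ds),
      Φ.word v.2.2 * D.dilation u v.2.1 * Φ.word v.1 =
        ∑ g, u g v.2.1 • (Φ.word v.2.2 * D.kraus b g * Φ.word v.1) := by
    intro v
    rw [dilation, Finset.mul_sum, Finset.sum_mul]
    refine Finset.sum_congr rfl fun g _ => ?_
    rw [Matrix.mul_smul, Matrix.smul_mul]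
  rw [blockState, h1, h1, Matrix.conjTranspose_sum, Finset.sum_mul, Finset.sum_mul,
    Matrix.trace_sum]
  refine Finset.sum_congr rfl fun g _ => ?_
  rw [Finset.mul_sum, Matrix.trace_sum]
  refine Finset.sum_congr rfl fun g' _ => ?_
  rw [Matrix.conjTranspose_smul, Matrix.smul_mul, Matrix.smul_mul, Matrix.mul_smul, smul_smul,
    Matrix.trace_smul, smul_eq_mul]

lemma qcmi_dilation {b : ℕ} (a c : ℕ) {u : Matrix (D.Idx b) (Fin b → Fin ds) ℂ}
    (hu : u * uᴴ = 1) : qcmi (Φ.blockState (a := a) (c := c) (D.dilation u)) = 0 := by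
  have hent : ∀ g g' : D.Idx b, (u * uᴴ) g g' = ∑ y, u g y * star (u g' y) := fun g g' => rfl
  refine qcmi_eq_zero (K := D.Lab) (I := fun κ => Fin (D.n κ.1 κ.2))
    (J := fun κ => Fin (D.n κ.1 (κ.2 + b))) (u := fun κ p y => u ⟨κ, p⟩ y) ?_ ?_
    (D.leftFactor_isHermitian a) (D.rightFactor_isHermitian b c) ?_
  · intro κ
    ext p q
    have h1 := hent ⟨κ, p⟩ ⟨κ, q⟩
    rw [hu] at h1
    refine Eq.trans h1.symm ?_
    simp [Matrix.one_apply]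
  · intro κ κ' h
    ext p q
    have h1 := hent ⟨κ, p⟩ ⟨κ', q⟩
    rw [hu, Matrix.one_apply_ne fun h' => h (congrArg Sigma.fst h')] at h1
    exact h1.symm
  · intro v w
    rw [blockState_dilation, Fintype.sum_sigma]
    refine Finset.sum_congr rfl fun κ _ => Finset.sum_congr rfl fun p _ => ?_
    rw [Fintype.sum_sigma, Finset.sum_eq_single κ]
    · refine Finset.sum_congr rfl fun q _ => ?_
      rw [trace_kraus_words_eq]
    · intro κ' _ h
      refine Finset.sum_eq_zero fun q _ => ?_
      rw [D.trace_kraus_words_ne (fun h' => h h'.symm), mul_zero]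
    · simp

end NormalForm
end IUMPS
/-! ### Powers of Jordan blocks -/

lemma add_pow_smul {A : Type*} [Ring A] [Algebra ℂ A] (N : A) (c : ℂ) (n : ℕ) :
    (c • (1 : A) + N) ^ n = ∑ j ∈ Finset.range (n + 1), ((n.choose j : ℂ) * c ^ (n - j)) • N ^ j := by
  have h : Commute N (c • (1 : A)) := (Commute.one_right N).smul_right c
  rw [add_comm, h.add_pow]
  refine Finset.sum_congr rfl fun j _ => ?_
  rw [smul_pow, one_pow, mul_smul_comm, mul_one, smul_mul_assoc, mul_smul, smul_comm,
    Nat.cast_smul_eq_nsmul ℂ, nsmul_eq_mul, Nat.cast_comm]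

lemma sum_range_choose_smul {V : Type*} [AddCommGroup V] [Module ℂ V] {n k : ℕ} (c : ℂ) {f : ℕ → V}
    (hf : ∀ j, k ≤ j → f j = 0) :
    ∑ j ∈ Finset.range (n + 1), ((n.choose j : ℂ) * c ^ (n - j)) • f j =
      ∑ j ∈ Finset.range k, ((n.choose j : ℂ) * c ^ (n - j)) • f j := by
  rw [Finset.sum_subset (Finset.range_mono (le_max_left (n + 1) k)),
    Finset.sum_subset (Finset.range_mono (le_max_right (n + 1) k))]
  · intro j _ hj
    rw [hf j (by simpa using hj), smul_zero]
  · intro j _ hj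
    rw [Nat.choose_eq_zero_of_lt (by simpa using hj), Nat.cast_zero, zero_mul, zero_smul]

/-- The bound for the entries of the power `n` of a Jordan block of size `k`. -/
def jordanBound (r : ℝ) (k n : ℕ) : ℝ := ∑ j ∈ Finset.range k, (n.choose j : ℝ) * r ^ (n - j)

lemma jordanBound_mono {r : ℝ} (hr : 0 ≤ r) {k l : ℕ} (h : k ≤ l) (n : ℕ) :
    jordanBound r k n ≤ jordanBound r l n :=
  Finset.sum_le_sum_of_subset_of_nonneg (Finset.range_mono h) fun _ _ _ => by positivity

/-- Use (n/K)^j ≤ (n/K)^K for n ≥ K, and that K^j/j! is a term of the series of e^K. -/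
lemma choose_le_exp_div_pow {n j K : ℕ} (hj : j ≤ K) (hn : K ≤ n) :
    (n.choose j : ℝ) ≤ (Real.exp 1 / K) ^ K * n ^ K := by
  rcases Nat.eq_zero_or_pos K with rfl | hK
  · obtain rfl : j = 0 := by omega
    simp
  have hK' : (0 : ℝ) < K := by exact_mod_cast hK
  have h1 : (1 : ℝ) ≤ n / K := by
    rw [le_div_iff₀ hK', one_mul]
    exact_mod_cast hn
  calc (n.choose j : ℝ) ≤ (n : ℝ) ^ j / j.factorial := Nat.choose_le_pow_div j n
    _ = (n / K : ℝ) ^ j * ((K : ℝ) ^ j / j.factorial) := by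
        rw [div_pow]
        field_simp
    _ ≤ (n / K : ℝ) ^ K * Real.exp K := by
        gcongr
        exact Real.pow_div_factorial_le_exp _ hK'.le _
    _ = _ := by
        rw [div_pow, div_pow, ← Real.exp_nat_mul, mul_one]
        ring

lemma jordanBound_le_of_eq {ν : ℝ} (h0 : 0 ≤ ν) (h1 : ν ≤ 1) {n K : ℕ} (hn : K ≤ n) :
    jordanBound ν (K + 1) n ≤ (K + 1) * (Real.exp 1 / K) ^ K * (n ^ K * ν ^ (n - K)) := by
  calc jordanBound ν (K + 1) n
      ≤ ∑ j ∈ Finset.range (K + 1), (Real.exp 1 / K) ^ K * n ^ K * ν ^ (n - K) := by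
        refine Finset.sum_le_sum fun j hj => ?_
        have hj' : j ≤ K := Nat.lt_succ_iff.mp (Finset.mem_range.mp hj)
        exact mul_le_mul (choose_le_exp_div_pow hj' hn) (pow_le_pow_of_le_one h0 h1 (by omega))
          (by positivity) (by positivity)
    _ = _ := by
        rw [Finset.sum_const, Finset.card_range, nsmul_eq_mul]
        push_cast
        ring

open Filter Topology in
lemma eventually_jordanBound_le {r ν c : ℝ} (hr : 0 ≤ r) (hrν : r < ν) (hc : 0 < c) (k : ℕ) :
    ∀ᶠ n : ℕ in atTop, jordanBound r k n ≤ c * ν ^ n := by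
  -- A positive number still below ν, which admits r = 0 and permits division by t.
  set t := max r (ν / 2)
  have hν : 0 < ν := hr.trans_lt hrν
  have ht : 0 < t := lt_max_of_lt_right (by linarith)
  have htν : t < ν := max_lt hrν (by linarith)
  have hq : |t / ν| < 1 := by
    rw [abs_of_pos (by positivity), div_lt_one hν]
    exact htν
  have h1 : Tendsto (fun n : ℕ => ∑ j ∈ Finset.range k, t⁻¹ ^ j * ((n : ℝ) ^ j * (t / ν) ^ n)) atTop
      (𝓝 (∑ j ∈ Finset.range k, t⁻¹ ^ j * 0)) :=
    tendsto_finsetSum _ fun j _ => (tendsto_pow_const_mul_const_pow_of_abs_lt_one j hq).const_mul _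
  simp only [mul_zero, Finset.sum_const_zero] at h1
  filter_upwards [h1.eventually (gt_mem_nhds hc), eventually_ge_atTop k] with n hn hkn
  calc jordanBound r k n ≤ ∑ j ∈ Finset.range k, (n : ℝ) ^ j * t ^ (n - j) := by
        refine Finset.sum_le_sum fun j _ => ?_
        gcongr
        · exact_mod_cast Nat.choose_le_pow n j
        · exact le_max_left _ _
    _ = (∑ j ∈ Finset.range k, t⁻¹ ^ j * ((n : ℝ) ^ j * (t / ν) ^ n)) * ν ^ n := by
        rw [Finset.sum_mul]
        refine Finset.sum_congr rfl fun j hj => ?_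
        have hj' : j ≤ n := (Finset.mem_range.mp hj).le.trans hkn
        rw [div_pow, pow_sub₀ _ ht.ne' hj', inv_pow]
        field_simp
    _ ≤ c * ν ^ n := by gcongr

-- The spectral gap and the rate of convergence to the peripheral channel

namespace IUMPS

variable {d ds : ℕ} (Φ : IUMPS d ds)

lemma endE_pow_apply (n : ℕ) (v : Fin d × Fin d → ℂ) : (Φ.endE ^ n) v = Φ.E ^ n *ᵥ v := by
  rw [endE, ← Matrix.toLin'_pow, Matrix.toLin'_apply]

lemma norm_eigenvalue_le_one {μ : ℂ} (h : Φ.endE.HasEigenvalue μ) : ‖μ‖ ≤ 1 := by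
  obtain ⟨v, hv⟩ := h.exists_hasEigenvector
  obtain ⟨p, hp⟩ := Function.ne_iff.mp hv.2
  have hp' : 0 < ‖v p‖ := norm_pos_iff.mpr hp
  by_contra hμ
  rw [not_le] at hμ
  obtain ⟨n, hn⟩ := pow_unbounded_of_one_lt ((∑ q, ‖v q‖) / ‖v p‖) hμ
  rw [div_lt_iff₀ hp'] at hn
  have h1 : (Φ.E ^ n *ᵥ v) p = μ ^ n * v p := by
    rw [← endE_pow_apply, hv.pow_apply]
    rfl
  have h2 : ‖(Φ.E ^ n *ᵥ v) p‖ ≤ ∑ q, ‖v q‖ := by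
    rw [Matrix.mulVec, dotProduct]
    refine (norm_sum_le _ _).trans (Finset.sum_le_sum fun q _ => ?_)
    rw [norm_mul]
    exact mul_le_of_le_one_left (norm_nonneg _) (Φ.norm_pow_apply_le n p q)
  rw [h1, norm_mul, norm_pow] at h2
  linarith

lemma finite_eigenvalues : {μ : ℂ | Φ.endE.HasEigenvalue μ}.Finite :=
  Module.End.finite_hasEigenvalue _

lemma finite_gap : {r | ∃ ν : ℂ, Φ.endE.HasEigenvalue ν ∧ ‖ν‖ < 1 ∧ r = ‖ν‖}.Finite := by
  refine (Φ.finite_eigenvalues.image fun ν => ‖ν‖).subset ?_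
  rintro r ⟨ν, h, _, rfl⟩
  exact ⟨ν, h, rfl⟩

lemma norm_le_nuGap {μ : ℂ} (h : Φ.endE.HasEigenvalue μ) (h1 : ‖μ‖ < 1) : ‖μ‖ ≤ Φ.nuGap :=
  le_csSup Φ.finite_gap.bddAbove ⟨μ, h, h1, rfl⟩

lemma nuGap_nonneg : 0 ≤ Φ.nuGap := by
  refine Real.sSup_nonneg ?_
  rintro r ⟨ν, _, _, rfl⟩
  exact norm_nonneg ν

lemma nuGap_lt_one : Φ.nuGap < 1 := by
  rcases Set.eq_empty_or_nonempty
    {r | ∃ ν : ℂ, Φ.endE.HasEigenvalue ν ∧ ‖ν‖ < 1 ∧ r = ‖ν‖} with h | h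
  · rw [nuGap, h, Real.sSup_empty]
    exact zero_lt_one
  · obtain ⟨ν, _, h1, h2⟩ := h.csSup_mem Φ.finite_gap
    rw [nuGap, h2]
    exact h1

lemma index_le {μ : ℂ} (h : Φ.endE.HasEigenvalue μ) (h1 : ‖μ‖ = Φ.nuGap) :
    Φ.endE.maxGenEigenspaceIndex μ ≤ Φ.K + 1 := by
  have hfin : {k | ∃ ν : ℂ, Φ.endE.HasEigenvalue ν ∧ ‖ν‖ = Φ.nuGap ∧
      k = Φ.endE.maxGenEigenspaceIndex ν - 1}.Finite := by
    refine (Φ.finite_eigenvalues.image fun ν => Φ.endE.maxGenEigenspaceIndex ν - 1).subset ?_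
    rintro k ⟨ν, h, _, rfl⟩
    exact ⟨ν, h, rfl⟩
  have h2 : Φ.endE.maxGenEigenspaceIndex μ - 1 ≤ Φ.K := le_csSup hfin.bddAbove ⟨μ, h, h1, rfl⟩
  omega

lemma gap_const_pos : 0 < (Φ.K + 1) * (Real.exp 1 / Φ.K) ^ Φ.K := by
  rcases Nat.eq_zero_or_pos Φ.K with h | h
  · rw [h]; simp
  · have : (0 : ℝ) < Φ.K := by exact_mod_cast h
    positivity

open Filter in
/-- All Jordan blocks inside the unit disk are eventually dominated by those at the gap. -/
lemma exists_jordanBound_le : ∃ n₁ : ℕ, ∀ n, n₁ ≤ n → ∀ μ : ℂ, Φ.endE.HasEigenvalue μ → ‖μ‖ < 1 →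
    jordanBound ‖μ‖ (Φ.endE.maxGenEigenspaceIndex μ) n ≤
      (Φ.K + 1) * (Real.exp 1 / Φ.K) ^ Φ.K * (n ^ Φ.K * Φ.nuGap ^ (n - Φ.K)) := by
  rw [← eventually_atTop]
  have h0 : ∀ μ ∈ {μ : ℂ | Φ.endE.HasEigenvalue μ}, ∀ᶠ n : ℕ in atTop, ‖μ‖ < 1 →
      jordanBound ‖μ‖ (Φ.endE.maxGenEigenspaceIndex μ) n ≤
        (Φ.K + 1) * (Real.exp 1 / Φ.K) ^ Φ.K * (n ^ Φ.K * Φ.nuGap ^ (n - Φ.K)) := by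
    intro μ hμ
    by_cases h1 : ‖μ‖ < 1
    swap
    · exact Eventually.of_forall fun n h => absurd h h1
    rcases (Φ.norm_le_nuGap hμ h1).eq_or_lt with h2 | h2
    · filter_upwards [eventually_ge_atTop Φ.K] with n hn _
      refine (jordanBound_mono (norm_nonneg μ) (Φ.index_le hμ h2) n).trans ?_
      rw [h2]
      exact jordanBound_le_of_eq Φ.nuGap_nonneg Φ.nuGap_lt_one.le hn
    · filter_upwards [eventually_jordanBound_le (norm_nonneg μ) h2 Φ.gap_const_pos
        (Φ.endE.maxGenEigenspaceIndex μ), eventually_ge_atTop 1] with n hn h1n _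
      refine hn.trans (mul_le_mul_of_nonneg_left ?_ Φ.gap_const_pos.le)
      have h3 : (1 : ℝ) ≤ (n : ℝ) ^ Φ.K := one_le_pow₀ (by exact_mod_cast h1n)
      have h4 : Φ.nuGap ^ n ≤ Φ.nuGap ^ (n - Φ.K) :=
        pow_le_pow_of_le_one Φ.nuGap_nonneg Φ.nuGap_lt_one.le (Nat.sub_le _ _)
      exact h4.trans (le_mul_of_one_le_left (pow_nonneg Φ.nuGap_nonneg _) h3)
  filter_upwards [(eventually_all_finite Φ.finite_eigenvalues).mpr h0] with n hn μ hμ h1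
  exact hn μ hμ h1

lemma maxGenEigenspace_le_nonperipheral {μ : ℂ} (h : ‖μ‖ ≠ 1) :
    Φ.endE.maxGenEigenspace μ ≤ nonperipheralSpace Φ.endE :=
  le_iSup₂_of_le (f := fun (ν : ℂ) (_ : ν ∈ {ν : ℂ | ‖ν‖ ≠ 1}) => Φ.endE.maxGenEigenspace ν) μ h
    le_rfl

lemma maxGenEigenspace_le_peripheral {μ : ℂ} (h : ‖μ‖ = 1) :
    Φ.endE.maxGenEigenspace μ ≤ peripheralSpace Φ.endE := by
  rw [peripheralSpace_eq]
  exact le_iSup₂_of_le (f := fun (ν : ℂ) (_ : ν ∈ {ν : ℂ | ‖ν‖ = 1}) =>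
    Φ.endE.maxGenEigenspace ν) μ h le_rfl

lemma sub_smul_pow_index {μ : ℂ} {v : Fin d × Fin d → ℂ} (hv : v ∈ Φ.endE.maxGenEigenspace μ) :
    ((Φ.endE - μ • 1) ^ Φ.endE.maxGenEigenspaceIndex μ) v = 0 := by
  rwa [Module.End.maxGenEigenspace_eq, Module.End.mem_genEigenspace_nat, LinearMap.mem_ker] at hv

lemma hasEigenvalue_of_mem {μ : ℂ} {v : Fin d × Fin d → ℂ}
    (hv : v ∈ Φ.endE.maxGenEigenspace μ) (h0 : v ≠ 0) : Φ.endE.HasEigenvalue μ := by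
  have h1 : Φ.endE.HasUnifEigenvalue μ ⊤ := fun h => h0 (by
    have h2 : v ∈ (⊥ : Submodule ℂ (Fin d × Fin d → ℂ)) := h ▸ hv
    simpa using h2)
  exact h1.lt zero_lt_one

lemma endE_pow_apply_eq {μ : ℂ} {v : Fin d × Fin d → ℂ} {k : ℕ}
    (hv : ((Φ.endE - μ • 1) ^ k) v = 0) (n : ℕ) : (Φ.endE ^ n) v =
      ∑ j ∈ Finset.range k, ((n.choose j : ℂ) * μ ^ (n - j)) • ((Φ.endE - μ • 1) ^ j) v := by
  have h1 : Φ.endE = μ • 1 + (Φ.endE - μ • 1) := by abel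
  conv_lhs => rw [h1, add_pow_smul]
  rw [LinearMap.sum_apply]
  simp_rw [LinearMap.smul_apply]
  refine sum_range_choose_smul μ fun j hj => ?_
  obtain ⟨i, rfl⟩ := Nat.exists_eq_add_of_le hj
  rw [add_comm, pow_add, Module.End.mul_apply, hv, map_zero]

lemma pow_sub_mulVec {n : ℕ} (hn : n ≠ 0) (v : Fin d × Fin d → ℂ) :
    (Φ.E ^ n - Φ.Eper ^ n) *ᵥ v = Φ.E ^ n *ᵥ (v - Φ.P *ᵥ v) := by
  rw [Φ.Eper_pow hn, Matrix.sub_mulVec, Matrix.mulVec_sub, Matrix.mulVec_mulVec]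

/-- Up to constants it suffices to treat generalized eigenvectors. On peripheral ones the two powers
agree exactly; on the others Ẽ^n vanishes and E^n is expanded binomially around its eigenvalue. -/
lemma exists_bound_mulVec (v : Fin d × Fin d → ℂ) : ∃ C : ℝ, 0 ≤ C ∧ ∃ n₁ : ℕ, ∀ n, n₁ ≤ n →
    ∀ p, ‖((Φ.E ^ n - Φ.Eper ^ n) *ᵥ v) p‖ ≤ C * (n ^ Φ.K * Φ.nuGap ^ (n - Φ.K)) := by
  obtain ⟨n₁, hn₁⟩ := Φ.exists_jordanBound_le
  have hmem : v ∈ ⨆ μ : ℂ, Φ.endE.maxGenEigenspace μ := by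
    rw [Module.End.iSup_maxGenEigenspace_eq_top]
    trivial
  induction hmem using Submodule.iSup_induction' with
  | mem μ v hv =>
    by_cases h1 : ‖μ‖ = 1
    · refine ⟨0, le_rfl, 1, fun n hn p => ?_⟩
      rw [Φ.pow_sub_mulVec (by omega),
        Φ.P_mulVec_of_mem (Φ.maxGenEigenspace_le_peripheral h1 hv), sub_self, Matrix.mulVec_zero]
      simp
    by_cases h0 : v = 0
    · refine ⟨0, le_rfl, 0, fun n hn p => ?_⟩
      rw [h0, Matrix.mulVec_zero]
      simp
    have hμ := Φ.hasEigenvalue_of_mem hv h0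
    have hμ1 : ‖μ‖ < 1 := lt_of_le_of_ne (Φ.norm_eigenvalue_le_one hμ) h1
    set k := Φ.endE.maxGenEigenspaceIndex μ with hk
    set V := ∑ j ∈ Finset.range k, ∑ p, ‖((Φ.endE - μ • 1) ^ j) v p‖ with hV
    have hV0 : 0 ≤ V := Finset.sum_nonneg fun _ _ => Finset.sum_nonneg fun _ _ => norm_nonneg _
    refine ⟨V * ((Φ.K + 1) * (Real.exp 1 / Φ.K) ^ Φ.K), mul_nonneg hV0 Φ.gap_const_pos.le,
      max n₁ 1, fun n hn p => ?_⟩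
    rw [Φ.pow_sub_mulVec (by have := le_max_right n₁ 1; omega),
      Φ.P_mulVec_of_mem_non (Φ.maxGenEigenspace_le_nonperipheral h1 hv), sub_zero,
      ← endE_pow_apply, Φ.endE_pow_apply_eq (Φ.sub_smul_pow_index hv), mul_assoc, Finset.sum_apply]
    calc _ ≤ ∑ j ∈ Finset.range k, (n.choose j : ℝ) * ‖μ‖ ^ (n - j) * V := by
          refine (norm_sum_le _ _).trans (Finset.sum_le_sum fun j hj => ?_)
          rw [Pi.smul_apply, smul_eq_mul, norm_mul, norm_mul, norm_pow, Complex.norm_natCast]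
          gcongr
          refine le_trans ?_ (Finset.single_le_sum
            (f := fun j => ∑ p, ‖((Φ.endE - μ • 1) ^ j) v p‖)
            (fun _ _ => Finset.sum_nonneg fun _ _ => norm_nonneg _) hj)
          exact Finset.single_le_sum (f := fun p => ‖((Φ.endE - μ • 1) ^ j) v p‖)
            (fun _ _ => norm_nonneg _) (Finset.mem_univ p)
      _ = V * jordanBound ‖μ‖ k n := by rw [← Finset.sum_mul, mul_comm, jordanBound]
      _ ≤ _ := by
          gcongr
          exact hn₁ n ((le_max_left _ _).trans hn) μ hμ hμ1
  | zero =>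
    refine ⟨0, le_rfl, 0, fun n hn p => ?_⟩
    rw [Matrix.mulVec_zero]
    simp
  | add v w _ _ ih1 ih2 =>
    obtain ⟨C, hC, n₂, h2⟩ := ih1
    obtain ⟨C', hC', n₃, h3⟩ := ih2
    refine ⟨C + C', add_nonneg hC hC', max n₂ n₃, fun n hn p => ?_⟩
    rw [Matrix.mulVec_add, add_mul]
    exact (norm_add_le _ _).trans (add_le_add (h2 n ((le_max_left _ _).trans hn) p)
      (h3 n ((le_max_right _ _).trans hn) p))

end IUMPS

lemma norm_le_sqrt_frobSq {m n : Type*} [Fintype m] [DecidableEq m] [Fintype n] [DecidableEq n]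
    (A : Matrix m n ℂ) : ‖A‖ ≤ √(frobSq A) := by
  rw [Matrix.l2_opNorm_def]
  refine ContinuousLinearMap.opNorm_le_bound _ (Real.sqrt_nonneg _) fun x => ?_
  refine (sq_le_sq₀ (by positivity) (by positivity)).mp ?_
  rw [mul_pow, Real.sq_sqrt (frobSq_nonneg A), EuclideanSpace.norm_sq_eq, EuclideanSpace.norm_sq_eq]
  exact sum_norm_sq_mulVec_le A x.ofLp

namespace IUMPS

variable {d ds : ℕ} (Φ : IUMPS d ds)

/-- The peripheral channel approximates the channel exponentially well. -/
lemma exists_bound_pow_sub : ∃ C : ℝ, 0 ≤ C ∧ ∃ n₁ : ℕ, ∀ n, n₁ ≤ n →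
    ‖Φ.E ^ n - Φ.Eper ^ n‖ ≤ C * (n ^ Φ.K * Φ.nuGap ^ (n - Φ.K)) := by
  choose C hC n₁ hn₁ using fun q : Fin d × Fin d => Φ.exists_bound_mulVec (Pi.single q 1)
  refine ⟨√(∑ _p : Fin d × Fin d, ∑ q, C q ^ 2), Real.sqrt_nonneg _,
    Finset.univ.sup n₁, fun n hn => ?_⟩
  have ht : (0 : ℝ) ≤ n ^ Φ.K * Φ.nuGap ^ (n - Φ.K) :=
    mul_nonneg (by positivity) (pow_nonneg Φ.nuGap_nonneg _)
  refine (norm_le_sqrt_frobSq _).trans (Real.sqrt_le_iff.mpr ⟨by positivity, ?_⟩)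
  rw [mul_pow, Real.sq_sqrt (by positivity), frobSq, Finset.sum_mul]
  refine Finset.sum_le_sum fun p _ => ?_
  rw [Finset.sum_mul]
  refine Finset.sum_le_sum fun q _ => ?_
  rw [← mul_pow]
  have h1 := hn₁ q n ((Finset.le_sup (Finset.mem_univ q)).trans hn) p
  rw [Matrix.mulVec_single_one] at h1
  exact pow_le_pow_left₀ (norm_nonneg _) h1 2

open Filter Topology in
lemma tendsto_gap : Tendsto (fun n : ℕ => (n : ℝ) ^ Φ.K * Φ.nuGap ^ (n - Φ.K)) atTop (𝓝 0) := by
  -- The shift by K removes the truncated subtraction, and then (n + K)^K ≤ (K + 1)^K n^K for n ≥ 1.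
  rw [← tendsto_add_atTop_iff_nat Φ.K]
  have h0 := Φ.nuGap_nonneg
  have h1 : |Φ.nuGap| < 1 := by rw [abs_of_nonneg h0]; exact Φ.nuGap_lt_one
  have h2 := (tendsto_pow_const_mul_const_pow_of_abs_lt_one Φ.K h1).const_mul
    (((Φ.K : ℝ) + 1) ^ Φ.K)
  rw [mul_zero] at h2
  refine squeeze_zero' (Eventually.of_forall fun n => by positivity) ?_ h2
  filter_upwards [eventually_ge_atTop 1] with n hn
  rw [Nat.add_sub_cancel, ← mul_assoc, ← mul_pow]
  gcongr
  push_cast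
  have h3 : (1 : ℝ) ≤ n := by exact_mod_cast hn
  have h4 : (0 : ℝ) ≤ Φ.K := Nat.cast_nonneg _
  nlinarith

end IUMPS
/-! ### Jordan decompositions -/

/-- The nilpotent block is a partial shift: N†N is diagonal with entries zero and one. -/
lemma norm_jordanBlock_zero_le (k : ℕ) : ‖jordanBlock k 0‖ ≤ 1 := by
  have h1 : (jordanBlock k 0)ᴴ * jordanBlock k 0 =
      Matrix.diagonal fun i : Fin k => if (i : ℕ) = 0 then (0 : ℂ) else 1 := by
    ext i j
    have hent : ∀ l i : Fin k, jordanBlock k 0 l i = if (l : ℕ) + 1 = i then 1 else 0 := by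
      intro l i
      rw [jordanBlock]
      split_ifs with h h' <;> first | rfl | (subst h; omega)
    rw [Matrix.mul_apply, Matrix.diagonal_apply]
    simp only [Matrix.conjTranspose_apply, hent]
    split_ifs with h h0
    · refine Finset.sum_eq_zero fun l _ => ?_
      rw [if_neg (by omega)]
      simp
    · subst h
      rw [Finset.sum_eq_single ⟨(i : ℕ) - 1, by omega⟩]
      · rw [if_pos (by simp only; omega)]
        simp
      · intro l _ hl
        rw [if_neg fun h' => hl (Fin.ext (by simp only; omega))]
        simp
      · simp
    · refine Finset.sum_eq_zero fun l _ => ?_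
      by_cases hi : (l : ℕ) + 1 = i
      · rw [if_neg fun h' => h (Fin.ext (hi.symm.trans h')), mul_zero]
      · rw [if_neg hi, star_zero, zero_mul]
  have h2 := Matrix.l2_opNorm_conjTranspose_mul_self (jordanBlock k 0)
  have h3 : ‖(jordanBlock k 0)ᴴ * jordanBlock k 0‖ ≤ 1 := by
    rw [h1, Matrix.l2_opNorm_diagonal, pi_norm_le_iff_of_nonneg zero_le_one]
    intro i
    split_ifs <;> simp
  rw [h2] at h3
  nlinarith [norm_nonneg (jordanBlock k 0)]

lemma jordanBlock_eq (k : ℕ) (μ : ℂ) : jordanBlock k μ = μ • 1 + jordanBlock k 0 := by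
  ext i j
  rw [Matrix.add_apply, Matrix.smul_apply, Matrix.one_apply, jordanBlock, jordanBlock]
  split_ifs <;> simp

lemma jordanBlock_zero_pow_apply {k : ℕ} (j : ℕ) (a b : Fin k) (h : (b : ℕ) < a + j) :
    (jordanBlock k 0 ^ j) a b = 0 := by
  induction j generalizing b with
  | zero => rw [pow_zero, Matrix.one_apply_ne]; rintro rfl; omega
  | succ j ih =>
    rw [pow_succ, Matrix.mul_apply]
    refine Finset.sum_eq_zero fun l _ => ?_
    by_cases hl : (l : ℕ) + 1 = b
    · rw [ih l (by omega), zero_mul]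
    · rw [jordanBlock, if_neg hl]
      simp

lemma norm_jordanBlock_pow_le {k : ℕ} (hk : k ≠ 0) (μ : ℂ) (n : ℕ) :
    ‖jordanBlock k μ ^ n‖ ≤ jordanBound ‖μ‖ k n := by
  have : Nonempty (Fin k) := ⟨⟨0, Nat.pos_of_ne_zero hk⟩⟩
  have h0 : ∀ j, k ≤ j → jordanBlock k 0 ^ j = 0 := by
    intro j hj
    ext a b
    exact jordanBlock_zero_pow_apply j a b (by omega)
  rw [jordanBlock_eq, add_pow_smul, sum_range_choose_smul μ h0]
  refine (norm_sum_le _ _).trans (Finset.sum_le_sum fun j _ => ?_)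
  rw [norm_smul, norm_mul, norm_pow, Complex.norm_natCast]
  refine mul_le_of_le_one_right (by positivity) ?_
  rcases Nat.eq_zero_or_pos j with rfl | hj
  · rw [pow_zero]
    exact norm_le_one_of_isometry (by simp)
  · exact (norm_pow_le' _ hj).trans (pow_le_one₀ (norm_nonneg _) (norm_jordanBlock_zero_le k))

lemma norm_blockDiagonal'_le {N : ℕ} {size : Fin N → ℕ}
    (M : ∀ b, Matrix (Fin (size b)) (Fin (size b)) ℂ) {C : ℝ} (hC : 0 ≤ C) (h : ∀ b, ‖M b‖ ≤ C) :
    ‖Matrix.blockDiagonal' M‖ ≤ C := by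
  rw [Matrix.l2_opNorm_def]
  refine ContinuousLinearMap.opNorm_le_bound _ hC fun x => ?_
  refine (sq_le_sq₀ (by positivity) (by positivity)).mp ?_
  rw [mul_pow, EuclideanSpace.norm_sq_eq, EuclideanSpace.norm_sq_eq, Fintype.sum_sigma,
    Fintype.sum_sigma, Finset.mul_sum]
  refine Finset.sum_le_sum fun b _ => ?_
  have h1 := pow_le_pow_left₀ (norm_nonneg _) ((M b).l2_opNorm_mulVec
    (WithLp.toLp 2 fun i => x.ofLp ⟨b, i⟩)) 2
  rw [mul_pow, EuclideanSpace.norm_sq_eq, EuclideanSpace.norm_sq_eq] at h1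
  have h2 : ∀ i, (Matrix.blockDiagonal' M *ᵥ x.ofLp) ⟨b, i⟩ =
      (M b *ᵥ fun i => x.ofLp ⟨b, i⟩) i := by
    intro i
    rw [Matrix.mulVec, dotProduct, Fintype.sum_sigma, Finset.sum_eq_single b]
    · simp only [Matrix.blockDiagonal'_apply_eq]
      rfl
    · intro b' _ hb
      refine Finset.sum_eq_zero fun j _ => ?_
      rw [Matrix.blockDiagonal'_apply_ne _ _ _ hb.symm, zero_mul]
    · simp
  calc _ = ∑ i, ‖(M b *ᵥ fun i => x.ofLp ⟨b, i⟩) i‖ ^ 2 := by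
        refine Finset.sum_congr rfl fun i _ => ?_
        rw [← h2]
        rfl
    _ ≤ ‖M b‖ ^ 2 * ∑ i, ‖x.ofLp ⟨b, i⟩‖ ^ 2 := h1
    _ ≤ _ := by
        gcongr
        exact h b

namespace IUMPS

variable {d ds : ℕ} (Φ : IUMPS d ds) (J : JordanDecomposition Φ.E)

lemma E_mul_S : Φ.E * J.S =
    J.S * Matrix.blockDiagonal' (fun b => jordanBlock (J.size b) (J.eig b)) := by
  refine (congrArg (· * J.S) J.decomp).trans ?_
  rw [Matrix.mul_assoc, J.inv_mul, Matrix.mul_one]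

lemma E_mul_S_apply (p : Fin d × Fin d) (b : Fin J.blocks) (i : Fin (J.size b)) :
    (Φ.E * J.S) p ⟨b, i⟩ = ∑ j, J.S p ⟨b, j⟩ * jordanBlock (J.size b) (J.eig b) j i := by
  rw [E_mul_S, Matrix.mul_apply, Fintype.sum_sigma, Finset.sum_eq_single b]
  · simp only [Matrix.blockDiagonal'_apply_eq]
  · intro b' _ hb
    refine Finset.sum_eq_zero fun j _ => ?_
    rw [Matrix.blockDiagonal'_apply_ne _ _ _ hb, mul_zero]
  · simp

/-- A vector of a Jordan chain. -/
def chain (b : Fin J.blocks) (i : Fin (J.size b)) : Fin d × Fin d → ℂ := fun p => J.S p ⟨b, i⟩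

lemma sub_smul_chain (b : Fin J.blocks) (i : Fin (J.size b)) :
    (Φ.endE - J.eig b • 1) (chain Φ J b i) =
      if h : (i : ℕ) = 0 then 0 else chain Φ J b ⟨i - 1, by omega⟩ := by
  ext p
  have h1 : Φ.endE (chain Φ J b i) p = (Φ.E * J.S) p ⟨b, i⟩ := by
    rw [endE, Matrix.toLin'_apply]
    rfl
  have hent : ∀ j : Fin (J.size b), J.S p ⟨b, j⟩ * jordanBlock (J.size b) (J.eig b) j i =
      (if j = i then J.eig b * J.S p ⟨b, i⟩ else 0) +
        if (j : ℕ) + 1 = i then J.S p ⟨b, j⟩ else 0 := by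
    intro j
    rw [jordanBlock]
    by_cases hj : j = i
    · subst hj
      rw [if_pos rfl, if_pos rfl, if_neg (by omega)]
      ring
    · rw [if_neg hj, if_neg hj]
      split_ifs <;> simp
  rw [LinearMap.sub_apply, LinearMap.smul_apply, Pi.sub_apply, h1, E_mul_S_apply,
    Finset.sum_congr rfl fun j _ => hent j, Finset.sum_add_distrib, Finset.sum_ite_eq',
    if_pos (Finset.mem_univ i)]
  have h2 : (J.eig b • (1 : Module.End ℂ (Fin d × Fin d → ℂ)) (chain Φ J b i)) p =
      J.eig b * J.S p ⟨b, i⟩ := rfl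
  rw [h2, add_sub_cancel_left]
  split_ifs with h
  · refine Finset.sum_eq_zero fun j _ => ?_
    rw [if_neg (by omega)]
  · rw [Finset.sum_eq_single ⟨(i : ℕ) - 1, by omega⟩]
    · rw [if_pos (by simp only; omega)]
      rfl
    · intro j _ hj
      rw [if_neg fun h' => hj (Fin.ext (by simp only; omega))]
    · simp

lemma sub_smul_pow_chain (b : Fin J.blocks) (m : ℕ) (i : Fin (J.size b)) (hm : m ≤ i) :
    ((Φ.endE - J.eig b • 1) ^ m) (chain Φ J b i) = chain Φ J b ⟨i - m, by omega⟩ := by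
  induction m with
  | zero => simp
  | succ m ih =>
    rw [pow_succ', Module.End.mul_apply, ih (by omega), sub_smul_chain, dif_neg (by simp only; omega)]
    congr 1

lemma chain_ne_zero (b : Fin J.blocks) (i : Fin (J.size b)) : chain Φ J b i ≠ 0 := by
  intro h
  have h1 := congrFun (congrFun J.inv_mul ⟨b, i⟩) ⟨b, i⟩
  rw [Matrix.mul_apply, Matrix.one_apply_eq] at h1
  have h2 : ∀ p, J.S p ⟨b, i⟩ = 0 := fun p => congrFun h p
  simp [h2] at h1

lemma chain_mem (b : Fin J.blocks) (i : Fin (J.size b)) :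
    chain Φ J b i ∈ Φ.endE.maxGenEigenspace (J.eig b) := by
  rw [Module.End.mem_maxGenEigenspace]
  refine ⟨i + 1, ?_⟩
  rw [pow_succ', Module.End.mul_apply, sub_smul_pow_chain Φ J b i i le_rfl, sub_smul_chain,
    dif_pos (by simp)]

/-- In a longer block, E - ν raised to the index would carry a chain vector to the first vector of
the chain, which is nonzero. -/
lemma size_le_index (b : Fin J.blocks) :
    J.size b ≤ Φ.endE.maxGenEigenspaceIndex (J.eig b) := by
  by_contra h
  rw [not_le] at h
  have h1 := Φ.sub_smul_pow_index (chain_mem Φ J b ⟨Φ.endE.maxGenEigenspaceIndex (J.eig b), h⟩)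
  rw [sub_smul_pow_chain Φ J b _ ⟨_, h⟩ le_rfl] at h1
  exact chain_ne_zero Φ J b _ h1

/-- The columns of S are generalized eigenvectors, so P is diagonal in any Jordan basis. -/
lemma P_mul_S : Φ.P * J.S =
    J.S * (Matrix.diagonal (fun q : Σ b, Fin (J.size b) => if ‖J.eig q.1‖ = 1 then (1 : ℂ) else 0) :
      Matrix (Σ b, Fin (J.size b)) (Σ b, Fin (J.size b)) ℂ) := by
  ext p ⟨b, i⟩
  rw [Matrix.mul_diagonal]
  have h1 : (Φ.P * J.S) p ⟨b, i⟩ = (Φ.P *ᵥ chain Φ J b i) p := rfl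
  rw [h1]
  split_ifs with h
  · rw [Φ.P_mulVec_of_mem (Φ.maxGenEigenspace_le_peripheral h (chain_mem Φ J b i)), mul_one]
    rfl
  · rw [Φ.P_mulVec_of_mem_non (Φ.maxGenEigenspace_le_nonperipheral h (chain_mem Φ J b i)), mul_zero]
    rfl

lemma pow_sub_eq {n : ℕ} (hn : n ≠ 0) : Φ.E ^ n - Φ.Eper ^ n = J.S * Matrix.blockDiagonal'
    (fun b => if ‖J.eig b‖ = 1 then 0 else jordanBlock (J.size b) (J.eig b) ^ n) * J.Sinv := by
  set D := Matrix.blockDiagonal' fun b => jordanBlock (J.size b) (J.eig b) with hD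
  set Δ : Matrix (Σ b, Fin (J.size b)) (Σ b, Fin (J.size b)) ℂ :=
    Matrix.diagonal fun q => if ‖J.eig q.1‖ = 1 then (1 : ℂ) else 0 with hΔ
  have h1 : ∀ n, Φ.E ^ n * J.S = J.S * D ^ n := by
    intro n
    induction n with
    | zero => simp
    | succ n ih =>
      rw [pow_succ, Matrix.mul_assoc, Φ.E_mul_S J, ← hD, ← Matrix.mul_assoc, ih, Matrix.mul_assoc, ← pow_succ]
  have h3 : D ^ n - D ^ n * Δ = Matrix.blockDiagonal'
      (fun b => if ‖J.eig b‖ = 1 then 0 else jordanBlock (J.size b) (J.eig b) ^ n) := by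
    rw [hD, ← Matrix.blockDiagonal'_pow]
    ext ⟨b, i⟩ ⟨b', j⟩
    rw [Matrix.sub_apply, hΔ, Matrix.mul_diagonal]
    by_cases hb : b = b'
    · subst hb
      rw [Matrix.blockDiagonal'_apply_eq, Matrix.blockDiagonal'_apply_eq]
      by_cases h : ‖J.eig b‖ = 1
      · rw [if_pos h, if_pos h, mul_one, sub_self]
        rfl
      · rw [if_neg h, if_neg h, mul_zero, sub_zero]
        rfl
    · rw [Matrix.blockDiagonal'_apply_ne _ _ _ hb, Matrix.blockDiagonal'_apply_ne _ _ _ hb]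
      simp
  rw [Φ.Eper_pow hn, ← h3]
  calc Φ.E ^ n - Φ.E ^ n * Φ.P = (Φ.E ^ n - Φ.E ^ n * Φ.P) * (J.S * J.Sinv) := by
        rw [J.mul_inv, Matrix.mul_one]
    _ = (Φ.E ^ n * J.S - Φ.E ^ n * (Φ.P * J.S)) * J.Sinv := by
        simp only [Matrix.sub_mul, Matrix.mul_assoc]
    _ = _ := by
        rw [Φ.P_mul_S J, ← hΔ, ← Matrix.mul_assoc (Φ.E ^ n) J.S Δ, h1, Matrix.mul_sub, Matrix.mul_assoc J.S]

/-- Convergence to the peripheral channel in terms of a Jordan decomposition. -/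
lemma exists_bound_jordan : ∃ n₁ : ℕ, ∀ n, n₁ ≤ n → ∀ J : JordanDecomposition Φ.E,
    ‖Φ.E ^ n - Φ.Eper ^ n‖ ≤ Φ.c₂ J * (n ^ Φ.K * Φ.nuGap ^ (n - Φ.K)) := by
  obtain ⟨n₁, hn₁⟩ := Φ.exists_jordanBound_le
  -- The threshold comes from the finitely many eigenvalues of E alone, so it serves all Jordan
  -- decompositions at once.
  refine ⟨max n₁ 1, fun n hn J => ?_⟩
  have hn0 : n ≠ 0 := by have := le_max_right n₁ 1; omega
  set t : ℝ := n ^ Φ.K * Φ.nuGap ^ (n - Φ.K) with ht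
  have ht0 : 0 ≤ t := mul_nonneg (by positivity) (pow_nonneg Φ.nuGap_nonneg _)
  have hct : 0 ≤ (Φ.K + 1) * (Real.exp 1 / Φ.K) ^ Φ.K * t := mul_nonneg Φ.gap_const_pos.le ht0
  have hblock : ‖Matrix.blockDiagonal' (fun b => if ‖J.eig b‖ = 1 then 0
      else jordanBlock (J.size b) (J.eig b) ^ n)‖ ≤
        (Φ.K + 1) * (Real.exp 1 / Φ.K) ^ Φ.K * t := by
    refine norm_blockDiagonal'_le _ hct fun b => ?_
    split_ifs with h
    · rw [norm_zero]
      exact hct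
    -- Empty blocks are allowed, and their label need not be an eigenvalue of E.
    · by_cases hs : J.size b = 0
      · have : IsEmpty (Fin (J.size b)) := by rw [hs]; infer_instance
        rw [Subsingleton.elim (jordanBlock (J.size b) (J.eig b) ^ n) 0, norm_zero]
        exact hct
      · have hev := Φ.hasEigenvalue_of_mem (chain_mem Φ J b ⟨0, Nat.pos_of_ne_zero hs⟩)
          (chain_ne_zero Φ J b _)
        exact ((norm_jordanBlock_pow_le hs _ n).trans (jordanBound_mono (norm_nonneg _)
          (size_le_index Φ J b) n)).trans (hn₁ n ((le_max_left _ _).trans hn) _ hev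
            (lt_of_le_of_ne (Φ.norm_eigenvalue_le_one hev) h))
  rw [Φ.pow_sub_eq J hn0]
  calc _ ≤ ‖J.S‖ * ((Φ.K + 1) * (Real.exp 1 / Φ.K) ^ Φ.K * t) * ‖J.Sinv‖ := by
        refine (Matrix.l2_opNorm_mul _ _).trans (mul_le_mul_of_nonneg_right
          ((Matrix.l2_opNorm_mul _ _).trans ?_) (norm_nonneg _))
        exact mul_le_mul_of_nonneg_left hblock (norm_nonneg _)
    _ = _ := by rw [c₂]; ring

end IUMPS
-- Threshold for the size of the middle region, and the main theorem
namespace IUMPS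

variable {d ds : ℕ} (Φ : IUMPS d ds)

open Filter in
lemma exists_pow_sub_small : ∃ n₂ : ℕ, ∀ n, n₂ ≤ n →
    ‖Φ.E ^ n - Φ.Eper ^ n‖ * d ≤ 3 / 4 * Φ.sigmaMin := by
  obtain ⟨C, hC, n₁, hn₁⟩ := Φ.exists_bound_pow_sub
  have h1 := (Φ.tendsto_gap.const_mul C).mul_const (d : ℝ)
  rw [mul_zero, zero_mul] at h1
  have hσ : (0 : ℝ) < 3 / 4 * Φ.sigmaMin := by
    have := Φ.sigmaMin_pos
    positivity
  rw [← eventually_atTop]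
  filter_upwards [h1.eventually (gt_mem_nhds hσ), eventually_ge_atTop n₁] with n hn h
  exact (mul_le_mul_of_nonneg_right (hn₁ n h) (Nat.cast_nonneg d)).trans hn.le

end IUMPS

end MPS

end

open MPS in
theorem mainTheorem2 {d ds : ℕ} (Φ : IUMPS d ds) :
    ∃ (N : ℕ) (p : Fin N → ℕ) (Q : ∀ α, Fin (p α) → Matrix (Fin d) (Fin d) ℂ),
      Φ.IsPeripheralDecomposition p Q ∧
      ∃ (n₀ : ℕ) (c₀ : ℝ), Φ.K < n₀ ∧
        ∀ b : ℕ, n₀ ≤ b →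
          ∃ F : (Fin b → Fin ds) → Matrix (Fin d) (Fin d) ℂ,
            Φ.IsPeripheralDilation F ∧
            ∀ a c : ℕ,
              IsQuantumMarkovChain (Φ.blockState (a := a) (c := c) F) ∧
              traceNorm (Φ.rho a b c - Φ.blockState F) ≤
                c₀ * ((b : ℝ) ^ Φ.K * Φ.nuGap ^ (b - Φ.K)) ∧
              traceNorm (Φ.rho a b c - Φ.blockState F) ≤
                (⨆ α, √(((∑ k, Q α k).rank : ℝ) ^ 3 / p α)) * √(2 / Φ.sigmaMin) *
                  ‖Φ.E ^ b - Φ.Eper ^ b‖ ∧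
              traceNorm (Φ.rho a b c - Φ.blockState F) ≤
                d * √(2 * d / Φ.sigmaMin) * ‖Φ.E ^ b - Φ.Eper ^ b‖ ∧
              ∀ J : JordanDecomposition Φ.E,
                traceNorm (Φ.rho a b c - Φ.blockState F) ≤
                  (⨆ α, √(((∑ k, Q α k).rank : ℝ) ^ 3 / p α)) * Φ.c₂ J * √(2 / Φ.sigmaMin) *
                    ((b : ℝ) ^ Φ.K * Φ.nuGap ^ (b - Φ.K)) ∧
                traceNorm (Φ.rho a b c - Φ.blockState F) ≤
                  Φ.c₂ J * d * √(2 * d / Φ.sigmaMin) *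
                    ((b : ℝ) ^ Φ.K * Φ.nuGap ^ (b - Φ.K)) := by
  obtain ⟨D⟩ := Φ.nonempty_normalForm
  obtain ⟨C, hC, n₁, hn₁⟩ := Φ.exists_bound_pow_sub
  obtain ⟨n₂, hn₂⟩ := Φ.exists_bound_jordan
  obtain ⟨n₃, hn₃⟩ := Φ.exists_pow_sub_small
  have hσ := Φ.sigmaMin_pos
  set G : ℝ := ⨆ α, √(((∑ k : Fin (D.m α), D.R α k).rank : ℝ) ^ 3 / D.m α) with hG
  have hG' : G = ⨆ α, √(((D.blk α).rank : ℝ) ^ 3 / D.m α) := by simp_rw [hG, D.sum_R]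
  have hG0 : 0 ≤ G := Real.iSup_nonneg fun α => Real.sqrt_nonneg _
  -- The bounds in terms of d alone follow from the blockwise ones, because G ≤ d√d.
  have hGd : G * √(2 / Φ.sigmaMin) ≤ d * √(2 * d / Φ.sigmaMin) := by
    have h1 : 2 * (d : ℝ) / Φ.sigmaMin = d * (2 / Φ.sigmaMin) := by ring
    rw [h1, Real.sqrt_mul (Nat.cast_nonneg d), ← mul_assoc, hG']
    exact mul_le_mul_of_nonneg_right D.iSup_le (Real.sqrt_nonneg _)
  -- The threshold exceeds K, lies past the onset of both rate bounds, and makes E^b - Ẽ^b small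
  -- enough for the polar correction. None of its parts depends on A, C or a Jordan decomposition.
  refine ⟨D.N, D.m, fun α k => D.R α k, D.isPeripheralDecomposition,
    Φ.K + 1 + n₁ + n₂ + n₃, G * √(2 / Φ.sigmaMin) * C, by omega, fun b hb => ?_⟩
  obtain ⟨u, hu, hclose⟩ := D.exists_dilation (b := b) (by omega) (hn₃ b (by omega)) hσ
  have hdil := D.isPeripheralDilation_dilation (by omega) hu
  refine ⟨D.dilation u, hdil, fun a c => ?_⟩
  have hmain := D.traceNorm_dilation_le a c hdil.1 hclose
  rw [← hG'] at hmain
  have hmain' : traceNorm (Φ.rho a b c - Φ.blockState (D.dilation u)) ≤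
      d * √(2 * d / Φ.sigmaMin) * ‖Φ.E ^ b - Φ.Eper ^ b‖ :=
    hmain.trans (mul_le_mul_of_nonneg_right hGd (norm_nonneg _))
  refine ⟨⟨Φ.isDensity_blockState hdil.1, D.qcmi_dilation a c hu⟩, ?_, hmain, hmain', fun J => ?_⟩
  · rw [mul_assoc (G * √(2 / Φ.sigmaMin))]
    exact hmain.trans (mul_le_mul_of_nonneg_left (hn₁ b (by omega)) (by positivity))
  · have hJ := hn₂ b (by omega) J
    constructor
    · refine (hmain.trans (mul_le_mul_of_nonneg_left hJ (by positivity))).trans_eq ?_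
      simp only [← hG]
      ring
    · refine (hmain'.trans (mul_le_mul_of_nonneg_left hJ (by positivity))).trans_eq ?_
      ring
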